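/- **Conventions.** Let $k$ be a field, and use Sweedler notation $\Delta(h)=h_1\otimes h_2$, with $\Delta^{cop}(h)=h_2\otimes h_1$. A *quantum groupoid* (weak Hopf algebra) is a $k$-algebra and $k$-coalgebra $(H,\Delta,\varepsilon)$ with $\Delta(hg)=\Delta(h)\Delta(g)$, $$1_1\otimes 1_2\otimes 1_3=1_1\otimes 1_21'_1\otimes 1'_2=1_1\otimes 1'_11_2\otimes 1'_2,\qquad \varepsilon(hgl)=\varepsilon(hg_1)\varepsilon(g_2l)=\varepsilon(hg_2)\varepsilon(g_1l),$$ together with a bijective $k$-linear antipode $S:H\to H$ such that $S*\mathrm{id}=\varepsilon_s$, $\mathrm{id}*S=\varepsilon_t$ and $S*\mathrm{id}*S=S$. Here $*$ is convolution, $\varepsilon_t(h)=\varepsilon(1_1h)1_2$ and $\varepsilon_s(h)=1_1\varepsilon(h1_2)$; put $H_t=\varepsilon_t(H)$ and $H_s=\varepsilon_s(H)$. A quantum groupoid map is a (unital, counital) map of algebras and coalgebras. A quasitriangular structure on $H$ is an element $\mathcal R=R^{(1)}\otimes R^{(2)}\in\Delta^{cop}(1)(H\otimes H)\Delta(1)$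 with $(\mathrm{id}\otimes\Delta)\mathcal R=\mathcal R_{13}\mathcal R_{12}$, $(\Delta\otimes \mathrm{id})\mathcal R=\mathcal R_{13}\mathcal R_{23}$ and $\Delta^{cop}(h)\mathcal R=\mathcal R\Delta(h)$ for all $h\in H$, for which there is $\mathcal R^{-1}\in\Delta(1)(H\otimes H)\Delta^{cop}(1)$ with $\mathcal R\mathcal R^{-1}=\Delta^{cop}(1)$ and $\mathcal R^{-1}\mathcal R=\Delta(1)$. For such $(H,\mathcal R)$, the category ${}_H\mathcal M$ of left $H$-modules is braided monoidal as follows. The tensor product is $V\otimes_tW=\Delta(1)\cdot(V\otimes_k W)$ with action $h\cdot(v\otimes w)=h_1\cdot v\otimes h_2\cdot w$; write $v\otimes_tw=\Delta(1)\cdot(v\otimes w)$. The unit object is $H_t$ with action $h\cdot z=\varepsilon_t(hz)$. The associativity constraint is $(u\otimes_tv)\otimes_tw\mapsto u\otimes_t(v\otimes_tw)$. The unit constraints are $z\otimes_tv\mapsto z\cdot v$ and $v\otimes_tz\mapsto S^{-1}(z)\cdot v$. The braiding is $v\otimes_tw\mapsto R^{(2)}\cdot w\otimes R^{(1)}\cdot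 v$. **Theorem 2.4.** Let $(H,\mathcal R)$ be a quasitriangular quantum groupoid, $L$ a quantum groupoid with antipode $S_L$ and counit $\varepsilon_L$, and $f:H\to L$ a quantum groupoid map. Put $h\cdot l=f(h_1)\,l\,f(S(h_2))$ for $h\in H$, $l\in L$, and let $C=C_L(L_s)=\{l\in L: lx=xl\text{ for all }x\in L_s\}$. Then $h\cdot l$ restricts to a left $H$-module structure on $C$, and $C$ is a Hopf algebra in the braided monoidal category ${}_H\mathcal M$ (in particular the following maps are well defined and are morphisms of $H$-modules, and $C$ is a bialgebra in ${}_H\mathcal M$) with - product $C\otimes_tC\to C$, $a\otimes_tb\mapsto ab$, - unit $H_t\to C$, $z\mapsto f(z)$, - coproduct $C\to C\otimes_tC\subseteq C\otimes_k C\subseteq L\otimes_kL$, $l\mapsto l_1f(S(R^{(2)}))\otimes R^{(1)}\cdot l_2$, - counit $C\to H_t$, $l\mapsto\varepsilon_L(f(1_1)l)1_2$, where $1_1\otimes1_2=\Delta(1_H)$, - antipode $S_{\mathcal R}:C\to C$, $S_{\mathcal R}(l)=f(R^{(2)})\,S_L(R^{(1)}\cdot l)$. -/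

import Mathlib

open scoped TensorProduct
open CategoryTheory

universe u v

namespace QG

section Basic

/-- A weak bialgebra over a field `k`: an algebra and a coalgebra `H` whose comultiplication is
multiplicative (not necessarily unital) and whose unit and counit satisfy the weak compatibility
axioms.  Triple tensors are written in `H ⊗ (H ⊗ H)`. -/
class WeakBialgebra (k : Type v) (H : Type u) [Field k] [Ring H] [Algebra k H]
    extends Coalgebra k H where
  /-- `Δ(a b) = Δ(a) Δ(b)`. -/
  comul_mul : ∀ a b : H, comul (a * b) = comul a * comul b
  /-- `1₁ ⊗ 1₂ ⊗ 1₃ = 1₁ ⊗ 1₂ 1'₁ ⊗ 1'₂`. -/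
  comul_comul_one : comul.lTensor H (comul (1 : H)) =
    TensorProduct.assoc k H H H (comul (1 : H) ⊗ₜ[k] (1 : H)) *
      ((1 : H) ⊗ₜ[k] comul (1 : H))
  /-- `1₁ ⊗ 1₂ ⊗ 1₃ = 1₁ ⊗ 1'₁ 1₂ ⊗ 1'₂`. -/
  comul_comul_one_op : comul.lTensor H (comul (1 : H)) =
    ((1 : H) ⊗ₜ[k] comul (1 : H)) *
      TensorProduct.assoc k H H H (comul (1 : H) ⊗ₜ[k] (1 : H))
  /-- `ε(h g l) = ε(h g₁) ε(g₂ l)`. -/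
  counit_mul_mul : ∀ h g l : H, counit (h * g * l) =
    LinearMap.mul' k k (TensorProduct.map (counit ∘ₗ LinearMap.mulLeft k h)
      (counit ∘ₗ LinearMap.mulRight k l) (comul g))
  /-- `ε(h g l) = ε(h g₂) ε(g₁ l)`. -/
  counit_mul_mul_op : ∀ h g l : H, counit (h * g * l) =
    LinearMap.mul' k k (TensorProduct.map (counit ∘ₗ LinearMap.mulRight k l)
      (counit ∘ₗ LinearMap.mulLeft k h) (comul g))

variable (k : Type v) {H : Type u} [Field k] [Ring H] [Algebra k H]

section Weak

variable [WeakBialgebra k H]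

/-- The comultiplication `Δ`. -/
abbrev Δ : H →ₗ[k] H ⊗[k] H := CoalgebraStruct.comul

/-- The opposite comultiplication `Δ^cop(h) = h₂ ⊗ h₁`. -/
def Δcop : H →ₗ[k] H ⊗[k] H := (TensorProduct.comm k H H).toLinearMap ∘ₗ Δ k

/-- The counit `ε`. -/
abbrev ε : H →ₗ[k] k := CoalgebraStruct.counit

/-- `ε ⊗ id : a ⊗ b ↦ ε(a) b`. -/
def counitLeft : H ⊗[k] H →ₗ[k] H :=
  (TensorProduct.lid k H).toLinearMap ∘ₗ (ε k).rTensor H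

/-- `id ⊗ ε : a ⊗ b ↦ ε(b) a`. -/
def counitRight : H ⊗[k] H →ₗ[k] H :=
  (TensorProduct.rid k H).toLinearMap ∘ₗ (ε k).lTensor H

/-- The target map `ε_t(h) = ε(1₁ h) 1₂`. -/
def targetMap : H →ₗ[k] H :=
  counitLeft k ∘ₗ LinearMap.mulLeft k (Δ k (1 : H)) ∘ₗ (TensorProduct.mk k H H).flip 1

/-- The source map `ε_s(h) = 1₁ ε(h 1₂)`. -/
def sourceMap : H →ₗ[k] H :=
  counitRight k ∘ₗ LinearMap.mulRight k (Δ k (1 : H)) ∘ₗ TensorProduct.mk k H H 1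

/-- The convolution product of two linear endomorphisms, `(f * g)(h) = f(h₁) g(h₂)`. -/
def conv (f g : H →ₗ[k] H) : H →ₗ[k] H :=
  LinearMap.mul' k H ∘ₗ TensorProduct.map f g ∘ₗ Δ k

variable (H) in
/-- The target space `H_t`, the image of `ε_t`. -/
def targetSpace : Submodule k H := LinearMap.range (targetMap k)

variable (H) in
/-- The source space `H_s`, the image of `ε_s`. -/
def sourceSpace : Submodule k H := LinearMap.range (sourceMap k)

variable (H) in
/-- The centralizer `C_H(H_s)` of the source space in `H`. -/
def sourceCentralizer : Subalgebra k H :=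
  Subalgebra.centralizer k (sourceSpace k H : Set H)

end Weak

/-- A quantum groupoid (weak Hopf algebra): a weak bialgebra with an antipode, which is
assumed to be bijective. -/
class QuantumGroupoid (k : Type v) (H : Type u) [Field k] [Ring H] [Algebra k H]
    extends WeakBialgebra k H where
  /-- The antipode `S`. -/
  antipode : H →ₗ[k] H
  /-- `S * id = ε_s`. -/
  antipode_conv_id : conv k antipode LinearMap.id = sourceMap k
  /-- `id * S = ε_t`. -/
  id_conv_antipode : conv k LinearMap.id antipode = targetMap k
  /-- `S * id * S = S`. -/
  antipode_conv_id_conv_antipode : conv k antipode (conv k LinearMap.id antipode) = antipode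
  antipode_bijective : Function.Bijective antipode

section Antipode

variable [QuantumGroupoid k H]

/-- The antipode `S` as a linear automorphism. -/
noncomputable def S : H ≃ₗ[k] H :=
  LinearEquiv.ofBijective QuantumGroupoid.antipode QuantumGroupoid.antipode_bijective

end Antipode

/-- A quasitriangular structure on a quantum groupoid `H`: an element
`R ∈ Δ^cop(1) (H ⊗ H) Δ(1)` with the usual hexagon and intertwining axioms, which has
a weak inverse `R⁻¹ ∈ Δ(1) (H ⊗ H) Δ^cop(1)` (necessarily unique). -/
class Quasitriangular (k : Type v) (H : Type u) [Field k] [Ring H] [Algebra k H]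
    [QuantumGroupoid k H] where
  R : H ⊗[k] H
  Rinv : H ⊗[k] H
  R_mem : ∃ x : H ⊗[k] H, R = Δcop k 1 * x * Δ k 1
  Rinv_mem : ∃ x : H ⊗[k] H, Rinv = Δ k 1 * x * Δcop k 1
  /-- `R R⁻¹ = Δ^cop(1)`. -/
  R_mul_Rinv : R * Rinv = Δcop k 1
  /-- `R⁻¹ R = Δ(1)`. -/
  Rinv_mul_R : Rinv * R = Δ k 1
  /-- `(id ⊗ Δ)(R) = R₁₃ R₁₂`. -/
  id_comul_R : (Δ k).lTensor H R =
    (TensorProduct.mk k H H 1).lTensor H R * TensorProduct.assoc k H H H (R ⊗ₜ[k] 1)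
  /-- `(Δ ⊗ id)(R) = R₁₃ R₂₃`. -/
  comul_id_R : TensorProduct.assoc k H H H ((Δ k).rTensor H R) =
    (TensorProduct.mk k H H 1).lTensor H R * (1 ⊗ₜ[k] R)
  /-- `Δ^cop(h) R = R Δ(h)`. -/
  comulcop_mul_R : ∀ h : H, Δcop k h * R = R * Δ k h

section Identities

variable [WeakBialgebra k H]

theorem Δ_mul (a b : H) : Δ k (a * b) = Δ k a * Δ k b := WeakBialgebra.comul_mul a b

theorem Δ_mul_e (a : H) : Δ k a * Δ k 1 = Δ k a := by rw [← Δ_mul, mul_one]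

theorem e_mul_Δ (a : H) : Δ k 1 * Δ k a = Δ k a := by rw [← Δ_mul, one_mul]

@[simp] theorem counitLeft_tmul (a b : H) : counitLeft k (a ⊗ₜ[k] b) = ε k a • b := by
  simp [counitLeft]

@[simp] theorem counitRight_tmul (a b : H) : counitRight k (a ⊗ₜ[k] b) = ε k b • a := by
  simp [counitRight]

theorem counitLeft_Δ (a : H) : counitLeft k (Δ k a) = a := by
  simp [counitLeft]

theorem counitRight_Δ (a : H) : counitRight k (Δ k a) = a := by
  simp [counitRight]

theorem targetMap_apply (h : H) : targetMap k h = counitLeft k (Δ k 1 * (h ⊗ₜ[k] 1)) := rfl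

/-- `ε_t'(h) = 1₁ ε(1₂ h)`. -/
def barTargetMap : H →ₗ[k] H :=
  counitRight k ∘ₗ LinearMap.mulLeft k (Δ k (1 : H)) ∘ₗ TensorProduct.mk k H H 1

theorem barTargetMap_apply (h : H) :
    barTargetMap k h = counitRight k (Δ k 1 * (1 ⊗ₜ[k] h)) := rfl

theorem counitLeft_mul (t : H ⊗[k] H) (y : H) :
    counitLeft k (t * (1 ⊗ₜ[k] y)) = counitLeft k t * y := by
  induction t using TensorProduct.induction_on with
  | zero => simp
  | tmul a b => simp
  | add a b ha hb => simp [add_mul, ha, hb]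

theorem counitRight_mul (t : H ⊗[k] H) (y : H) :
    counitRight k (t * (y ⊗ₜ[k] 1)) = counitRight k t * y := by
  induction t using TensorProduct.induction_on with
  | zero => simp
  | tmul a b => simp
  | add a b ha hb => simp [add_mul, ha, hb]

theorem mul_targetMap (t : H ⊗[k] H) :
    LinearMap.mul' k H (TensorProduct.map (targetMap k) LinearMap.id t) =
      counitLeft k (Δ k 1 * t) := by
  induction t using TensorProduct.induction_on with
  | zero => simp
  | tmul a b =>
    have : a ⊗ₜ[k] b = (a ⊗ₜ[k] 1) * ((1 : H) ⊗ₜ[k] b) := by simp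
    rw [this, ← mul_assoc, counitLeft_mul, ← targetMap_apply]
    simp
  | add a b ha hb => simp [mul_add, ha, hb]

theorem mul_barTargetMap (t : H ⊗[k] H) :
    LinearMap.mul' k H (TensorProduct.comm k H H
      (TensorProduct.map LinearMap.id (barTargetMap k) t)) = counitRight k (Δ k 1 * t) := by
  induction t using TensorProduct.induction_on with
  | zero => simp
  | tmul a b =>
    have : a ⊗ₜ[k] b = ((1 : H) ⊗ₜ[k] b) * (a ⊗ₜ[k] 1) := by simp
    rw [this, ← mul_assoc, counitRight_mul, ← barTargetMap_apply]
    simp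
  | add a b ha hb => simp [mul_add, ha, hb]

theorem counit_mul_targetMap (g h : H) : ε k (g * targetMap k h) = ε k (g * h) := by
  have h1 := WeakBialgebra.counit_mul_mul_op (k := k) g 1 h
  rw [mul_one] at h1
  rw [h1, targetMap_apply]
  generalize Δ k (1 : H) = t
  induction t using TensorProduct.induction_on with
  | zero => simp
  | tmul a b => simp
  | add a b ha hb => simp [add_mul, mul_add, ha, hb]

theorem counit_mul_barTargetMap (g h : H) : ε k (g * barTargetMap k h) = ε k (g * h) := by
  have h1 := WeakBialgebra.counit_mul_mul (k := k) g 1 h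
  rw [mul_one] at h1
  rw [h1, barTargetMap_apply]
  generalize Δ k (1 : H) = t
  induction t using TensorProduct.induction_on with
  | zero => simp
  | tmul a b => simp [mul_comm]
  | add a b ha hb => simp [add_mul, mul_add, ha, hb]

theorem counitLeft_congr {x y : H} (hxy : ∀ g : H, ε k (g * x) = ε k (g * y)) (t : H ⊗[k] H) :
    counitLeft k (t * (x ⊗ₜ[k] 1)) = counitLeft k (t * (y ⊗ₜ[k] 1)) := by
  induction t using TensorProduct.induction_on with
  | zero => simp
  | tmul a b => simp [hxy]
  | add a b ha hb => simp [add_mul, ha, hb]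

theorem targetMap_mul_targetMap (g h : H) : targetMap k (g * targetMap k h) = targetMap k (g * h) :=
  counitLeft_congr k (fun x => by
    rw [← mul_assoc, counit_mul_targetMap, mul_assoc]) _

@[simp] theorem targetMap_targetMap (h : H) : targetMap k (targetMap k h) = targetMap k h := by
  simpa using targetMap_mul_targetMap k 1 h

theorem targetMap_barTargetMap (h : H) : targetMap k (barTargetMap k h) = targetMap k h :=
  counitLeft_congr k (fun x => counit_mul_barTargetMap k x h) _

theorem targetMap_one : targetMap k (1 : H) = 1 := by
  rw [targetMap_apply, ← Algebra.TensorProduct.one_def, mul_one, counitLeft_Δ]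

/-- `p ⊗ t ↦ ε(p x) t`. -/
def contractLeft (x : H) : H ⊗[k] (H ⊗[k] H) →ₗ[k] H ⊗[k] H :=
  (TensorProduct.lid k (H ⊗[k] H)).toLinearMap ∘ₗ
    (ε k ∘ₗ LinearMap.mulRight k x).rTensor (H ⊗[k] H)

@[simp] theorem contractLeft_tmul (x p : H) (t : H ⊗[k] H) :
    contractLeft k x (p ⊗ₜ[k] t) = ε k (p * x) • t := by simp [contractLeft]

/-- `p ⊗ q ⊗ r ↦ ε(r x) p ⊗ q`. -/
def contractRight (x : H) : H ⊗[k] (H ⊗[k] H) →ₗ[k] H ⊗[k] H :=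
  (TensorProduct.rid k (H ⊗[k] H)).toLinearMap ∘ₗ
    (ε k ∘ₗ LinearMap.mulRight k x).lTensor (H ⊗[k] H) ∘ₗ
      (TensorProduct.assoc k H H H).symm.toLinearMap

@[simp] theorem contractRight_tmul (x p q r : H) :
    contractRight k x (p ⊗ₜ[k] (q ⊗ₜ[k] r)) = ε k (r * x) • (p ⊗ₜ[k] q) := by
  simp [contractRight]

theorem Δ_counitLeft (x : H) (t : H ⊗[k] H) :
    Δ k (counitLeft k (t * (x ⊗ₜ[k] 1))) = contractLeft k x ((Δ k).lTensor H t) := by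
  induction t using TensorProduct.induction_on with
  | zero => simp
  | tmul a b => simp
  | add a b ha hb => simp [add_mul, ha, hb]

theorem Δ_counitRight (x : H) (t : H ⊗[k] H) :
    Δ k (counitRight k (t * (1 ⊗ₜ[k] x))) =
      contractRight k x (TensorProduct.assoc k H H H ((Δ k).rTensor H t)) := by
  induction t using TensorProduct.induction_on with
  | zero => simp
  | tmul a b => simp [contractRight]
  | add a b ha hb => simp [add_mul, ha, hb]

theorem coassoc_e (a : H) : TensorProduct.assoc k H H H ((Δ k).rTensor H (Δ k a)) =
    (Δ k).lTensor H (Δ k a) := Coalgebra.coassoc_apply a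

theorem Δ_targetMap (x : H) : Δ k (targetMap k x) = Δ k 1 * (targetMap k x ⊗ₜ[k] 1) := by
  rw [targetMap_apply, Δ_counitLeft, WeakBialgebra.comul_comul_one_op]
  generalize Δ k (1 : H) = s
  suffices ∀ t : H ⊗[k] H, contractLeft k x ((1 ⊗ₜ[k] s) *
      TensorProduct.assoc k H H H (t ⊗ₜ[k] 1)) =
      s * (counitLeft k (t * (x ⊗ₜ[k] 1)) ⊗ₜ[k] 1) from this s
  intro t
  induction t using TensorProduct.induction_on with
  | zero => simp
  | tmul a b => simp [← TensorProduct.smul_tmul']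
  | add a b ha hb => simp [add_mul, mul_add, TensorProduct.add_tmul, ha, hb]

theorem Δ_targetMap_op (x : H) : Δ k (targetMap k x) = (targetMap k x ⊗ₜ[k] 1) * Δ k 1 := by
  rw [targetMap_apply, Δ_counitLeft, WeakBialgebra.comul_comul_one]
  generalize Δ k (1 : H) = s
  suffices ∀ t : H ⊗[k] H, contractLeft k x (
      TensorProduct.assoc k H H H (t ⊗ₜ[k] 1) * (1 ⊗ₜ[k] s)) =
      (counitLeft k (t * (x ⊗ₜ[k] 1)) ⊗ₜ[k] 1) * s from this s
  intro t
  induction t using TensorProduct.induction_on with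
  | zero => simp
  | tmul a b => simp [← TensorProduct.smul_tmul']
  | add a b ha hb => simp [add_mul, TensorProduct.add_tmul, ha, hb]

theorem Δ_barTargetMap (x : H) :
    Δ k (barTargetMap k x) = Δ k 1 * (1 ⊗ₜ[k] barTargetMap k x) := by
  rw [barTargetMap_apply, Δ_counitRight, coassoc_e, WeakBialgebra.comul_comul_one]
  suffices ∀ s t : H ⊗[k] H, contractRight k x (
      TensorProduct.assoc k H H H (s ⊗ₜ[k] 1) * (1 ⊗ₜ[k] t)) =
      s * (1 ⊗ₜ[k] counitRight k (t * (1 ⊗ₜ[k] x))) from this _ _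
  intro s t
  induction t using TensorProduct.induction_on with
  | zero => simp
  | tmul a b =>
    induction s using TensorProduct.induction_on with
    | zero => simp
    | tmul c d => simp
    | add c d hc hd => simp only [map_add, add_mul, TensorProduct.add_tmul, hc, hd]
  | add a b ha hb => simp only [map_add, add_mul, mul_add, TensorProduct.tmul_add, ha, hb]

/-- `h₁ ⊗ ε_t(h₂) = 1₁ h ⊗ 1₂`. -/
theorem id_targetMap_Δ (h : H) :
    (targetMap k).lTensor H (Δ k h) = Δ k 1 * (h ⊗ₜ[k] 1) := by
  let Θ : (H ⊗[k] H) ⊗[k] H →ₗ[k] H ⊗[k] H :=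
    (counitRight k ∘ₗ LinearMap.mulRight k (Δ k h)).rTensor H
  have key1 : ∀ t : H ⊗[k] H, Θ ((Δ k).rTensor H t) = t * (h ⊗ₜ[k] 1) := by
    intro t
    induction t using TensorProduct.induction_on with
    | zero => simp
    | tmul a b => simp [Θ, ← Δ_mul, counitRight_Δ]
    | add a b ha hb => simp [add_mul, ha, hb]
  have key2 : ∀ s t u : H ⊗[k] H,
      (counitRight k ∘ₗ LinearMap.mulRight k u).rTensor H
      ((TensorProduct.assoc k H H H).symm ((1 ⊗ₜ[k] s) *
        TensorProduct.assoc k H H H (t ⊗ₜ[k] 1))) =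
      (counitLeft k ∘ₗ LinearMap.mulLeft k s ∘ₗ (TensorProduct.mk k H H).flip 1).lTensor H
        (t * u) := by
    intro s t u
    induction s using TensorProduct.induction_on with
    | zero => simp
    | add a b ha hb =>
      simp only [TensorProduct.tmul_add, add_mul, map_add, ha, hb, LinearMap.lTensor_comp_apply]
      simp only [← LinearMap.lTensor_comp_apply, ← LinearMap.add_apply,
        ← LinearMap.lTensor_add]
      congr 2
      ext x
      simp [add_mul]
    | tmul a b =>
      induction t using TensorProduct.induction_on with
      | zero => simp
      | add c d hc hd => simp only [TensorProduct.add_tmul, mul_add, add_mul, map_add, hc, hd]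
      | tmul c d =>
        induction u using TensorProduct.induction_on with
        | zero => simp
        | add p q hp hq =>
          rw [mul_add, map_add, ← hp, ← hq]
          simp [mul_add, TensorProduct.add_tmul]
        | tmul p q =>
          simp [TensorProduct.smul_tmul, mul_assoc]
  have h2 := key2 (Δ k 1) (Δ k 1) (Δ k h)
  rw [← WeakBialgebra.comul_comul_one_op, ← coassoc_e, LinearEquiv.symm_apply_apply,
    e_mul_Δ] at h2
  have h3 := key1 (Δ k 1)
  rw [← h3]
  exact h2.symm

end Identities

section AntipodeIdentities

variable [QuantumGroupoid k H]

theorem targetMap_eq_conv (h : H) :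
    targetMap k h = LinearMap.mul' k H ((S k).toLinearMap.lTensor H (Δ k h)) := by
  rw [← QuantumGroupoid.id_conv_antipode]
  rfl

theorem targetMap_targetMap_mul (x h : H) :
    targetMap k (targetMap k x * h) = targetMap k x * targetMap k h := by
  rw [targetMap_eq_conv k (targetMap k x * h), targetMap_eq_conv k h, Δ_mul, Δ_targetMap_op,
    mul_assoc, e_mul_Δ]
  generalize Δ k h = t
  induction t using TensorProduct.induction_on with
  | zero => simp
  | tmul a b => simp [mul_assoc]
  | add a b ha hb => simp only [mul_add, map_add, ha, hb]

theorem e_eq_id_targetMap : (Δ k (1 : H)) = (targetMap k).lTensor H (Δ k 1) := by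
  rw [id_targetMap_Δ, ← Algebra.TensorProduct.one_def, mul_one]

/-- `Δ(1) (1 ⊗ ε_t(x)) = Δ(1) (ε_t'(x) ⊗ 1)`. -/
theorem e_mul_tmul_targetMap (x : H) :
    Δ k 1 * (1 ⊗ₜ[k] targetMap k x) = Δ k 1 * (barTargetMap k x ⊗ₜ[k] 1) := by
  rw [← id_targetMap_Δ k (barTargetMap k x), Δ_barTargetMap, e_eq_id_targetMap k]
  generalize Δ k (1 : H) = t
  induction t using TensorProduct.induction_on with
  | zero => simp
  | tmul a b => simp [targetMap_targetMap_mul, targetMap_barTargetMap]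
  | add a b ha hb => simp only [add_mul, map_add, ha, hb]

theorem S_e : LinearMap.mul' k H ((S k).toLinearMap.rTensor H (Δ k 1)) = 1 := by
  have h1 : conv k (S k (H := H)).toLinearMap LinearMap.id = sourceMap k :=
    QuantumGroupoid.antipode_conv_id
  have h2 := LinearMap.congr_fun h1 1
  have h3 : sourceMap k (1 : H) = counitRight k ((1 ⊗ₜ[k] 1) * Δ k 1) := rfl
  rw [h3, ← Algebra.TensorProduct.one_def, one_mul, counitRight_Δ] at h2
  exact h2

theorem S_barTargetMap (x : H) : S k (barTargetMap k x) = targetMap k x := by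
  have h1 : conv k (S k (H := H)).toLinearMap (conv k LinearMap.id (S k).toLinearMap) =
    (S k).toLinearMap := QuantumGroupoid.antipode_conv_id_conv_antipode
  have h2 : conv k LinearMap.id (S k).toLinearMap = targetMap k (H := H) :=
    QuantumGroupoid.id_conv_antipode
  rw [h2] at h1
  have h3 := LinearMap.congr_fun h1 (barTargetMap k x)
  have h4 : conv k (S k).toLinearMap (targetMap k) (barTargetMap k x) =
    LinearMap.mul' k H (TensorProduct.map (S k).toLinearMap (targetMap k)
      (Δ k (barTargetMap k x))) := rfl
  rw [h4, Δ_barTargetMap, e_eq_id_targetMap k] at h3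
  have h5 : ∀ t : H ⊗[k] H, LinearMap.mul' k H
      (TensorProduct.map (S k).toLinearMap (targetMap k)
        ((targetMap k).lTensor H t * (1 ⊗ₜ[k] barTargetMap k x))) =
      LinearMap.mul' k H ((S k).toLinearMap.rTensor H ((targetMap k).lTensor H t)) *
        targetMap k x := by
    intro t
    induction t using TensorProduct.induction_on with
    | zero => simp
    | tmul a b => simp [targetMap_targetMap_mul, targetMap_barTargetMap, mul_assoc]
    | add a b ha hb => simp only [add_mul, map_add, ha, hb]
  rw [h5, ← e_eq_id_targetMap, S_e, one_mul] at h3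
  exact h3.symm

theorem S_symm_targetMap (x : H) : (S k).symm (targetMap k x) = barTargetMap k x := by
  rw [← S_barTargetMap, LinearEquiv.symm_apply_apply]

end AntipodeIdentities

end Basic

/-! ### The category of left modules -/

/-- A left `H`-module, as a `k`-vector space with an algebra map `H → End_k`. -/
structure LMod (k : Type v) (H : Type u) [Field k] [Ring H] [Algebra k H] where
  /-- The underlying vector space. -/
  carrier : Type u
  [addCommGroup : AddCommGroup carrier]
  [module : Module k carrier]
  /-- The action. -/
  ρ : H →ₐ[k] Module.End k carrier

namespace LMod

attribute [instance] LMod.addCommGroup LMod.module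

variable {k : Type v} {H : Type u} [Field k] [Ring H] [Algebra k H]

/-- The left `H`-module given by an action on a vector space. -/
abbrev of {V : Type u} [AddCommGroup V] [Module k V] (ρ : H →ₐ[k] Module.End k V) : LMod k H where
  carrier := V
  ρ := ρ

/-- `H`-linear maps. -/
@[ext] structure Hom (X Y : LMod k H) where
  toLin : X.carrier →ₗ[k] Y.carrier
  comm : ∀ (h : H) (x : X.carrier), toLin (X.ρ h x) = Y.ρ h (toLin x)

/-- The category `_H M` of left `H`-modules. -/
instance : Category (LMod k H) where
  Hom := Hom
  id X := ⟨LinearMap.id, fun _ _ => rfl⟩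
  comp f g := ⟨g.toLin ∘ₗ f.toLin, fun h x => by
    rw [LinearMap.comp_apply, f.comm, g.comm, LinearMap.comp_apply]⟩

/-- The underlying linear map of a morphism. -/
abbrev lin {X Y : LMod k H} (f : X ⟶ Y) : X.carrier →ₗ[k] Y.carrier := Hom.toLin f

theorem lin_comm {X Y : LMod k H} (f : X ⟶ Y) (h : H) (x : X.carrier) :
    lin f (X.ρ h x) = Y.ρ h (lin f x) := Hom.comm f h x

theorem hom_ext {X Y : LMod k H} {f g : X ⟶ Y} (w : ∀ x, lin f x = lin g x) : f = g :=
  Hom.ext (LinearMap.ext w)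

@[simp] theorem lin_id (X : LMod k H) (x : X.carrier) : lin (𝟙 X) x = x := rfl

@[simp] theorem lin_comp {X Y Z : LMod k H} (f : X ⟶ Y) (g : Y ⟶ Z) (x : X.carrier) :
    lin (f ≫ g) x = lin g (lin f x) := rfl

/-- An isomorphism from a bijective `H`-linear map with an explicit inverse. -/
def mkIso {X Y : LMod k H} (f : X.carrier →ₗ[k] Y.carrier) (g : Y.carrier →ₗ[k] X.carrier)
    (hf : ∀ (h : H) (x : X.carrier), f (X.ρ h x) = Y.ρ h (f x))
    (hgf : ∀ x, g (f x) = x) (hfg : ∀ y, f (g y) = y) : X ≅ Y where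
  hom := ⟨f, hf⟩
  inv := ⟨g, fun h y => by rw [← hgf (X.ρ h (g y)), hf, hfg]⟩
  hom_inv_id := hom_ext hgf
  inv_hom_id := hom_ext hfg

/-- The action of `H ⊗ H` on `X ⊗ Y`. -/
noncomputable def act₂ (X Y : LMod k H) :
    H ⊗[k] H →ₐ[k] Module.End k (X.carrier ⊗[k] Y.carrier) :=
  Module.endTensorEndAlgHom.comp (Algebra.TensorProduct.map X.ρ Y.ρ)

@[simp] theorem act₂_tmul (X Y : LMod k H) (a b : H) (x : X.carrier) (y : Y.carrier) :
    act₂ X Y (a ⊗ₜ[k] b) (x ⊗ₜ[k] y) = X.ρ a x ⊗ₜ[k] Y.ρ b y := rfl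

theorem act₂_mul (X Y : LMod k H) (s t : H ⊗[k] H) (x : X.carrier ⊗[k] Y.carrier) :
    act₂ X Y s (act₂ X Y t x) = act₂ X Y (s * t) x := by
  rw [map_mul]; rfl

theorem map_act₂ {X Y X' Y' : LMod k H} (f : X ⟶ X') (g : Y ⟶ Y') (t : H ⊗[k] H)
    (x : X.carrier ⊗[k] Y.carrier) :
    TensorProduct.map (lin f) (lin g) (act₂ X Y t x) =
      act₂ X' Y' t (TensorProduct.map (lin f) (lin g) x) := by
  induction t using TensorProduct.induction_on with
  | zero => simp
  | add a b ha hb => simp only [map_add, LinearMap.add_apply, ha, hb]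
  | tmul a b =>
    induction x using TensorProduct.induction_on with
    | zero => simp
    | add x y hx hy => simp only [map_add, hx, hy]
    | tmul x y => simp [lin_comm]

theorem comm_act₂ (X Y : LMod k H) (t : H ⊗[k] H) (x : X.carrier ⊗[k] Y.carrier) :
    TensorProduct.comm k _ _ (act₂ X Y t x) =
      act₂ Y X (TensorProduct.comm k H H t) (TensorProduct.comm k _ _ x) := by
  induction t using TensorProduct.induction_on with
  | zero => simp
  | add a b ha hb => simp only [map_add, LinearMap.add_apply, ha, hb]
  | tmul a b =>
    induction x using TensorProduct.induction_on with
    | zero => simp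
    | add x y hx hy => simp only [map_add, hx, hy]
    | tmul x y => simp

section Tensor

variable [QuantumGroupoid k H]

/-- The underlying space `X ⊗_t Y = Δ(1) · (X ⊗ Y)`, a subspace of `X ⊗ Y`. -/
noncomputable def tensorSpace (X Y : LMod k H) : Submodule k (X.carrier ⊗[k] Y.carrier) :=
  LinearMap.range (act₂ X Y (Δ k 1))

/-- The left `H`-module `X ⊗_t Y = Δ(1) · (X ⊗ Y)`, with `h · (x ⊗ y) = h₁ · x ⊗ h₂ · y`. -/
noncomputable def tensor (X Y : LMod k H) : LMod k H where
  carrier := tensorSpace X Y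
  ρ := AlgHom.ofLinearMap
    { toFun := fun h =>
        (act₂ X Y (Δ k h)).restrict (p := tensorSpace X Y) (q := tensorSpace X Y) (by
          rintro _ ⟨y, rfl⟩
          exact ⟨act₂ X Y (Δ k h) y, by rw [act₂_mul, act₂_mul, e_mul_Δ, Δ_mul_e]⟩)
      map_add' := fun a b => by ext x; simp
      map_smul' := fun c a => by ext x; simp }
    (by
      ext ⟨_, y, rfl⟩
      simp [act₂_mul, e_mul_Δ, -map_mul, -Module.End.mul_apply])
    (fun a b => by
      ext x
      simp [Δ_mul])

/-- The inclusion `X ⊗_t Y → X ⊗ Y`. -/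
noncomputable def incl (X Y : LMod k H) :
    (tensor X Y).carrier →ₗ[k] X.carrier ⊗[k] Y.carrier :=
  (tensorSpace X Y).subtype

/-- The projection `X ⊗ Y → X ⊗_t Y`, `t ↦ Δ(1) · t`. -/
noncomputable def proj (X Y : LMod k H) :
    X.carrier ⊗[k] Y.carrier →ₗ[k] (tensor X Y).carrier :=
  (act₂ X Y (Δ k 1)).rangeRestrict

@[simp] theorem incl_proj (X Y : LMod k H) (t : X.carrier ⊗[k] Y.carrier) :
    incl X Y (proj X Y t) = act₂ X Y (Δ k 1) t := rfl

theorem proj_surj (X Y : LMod k H) (t : (tensor X Y).carrier) : ∃ s, proj X Y s = t :=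
  LinearMap.surjective_rangeRestrict _ t

theorem incl_injective (X Y : LMod k H) : Function.Injective (incl X Y) :=
  Subtype.val_injective

theorem proj_act_e (X Y : LMod k H) (t : X.carrier ⊗[k] Y.carrier) :
    proj X Y (act₂ X Y (Δ k 1) t) = proj X Y t := by
  apply incl_injective
  rw [incl_proj, incl_proj, act₂_mul, Δ_mul_e]

@[simp] theorem proj_incl (X Y : LMod k H) (t : (tensor X Y).carrier) :
    proj X Y (incl X Y t) = t := by
  obtain ⟨s, rfl⟩ := proj_surj X Y t
  rw [incl_proj, proj_act_e]

theorem incl_ρ (X Y : LMod k H) (h : H) (t : (tensor X Y).carrier) :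
    incl X Y ((tensor X Y).ρ h t) = act₂ X Y (Δ k h) (incl X Y t) := rfl

theorem tensor_ρ (X Y : LMod k H) (h : H) (t : X.carrier ⊗[k] Y.carrier) :
    (tensor X Y).ρ h (proj X Y t) = proj X Y (act₂ X Y (Δ k h) t) := by
  apply incl_injective
  rw [incl_ρ, incl_proj, incl_proj, act₂_mul, act₂_mul, Δ_mul_e, e_mul_Δ]

/-- The element `x ⊗_t y = Δ(1) · (x ⊗ y)`. -/
noncomputable def tm {X Y : LMod k H} (x : X.carrier) (y : Y.carrier) : (tensor X Y).carrier :=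
  proj X Y (x ⊗ₜ[k] y)

theorem tensor_ind {X Y : LMod k H} {p : (tensor X Y).carrier → Prop}
    (h0 : p 0) (hadd : ∀ s t, p s → p t → p (s + t))
    (htm : ∀ (x : X.carrier) (y : Y.carrier), p (tm x y)) (t : (tensor X Y).carrier) : p t := by
  obtain ⟨s, rfl⟩ := proj_surj X Y t
  induction s using TensorProduct.induction_on with
  | zero => rw [map_zero]; exact h0
  | tmul x y => exact htm x y
  | add a b ha hb => rw [map_add]; exact hadd _ _ ha hb

theorem tm_ext {X Y : LMod k H} {V : Type*} [AddCommGroup V] [Module k V]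
    {f g : (tensor X Y).carrier →ₗ[k] V} (w : ∀ x y, f (tm x y) = g (tm x y))
    (t : (tensor X Y).carrier) : f t = g t := by
  induction t using tensor_ind with
  | h0 => simp
  | hadd s t hs ht => simp only [map_add, hs, ht]
  | htm x y => exact w x y

/-- `tm` as a bilinear map. -/
noncomputable def tmL (X Y : LMod k H) :
    X.carrier →ₗ[k] Y.carrier →ₗ[k] (tensor X Y).carrier :=
  (TensorProduct.mk k X.carrier Y.carrier).compr₂ (proj X Y)

theorem tm_zero_left {X Y : LMod k H} (y : Y.carrier) : tm (0 : X.carrier) y = 0 :=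
  LinearMap.map_zero₂ (tmL X Y) y

theorem tm_zero_right {X Y : LMod k H} (x : X.carrier) : tm x (0 : Y.carrier) = 0 :=
  map_zero (tmL X Y x)

theorem tm_add_left {X Y : LMod k H} (x x' : X.carrier) (y : Y.carrier) :
    tm (x + x') y = tm x y + tm x' y := LinearMap.map_add₂ (tmL X Y) x x' y

theorem tm_add_right {X Y : LMod k H} (x : X.carrier) (y y' : Y.carrier) :
    tm x (y + y') = tm x y + tm x y' := map_add (tmL X Y x) y y'

theorem tm_ext_left {X Y Z : LMod k H} {V : Type*} [AddCommGroup V] [Module k V]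
    {f g : (tensor (tensor X Y) Z).carrier →ₗ[k] V}
    (w : ∀ x y z, f (tm (tm x y) z) = g (tm (tm x y) z))
    (t : (tensor (tensor X Y) Z).carrier) : f t = g t :=
  tm_ext (fun s z => tm_ext (f := f ∘ₗ (tmL (tensor X Y) Z).flip z)
    (g := g ∘ₗ (tmL (tensor X Y) Z).flip z) (fun x y => w x y z) s) t

theorem tm_ext_right {X Y Z : LMod k H} {V : Type*} [AddCommGroup V] [Module k V]
    {f g : (tensor X (tensor Y Z)).carrier →ₗ[k] V}
    (w : ∀ x y z, f (tm x (tm y z)) = g (tm x (tm y z)))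
    (t : (tensor X (tensor Y Z)).carrier) : f t = g t :=
  tm_ext (fun x s => tm_ext (f := f ∘ₗ tmL X (tensor Y Z) x)
    (g := g ∘ₗ tmL X (tensor Y Z) x) (fun y z => w x y z) s) t

theorem tm_ext_left_left {W X Y Z : LMod k H} {V : Type*} [AddCommGroup V] [Module k V]
    {f g : (tensor (tensor (tensor W X) Y) Z).carrier →ₗ[k] V}
    (w : ∀ v x y z, f (tm (tm (tm v x) y) z) = g (tm (tm (tm v x) y) z))
    (t : (tensor (tensor (tensor W X) Y) Z).carrier) : f t = g t :=
  tm_ext (fun s z => tm_ext_left (f := f ∘ₗ (tmL (tensor (tensor W X) Y) Z).flip z)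
    (g := g ∘ₗ (tmL (tensor (tensor W X) Y) Z).flip z) (fun v x y => w v x y z) s) t

/-- The tensor product of morphisms. -/
noncomputable def tensorMap {X Y X' Y' : LMod k H} (f : X ⟶ X') (g : Y ⟶ Y') :
    tensor X Y ⟶ tensor X' Y' where
  toLin := proj X' Y' ∘ₗ TensorProduct.map (lin f) (lin g) ∘ₗ incl X Y
  comm h x := by
    obtain ⟨s, rfl⟩ := proj_surj X Y x
    rw [tensor_ρ]
    simp only [LinearMap.comp_apply, incl_proj, map_act₂, proj_act_e]
    rw [tensor_ρ]

@[simp] theorem tensorMap_proj {X Y X' Y' : LMod k H} (f : X ⟶ X') (g : Y ⟶ Y')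
    (s : X.carrier ⊗[k] Y.carrier) :
    lin (tensorMap f g) (proj X Y s) = proj X' Y' (TensorProduct.map (lin f) (lin g) s) := by
  change proj X' Y' (TensorProduct.map (lin f) (lin g) (incl X Y (proj X Y s))) = _
  rw [incl_proj, map_act₂, proj_act_e]

@[simp] theorem tensorMap_tm {X Y X' Y' : LMod k H} (f : X ⟶ X') (g : Y ⟶ Y')
    (x : X.carrier) (y : Y.carrier) :
    lin (tensorMap f g) (tm x y) = tm (lin f x) (lin g y) :=
  tensorMap_proj f g _

section Associator

variable (X Y Z : LMod k H)

/-- The associator, induced by `(x ⊗ y) ⊗ z ↦ x ⊗ (y ⊗ z)`. -/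
noncomputable def assocLin :
    (tensor (tensor X Y) Z).carrier →ₗ[k] (tensor X (tensor Y Z)).carrier :=
  proj X (tensor Y Z) ∘ₗ (proj Y Z).lTensor X.carrier ∘ₗ
    (TensorProduct.assoc k X.carrier Y.carrier Z.carrier).toLinearMap ∘ₗ
    (incl X Y).rTensor Z.carrier ∘ₗ incl (tensor X Y) Z

/-- The inverse associator, induced by `x ⊗ (y ⊗ z) ↦ (x ⊗ y) ⊗ z`. -/
noncomputable def assocInvLin :
    (tensor X (tensor Y Z)).carrier →ₗ[k] (tensor (tensor X Y) Z).carrier :=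
  proj (tensor X Y) Z ∘ₗ (proj X Y).rTensor Z.carrier ∘ₗ
    (TensorProduct.assoc k X.carrier Y.carrier Z.carrier).symm.toLinearMap ∘ₗ
    (incl Y Z).lTensor X.carrier ∘ₗ incl X (tensor Y Z)

/-- `H ⊗ (H ⊗ H)` acting on `x ⊗ (y ⊗ z)` and projected to `X ⊗_t (Y ⊗_t Z)`. -/
noncomputable def act₃ (x : X.carrier) (y : Y.carrier) (z : Z.carrier) :
    H ⊗[k] (H ⊗[k] H) →ₗ[k] (tensor X (tensor Y Z)).carrier :=
  proj X (tensor Y Z) ∘ₗ TensorProduct.map (LinearMap.applyₗ x ∘ₗ X.ρ.toLinearMap)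
    (proj Y Z ∘ₗ LinearMap.applyₗ (y ⊗ₜ[k] z) ∘ₗ (act₂ Y Z).toLinearMap)

@[simp] theorem act₃_tmul (x : X.carrier) (y : Y.carrier) (z : Z.carrier) (a : H)
    (t : H ⊗[k] H) : act₃ X Y Z x y z (a ⊗ₜ[k] t) =
      tm (X.ρ a x) (proj Y Z (act₂ Y Z t (y ⊗ₜ[k] z))) := rfl

theorem tm_proj_right (x : X.carrier) (y : Y.carrier) (z : Z.carrier) (t : H ⊗[k] H) :
    act₃ X Y Z x y z ((Δ k).lTensor H t) =
      proj X (tensor Y Z) (act₂ X (tensor Y Z) t (x ⊗ₜ[k] (tm y z))) := by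
  induction t using TensorProduct.induction_on with
  | zero => simp only [map_zero, LinearMap.zero_apply]
  | add a b ha hb => simp only [map_add, LinearMap.add_apply, ha, hb]
  | tmul a b =>
    rw [LinearMap.lTensor_tmul, act₃_tmul, ← tensor_ρ]
    rfl

theorem assocLin_raw (x : X.carrier) (y : Y.carrier) (z : Z.carrier) (t : H ⊗[k] H) :
    proj X (tensor Y Z) ((proj Y Z).lTensor X.carrier
      (TensorProduct.assoc k X.carrier Y.carrier Z.carrier ((incl X Y).rTensor Z.carrier
        (act₂ (tensor X Y) Z t (tm x y ⊗ₜ[k] z))))) =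
    act₃ X Y Z x y z (TensorProduct.assoc k H H H ((Δ k).rTensor H t)) := by
  induction t using TensorProduct.induction_on with
  | zero => simp only [map_zero, LinearMap.zero_apply]
  | add a b ha hb => simp only [map_add, LinearMap.add_apply, ha, hb]
  | tmul a b =>
    rw [act₂_tmul, LinearMap.rTensor_tmul, LinearMap.rTensor_tmul, tm, tensor_ρ,
      incl_proj, act₂_mul, e_mul_Δ]
    generalize Δ k a = s
    induction s using TensorProduct.induction_on with
    | zero => simp
    | add a b ha hb =>
      simp only [map_add, LinearMap.add_apply, TensorProduct.add_tmul, ha, hb]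
    | tmul c d => simp; rfl

theorem assocLin_act (x : X.carrier) (y : Y.carrier) (z : Z.carrier) (h : H) :
    assocLin X Y Z ((tensor (tensor X Y) Z).ρ h (tm (tm x y) z)) =
      (tensor X (tensor Y Z)).ρ h (tm x (tm y z)) := by
  unfold assocLin
  conv_lhs => rw [tm]
  rw [tensor_ρ]
  simp only [LinearMap.comp_apply, incl_proj, LinearEquiv.coe_coe, act₂_mul, e_mul_Δ]
  rw [assocLin_raw, coassoc_e, tm_proj_right, ← tensor_ρ]
  rfl

@[simp] theorem assocLin_tm (x : X.carrier) (y : Y.carrier) (z : Z.carrier) :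
    assocLin X Y Z (tm (tm x y) z) = tm x (tm y z) := by
  simpa using assocLin_act X Y Z x y z 1

/-- `(H ⊗ H) ⊗ H` acting on `(x ⊗ y) ⊗ z` and projected to `(X ⊗_t Y) ⊗_t Z`. -/
noncomputable def act₃' (x : X.carrier) (y : Y.carrier) (z : Z.carrier) :
    (H ⊗[k] H) ⊗[k] H →ₗ[k] (tensor (tensor X Y) Z).carrier :=
  proj (tensor X Y) Z ∘ₗ TensorProduct.map
    (proj X Y ∘ₗ LinearMap.applyₗ (x ⊗ₜ[k] y) ∘ₗ (act₂ X Y).toLinearMap)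
    (LinearMap.applyₗ z ∘ₗ Z.ρ.toLinearMap)

@[simp] theorem act₃'_tmul (x : X.carrier) (y : Y.carrier) (z : Z.carrier) (a : H)
    (t : H ⊗[k] H) : act₃' X Y Z x y z (t ⊗ₜ[k] a) =
      tm (proj X Y (act₂ X Y t (x ⊗ₜ[k] y))) (Z.ρ a z) := rfl

theorem tm_proj_left (x : X.carrier) (y : Y.carrier) (z : Z.carrier) (t : H ⊗[k] H) :
    act₃' X Y Z x y z ((Δ k).rTensor H t) =
      proj (tensor X Y) Z (act₂ (tensor X Y) Z t (tm x y ⊗ₜ[k] z)) := by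
  induction t using TensorProduct.induction_on with
  | zero => simp only [map_zero, LinearMap.zero_apply]
  | add a b ha hb => simp only [map_add, LinearMap.add_apply, ha, hb]
  | tmul a b =>
    rw [LinearMap.rTensor_tmul, act₃'_tmul, ← tensor_ρ]
    rfl

theorem assocInvLin_raw (x : X.carrier) (y : Y.carrier) (z : Z.carrier) (t : H ⊗[k] H) :
    proj (tensor X Y) Z ((proj X Y).rTensor Z.carrier
      ((TensorProduct.assoc k X.carrier Y.carrier Z.carrier).symm ((incl Y Z).lTensor X.carrier
        (act₂ X (tensor Y Z) t (x ⊗ₜ[k] tm y z))))) =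
    act₃' X Y Z x y z ((TensorProduct.assoc k H H H).symm ((Δ k).lTensor H t)) := by
  induction t using TensorProduct.induction_on with
  | zero => simp only [map_zero, LinearMap.zero_apply]
  | add a b ha hb => simp only [map_add, LinearMap.add_apply, ha, hb]
  | tmul a b =>
    rw [act₂_tmul, LinearMap.lTensor_tmul, LinearMap.lTensor_tmul, tm, tensor_ρ,
      incl_proj, act₂_mul, e_mul_Δ]
    generalize Δ k b = s
    induction s using TensorProduct.induction_on with
    | zero => simp
    | add a b ha hb =>
      simp only [map_add, LinearMap.add_apply, TensorProduct.tmul_add, ha, hb]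
    | tmul c d => simp; rfl

@[simp] theorem assocInvLin_tm (x : X.carrier) (y : Y.carrier) (z : Z.carrier) :
    assocInvLin X Y Z (tm x (tm y z)) = tm (tm x y) z := by
  have h1 := assocInvLin_raw X Y Z x y z (Δ k 1)
  rw [← coassoc_e, LinearEquiv.symm_apply_apply, tm_proj_left, proj_act_e] at h1
  exact h1

/-- The associativity constraint. -/
noncomputable def assocIso : tensor (tensor X Y) Z ≅ tensor X (tensor Y Z) :=
  mkIso (assocLin X Y Z) (assocInvLin X Y Z)
    (fun h t => tm_ext_left (f := assocLin X Y Z ∘ₗ (tensor (tensor X Y) Z).ρ h)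
      (g := (tensor X (tensor Y Z)).ρ h ∘ₗ assocLin X Y Z)
      (fun x y z => by
        rw [LinearMap.comp_apply, assocLin_act, LinearMap.comp_apply, assocLin_tm]) t)
    (tm_ext_left (f := assocInvLin X Y Z ∘ₗ assocLin X Y Z) (g := LinearMap.id)
      (fun x y z => by simp))
    (tm_ext_right (f := assocLin X Y Z ∘ₗ assocInvLin X Y Z) (g := LinearMap.id)
      (fun x y z => by simp))

@[simp] theorem assocIso_hom_tm (x : X.carrier) (y : Y.carrier) (z : Z.carrier) :
    lin (assocIso X Y Z).hom (tm (tm x y) z) = tm x (tm y z) := assocLin_tm X Y Z x y z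

@[simp] theorem assocIso_inv_tm (x : X.carrier) (y : Y.carrier) (z : Z.carrier) :
    lin (assocIso X Y Z).inv (tm x (tm y z)) = tm (tm x y) z := assocInvLin_tm X Y Z x y z

end Associator

section Unit

variable (k H) in
/-- The unit object `H_t`, with action `h · z = ε_t(h z)`. -/
noncomputable def unit : LMod k H where
  carrier := targetSpace k H
  ρ := AlgHom.ofLinearMap
    { toFun := fun h =>
        (targetMap k ∘ₗ LinearMap.mulLeft k h).restrict (p := targetSpace k H)
          (q := targetSpace k H) (fun x _ => ⟨h * x, rfl⟩)
      map_add' := fun a b => by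
        ext x
        change targetMap k ((a + b) * x.1) = targetMap k (a * x.1) + targetMap k (b * x.1)
        rw [add_mul, map_add]
      map_smul' := fun c a => by
        ext x
        change targetMap k ((c • a) * x.1) = c • targetMap k (a * x.1)
        rw [smul_mul_assoc, map_smul] }
    (by
      ext ⟨_, x, rfl⟩
      simp)
    (fun a b => by
      ext x
      change targetMap k ((a * b) * x.1) = targetMap k (a * targetMap k (b * x.1))
      rw [targetMap_mul_targetMap, mul_assoc])

variable (k H) in
/-- The inclusion `H_t → H`. -/
noncomputable def unitVal : (unit k H).carrier →ₗ[k] H := (targetSpace k H).subtype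

variable (k H) in
/-- `ε_t` as a map onto `H_t`. -/
noncomputable def toUnit : H →ₗ[k] (unit k H).carrier := (targetMap k).rangeRestrict

@[simp] theorem unitVal_toUnit (h : H) : unitVal k H (toUnit k H h) = targetMap k h := rfl

theorem toUnit_surj (z : (unit k H).carrier) : ∃ h, toUnit k H h = z :=
  LinearMap.surjective_rangeRestrict _ z

theorem unitVal_injective : Function.Injective (unitVal k H) := Subtype.val_injective

theorem targetMap_unitVal (z : (unit k H).carrier) :
    targetMap k (unitVal k H z) = unitVal k H z := by
  obtain ⟨x, rfl⟩ := toUnit_surj z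
  simp

theorem unit_ρ (h : H) (z : (unit k H).carrier) :
    unitVal k H ((unit k H).ρ h z) = targetMap k (h * unitVal k H z) := rfl

variable (X : LMod k H)

/-- `z ⊗ v ↦ z · v`. -/
noncomputable def leftAct : (unit k H).carrier ⊗[k] X.carrier →ₗ[k] X.carrier :=
  TensorProduct.lift (X.ρ.toLinearMap ∘ₗ unitVal k H)

@[simp] theorem leftAct_tmul (z : (unit k H).carrier) (v : X.carrier) :
    leftAct X (z ⊗ₜ[k] v) = X.ρ (unitVal k H z) v := rfl

/-- `v ⊗ z ↦ S⁻¹(z) · v`. -/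
noncomputable def rightAct : X.carrier ⊗[k] (unit k H).carrier →ₗ[k] X.carrier :=
  TensorProduct.lift (X.ρ.toLinearMap ∘ₗ (S k).symm.toLinearMap ∘ₗ unitVal k H).flip

@[simp] theorem rightAct_tmul (z : (unit k H).carrier) (v : X.carrier) :
    rightAct X (v ⊗ₜ[k] z) = X.ρ ((S k).symm (unitVal k H z)) v := rfl

theorem leftAct_act (t : H ⊗[k] H) (z : (unit k H).carrier) (v : X.carrier) :
    leftAct X (act₂ (unit k H) X t (z ⊗ₜ[k] v)) =
      X.ρ (counitLeft k (Δ k 1 * (t * (unitVal k H z ⊗ₜ[k] 1)))) v := by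
  rw [← mul_targetMap]
  induction t using TensorProduct.induction_on with
  | zero => simp
  | add a b ha hb => simp only [map_add, LinearMap.add_apply, add_mul, ha, hb]
  | tmul a b => simp [unit_ρ]

theorem rightAct_act (t : H ⊗[k] H) (z : (unit k H).carrier) (v : X.carrier) :
    rightAct X (act₂ X (unit k H) t (v ⊗ₜ[k] z)) =
      X.ρ (counitRight k (Δ k 1 * (t * (1 ⊗ₜ[k] unitVal k H z)))) v := by
  rw [← mul_barTargetMap]
  induction t using TensorProduct.induction_on with
  | zero => simp
  | add a b ha hb => simp only [map_add, LinearMap.add_apply, add_mul, ha, hb]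
  | tmul a b => simp [unit_ρ, S_symm_targetMap]

/-- The left unit constraint, the restriction of `z ⊗ v ↦ z · v`. -/
noncomputable def leftUnitLin : (tensor (unit k H) X).carrier →ₗ[k] X.carrier :=
  leftAct X ∘ₗ incl (unit k H) X

/-- The right unit constraint, the restriction of `v ⊗ z ↦ S⁻¹(z) · v`. -/
noncomputable def rightUnitLin : (tensor X (unit k H)).carrier →ₗ[k] X.carrier :=
  rightAct X ∘ₗ incl X (unit k H)

theorem Δ_unitVal (z : (unit k H).carrier) :
    Δ k (unitVal k H z) = Δ k 1 * (unitVal k H z ⊗ₜ[k] 1) := by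
  obtain ⟨x, rfl⟩ := toUnit_surj z
  exact Δ_targetMap k x

theorem leftUnitLin_act (h : H) (z : (unit k H).carrier) (v : X.carrier) :
    leftUnitLin X ((tensor (unit k H) X).ρ h (tm z v)) = X.ρ h (X.ρ (unitVal k H z) v) := by
  rw [tm, tensor_ρ]
  unfold leftUnitLin
  rw [LinearMap.comp_apply, incl_proj, act₂_mul, e_mul_Δ, leftAct_act, ← mul_assoc, e_mul_Δ,
    ← Δ_mul_e, mul_assoc, ← Δ_unitVal, ← Δ_mul, counitLeft_Δ, map_mul]
  rfl

@[simp] theorem leftUnitLin_tm (z : (unit k H).carrier) (v : X.carrier) :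
    leftUnitLin X (tm z v) = X.ρ (unitVal k H z) v := by
  simpa using leftUnitLin_act X 1 z v

@[simp] theorem rightUnitLin_tm (z : (unit k H).carrier) (v : X.carrier) :
    rightUnitLin X (tm v z) = X.ρ ((S k).symm (unitVal k H z)) v := by
  unfold rightUnitLin
  rw [tm, LinearMap.comp_apply, incl_proj, rightAct_act, ← mul_assoc, e_mul_Δ]
  obtain ⟨x, rfl⟩ := toUnit_surj z
  rw [unitVal_toUnit, ← barTargetMap_apply, ← S_symm_targetMap, targetMap_targetMap]

/-- `v ⊗_t (z · w) = (S⁻¹(z) · v) ⊗_t w`. -/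
theorem tm_unit_act {X Y : LMod k H} (z : (unit k H).carrier) (v : X.carrier) (w : Y.carrier) :
    tm v (Y.ρ (unitVal k H z) w) = tm (X.ρ ((S k).symm (unitVal k H z)) v) w := by
  obtain ⟨x, rfl⟩ := toUnit_surj z
  rw [unitVal_toUnit, S_symm_targetMap]
  have h1 : v ⊗ₜ[k] (Y.ρ (targetMap k x) w) =
      act₂ X Y (1 ⊗ₜ[k] targetMap k x) (v ⊗ₜ[k] w) := by simp
  have h2 : (X.ρ (barTargetMap k x) v) ⊗ₜ[k] w =
      act₂ X Y (barTargetMap k x ⊗ₜ[k] 1) (v ⊗ₜ[k] w) := by simp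
  rw [tm, tm, h1, h2, ← proj_act_e, act₂_mul, e_mul_tmul_targetMap, ← act₂_mul, proj_act_e]

variable (k H) in
/-- The element `1 ∈ H_t`. -/
noncomputable def unitOne : (unit k H).carrier := toUnit k H 1

@[simp] theorem unitVal_unitOne : unitVal k H (unitOne k H) = 1 := targetMap_one k

theorem S_symm_one : (S k).symm (1 : H) = 1 := by
  rw [← targetMap_one k, S_symm_targetMap, barTargetMap_apply, ← Algebra.TensorProduct.one_def,
    mul_one, counitRight_Δ]
  exact (targetMap_one k).symm

/-- The left unit constraint as an isomorphism. -/
noncomputable def leftUnitIso : tensor (unit k H) X ≅ X :=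
  mkIso (leftUnitLin X) (tmL (unit k H) X (unitOne k H))
    (fun h t => tm_ext (f := leftUnitLin X ∘ₗ (tensor (unit k H) X).ρ h)
      (g := X.ρ h ∘ₗ leftUnitLin X)
      (fun z v => by rw [LinearMap.comp_apply, leftUnitLin_act, LinearMap.comp_apply,
        leftUnitLin_tm]) t)
    (tm_ext (f := tmL (unit k H) X (unitOne k H) ∘ₗ leftUnitLin X) (g := LinearMap.id)
      (fun z v => by
        rw [LinearMap.comp_apply, leftUnitLin_tm]
        refine (tm_unit_act z (unitOne k H) v).trans ?_
        rw [LinearMap.id_apply]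
        congr 1
        apply unitVal_injective
        obtain ⟨x, rfl⟩ := toUnit_surj z
        rw [unit_ρ, unitVal_unitOne, mul_one, unitVal_toUnit, S_symm_targetMap,
          targetMap_barTargetMap]))
    (fun v => by
      refine (leftUnitLin_tm X (unitOne k H) v).trans ?_
      simp)

theorem tm_unitOne_act (h : H) (v : X.carrier) :
    (tensor X (unit k H)).ρ h (tm v (unitOne k H)) = tm (X.ρ h v) (unitOne k H) := by
  have h1 : X.ρ h v ⊗ₜ[k] unitOne k H =
      act₂ X (unit k H) (h ⊗ₜ[k] 1) (v ⊗ₜ[k] unitOne k H) := by simp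
  have h2 : ∀ t : H ⊗[k] H, act₂ X (unit k H) t (v ⊗ₜ[k] unitOne k H) =
      act₂ X (unit k H) ((targetMap k).lTensor H t) (v ⊗ₜ[k] unitOne k H) := by
    intro t
    induction t using TensorProduct.induction_on with
    | zero => simp
    | add a b ha hb => simp only [map_add, LinearMap.add_apply, ha, hb]
    | tmul a b =>
      rw [LinearMap.lTensor_tmul, act₂_tmul, act₂_tmul]
      congr 1
      apply unitVal_injective
      rw [unit_ρ, unit_ρ, unitVal_unitOne, mul_one, mul_one, targetMap_targetMap]
  rw [tm, tensor_ρ, tm, h1, h2, id_targetMap_Δ, ← act₂_mul, proj_act_e]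

/-- The right unit constraint as an isomorphism. -/
noncomputable def rightUnitIso : tensor X (unit k H) ≅ X :=
  (mkIso ((tmL X (unit k H)).flip (unitOne k H)) (rightUnitLin X)
    (fun h v => (tm_unitOne_act X h v).symm)
    (fun v => by
      refine (rightUnitLin_tm X (unitOne k H) v).trans ?_
      simp [S_symm_one])
    (tm_ext (f := (tmL X (unit k H)).flip (unitOne k H) ∘ₗ rightUnitLin X) (g := LinearMap.id)
      (fun v z => by
        rw [LinearMap.comp_apply, rightUnitLin_tm]
        refine (tm_unit_act z v (unitOne k H)).symm.trans ?_
        rw [LinearMap.id_apply]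
        congr 1
        apply unitVal_injective
        rw [unit_ρ, unitVal_unitOne, mul_one, targetMap_unitVal]))).symm

@[simp] theorem leftUnitIso_hom_tm (z : (unit k H).carrier) (v : X.carrier) :
    lin (leftUnitIso X).hom (tm z v) = X.ρ (unitVal k H z) v := leftUnitLin_tm X z v

@[simp] theorem rightUnitIso_hom_tm (z : (unit k H).carrier) (v : X.carrier) :
    lin (rightUnitIso X).hom (tm v z) = X.ρ ((S k).symm (unitVal k H z)) v :=
  rightUnitLin_tm X z v

end Unit

/-- The data of the monoidal category of left `H`-modules. -/
noncomputable instance : MonoidalCategoryStruct (LMod k H) where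
  tensorObj := tensor
  whiskerLeft X _ _ g := tensorMap (𝟙 X) g
  whiskerRight f Y := tensorMap f (𝟙 Y)
  tensorHom := tensorMap
  tensorUnit := unit k H
  associator := assocIso
  leftUnitor := leftUnitIso
  rightUnitor := rightUnitIso

/-- The monoidal category of left `H`-modules. -/
noncomputable instance : MonoidalCategory (LMod k H) :=
  MonoidalCategory.ofTensorHom
    (id_tensorHom_id := fun X Y => hom_ext (tm_ext (fun x y => tensorMap_tm _ _ x y)))
    (id_tensorHom := fun _ _ _ _ => rfl)
    (tensorHom_id := fun _ _ => rfl)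
    (tensorHom_comp_tensorHom := fun f₁ f₂ g₁ g₂ => hom_ext (tm_ext (fun x y => by
      change lin (tensorMap g₁ g₂) (lin (tensorMap f₁ f₂) (tm x y)) =
        lin (tensorMap (f₁ ≫ g₁) (f₂ ≫ g₂)) (tm x y)
      simp)))
    (associator_naturality := fun {X₁ X₂ X₃ Y₁ Y₂ Y₃} f₁ f₂ f₃ =>
      hom_ext (tm_ext_left (fun x y z => by
        change lin (assocIso Y₁ Y₂ Y₃).hom (lin (tensorMap (tensorMap f₁ f₂) f₃) (tm (tm x y) z)) =
          lin (tensorMap f₁ (tensorMap f₂ f₃)) (lin (assocIso X₁ X₂ X₃).hom (tm (tm x y) z))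
        simp)))
    (leftUnitor_naturality := fun {X Y} f => hom_ext (tm_ext (fun z v => by
      change lin (leftUnitIso Y).hom (lin (tensorMap (𝟙 (unit k H)) f) (tm z v)) =
        lin f (lin (leftUnitIso X).hom (tm z v))
      simp [lin_comm])))
    (rightUnitor_naturality := fun {X Y} f => hom_ext (tm_ext (fun v z => by
      change lin (rightUnitIso Y).hom (lin (tensorMap f (𝟙 (unit k H))) (tm v z)) =
        lin f (lin (rightUnitIso X).hom (tm v z))
      simp [lin_comm])))
    (pentagon := fun W X Y Z => hom_ext (tm_ext_left_left (fun w x y z => by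
      change lin (tensorMap (𝟙 W) (assocIso X Y Z).hom) (lin (assocIso W (tensor X Y) Z).hom
        (lin (tensorMap (assocIso W X Y).hom (𝟙 Z)) (tm (tm (tm w x) y) z))) =
        lin (assocIso W X (tensor Y Z)).hom (lin (assocIso (tensor W X) Y Z).hom
          (tm (tm (tm w x) y) z))
      simp)))
    (triangle := fun X Y => hom_ext (tm_ext_left (fun x z y => by
      change lin (tensorMap (𝟙 X) (leftUnitIso Y).hom) (lin (assocIso X (unit k H) Y).hom
        (tm (tm x z) y)) = lin (tensorMap (rightUnitIso X).hom (𝟙 Y)) (tm (tm x z) y)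
      simp [tm_unit_act])))

section Braiding

/-- `p ⊗ (q ⊗ r) ↦ (q · y) ⊗_t ((r · z) ⊗_t (p · x))`. -/
noncomputable def hexFwd {X Y Z : LMod k H} (x : X.carrier) (y : Y.carrier) (z : Z.carrier) :
    H ⊗[k] (H ⊗[k] H) →ₗ[k] (tensor Y (tensor Z X)).carrier :=
  assocLin Y Z X ∘ₗ proj (tensor Y Z) X ∘ₗ (TensorProduct.comm k _ _).toLinearMap ∘ₗ
    TensorProduct.map (LinearMap.applyₗ x ∘ₗ X.ρ.toLinearMap)
      (proj Y Z ∘ₗ LinearMap.applyₗ (y ⊗ₜ[k] z) ∘ₗ (act₂ Y Z).toLinearMap)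

@[simp] theorem hexFwd_tmul {X Y Z : LMod k H} (x : X.carrier) (y : Y.carrier) (z : Z.carrier)
    (p q r : H) : hexFwd x y z (p ⊗ₜ[k] (q ⊗ₜ[k] r)) =
      tm (Y.ρ q y) (tm (Z.ρ r z) (X.ρ p x)) :=
  assocLin_tm Y Z X _ _ _

theorem hexFwd_left {X Y Z : LMod k H} (x : X.carrier) (y : Y.carrier) (z : Z.carrier)
    (t : H ⊗[k] H) :
    assocLin Y Z X (proj (tensor Y Z) X (TensorProduct.comm k _ _
      (act₂ X (tensor Y Z) t (x ⊗ₜ[k] tm y z)))) = hexFwd x y z ((Δ k).lTensor H t) := by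
  induction t using TensorProduct.induction_on with
  | zero => simp only [map_zero, LinearMap.zero_apply]
  | add a b ha hb => simp only [map_add, LinearMap.add_apply, ha, hb]
  | tmul a b =>
    rw [act₂_tmul, tm, tensor_ρ]
    rfl

theorem hexFwd_right {X Y Z : LMod k H} (x : X.carrier) (y : Y.carrier) (z : Z.carrier)
    (t : H ⊗[k] H) (c d : H) :
    tm (Y.ρ d y) (proj Z X (TensorProduct.comm k _ _ (act₂ X Z t (X.ρ c x ⊗ₜ[k] z)))) =
      hexFwd x y z ((TensorProduct.mk k H H 1).lTensor H t * (c ⊗ₜ[k] (d ⊗ₜ[k] 1))) := by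
  induction t using TensorProduct.induction_on with
  | zero => simp only [map_zero, LinearMap.zero_apply, zero_mul, tm_zero_right]
  | add a b ha hb => simp only [map_add, LinearMap.add_apply, add_mul, tm_add_right, ha, hb]
  | tmul a b =>
    rw [act₂_tmul, LinearMap.lTensor_tmul, TensorProduct.mk_apply,
      Algebra.TensorProduct.tmul_mul_tmul, Algebra.TensorProduct.tmul_mul_tmul, hexFwd_tmul,
      one_mul, mul_one, map_mul]
    rfl

/-- `p ⊗ (q ⊗ r) ↦ ((r · z) ⊗_t (p · x)) ⊗_t (q · y)`. -/
noncomputable def hexRev {X Y Z : LMod k H} (x : X.carrier) (y : Y.carrier) (z : Z.carrier) :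
    H ⊗[k] (H ⊗[k] H) →ₗ[k] (tensor (tensor Z X) Y).carrier :=
  assocInvLin Z X Y ∘ₗ proj Z (tensor X Y) ∘ₗ (TensorProduct.comm k _ _).toLinearMap ∘ₗ
    TensorProduct.map (proj X Y ∘ₗ LinearMap.applyₗ (x ⊗ₜ[k] y) ∘ₗ (act₂ X Y).toLinearMap)
      (LinearMap.applyₗ z ∘ₗ Z.ρ.toLinearMap) ∘ₗ (TensorProduct.assoc k H H H).symm.toLinearMap

@[simp] theorem hexRev_tmul {X Y Z : LMod k H} (x : X.carrier) (y : Y.carrier) (z : Z.carrier)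
    (p q r : H) : hexRev x y z (p ⊗ₜ[k] (q ⊗ₜ[k] r)) =
      tm (tm (Z.ρ r z) (X.ρ p x)) (Y.ρ q y) :=
  assocInvLin_tm Z X Y _ _ _

theorem hexRev_left {X Y Z : LMod k H} (x : X.carrier) (y : Y.carrier) (z : Z.carrier)
    (t : H ⊗[k] H) :
    assocInvLin Z X Y (proj Z (tensor X Y) (TensorProduct.comm k _ _
      (act₂ (tensor X Y) Z t (tm x y ⊗ₜ[k] z)))) =
      hexRev x y z (TensorProduct.assoc k H H H ((Δ k).rTensor H t)) := by
  induction t using TensorProduct.induction_on with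
  | zero => simp only [map_zero, LinearMap.zero_apply]
  | add a b ha hb => simp only [map_add, LinearMap.add_apply, ha, hb]
  | tmul a b =>
    rw [act₂_tmul, tm, tensor_ρ]
    unfold hexRev
    simp only [LinearMap.comp_apply, LinearEquiv.coe_coe, LinearEquiv.symm_apply_apply]
    rfl

theorem hexRev_right {X Y Z : LMod k H} (x : X.carrier) (y : Y.carrier) (z : Z.carrier)
    (t : H ⊗[k] H) (c d : H) :
    tm (proj Z X (TensorProduct.comm k _ _ (act₂ X Z t (x ⊗ₜ[k] Z.ρ d z)))) (Y.ρ c y) =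
      hexRev x y z ((TensorProduct.mk k H H 1).lTensor H t * (1 ⊗ₜ[k] (c ⊗ₜ[k] d))) := by
  induction t using TensorProduct.induction_on with
  | zero => simp only [map_zero, LinearMap.zero_apply, zero_mul, tm_zero_left]
  | add a b ha hb => simp only [map_add, LinearMap.add_apply, add_mul, tm_add_left, ha, hb]
  | tmul a b =>
    rw [act₂_tmul, LinearMap.lTensor_tmul, TensorProduct.mk_apply,
      Algebra.TensorProduct.tmul_mul_tmul, Algebra.TensorProduct.tmul_mul_tmul, hexRev_tmul,
      one_mul, mul_one, map_mul]
    rfl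

theorem proj_comm_ecop (X Y : LMod k H) (s : X.carrier ⊗[k] Y.carrier) :
    proj Y X (TensorProduct.comm k _ _ (act₂ X Y (Δcop k 1) s)) =
      proj Y X (TensorProduct.comm k _ _ s) := by
  rw [comm_act₂]
  have : TensorProduct.comm k H H (Δcop k 1) = Δ k 1 := TensorProduct.comm_comm _ _ _ _
  rw [this, proj_act_e]

variable [Quasitriangular k H] (X Y : LMod k H)

open Quasitriangular in
/-- The braiding, the restriction of `v ⊗ w ↦ R⁽²⁾ · w ⊗ R⁽¹⁾ · v`. -/
noncomputable def braidLin : (tensor X Y).carrier →ₗ[k] (tensor Y X).carrier :=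
  proj Y X ∘ₗ (TensorProduct.comm k X.carrier Y.carrier).toLinearMap ∘ₗ act₂ X Y R ∘ₗ incl X Y

open Quasitriangular in
/-- The inverse braiding, the restriction of `w ⊗ v ↦ R⁻¹⁽¹⁾ · v ⊗ R⁻¹⁽²⁾ · w`. -/
noncomputable def braidInvLin : (tensor Y X).carrier →ₗ[k] (tensor X Y).carrier :=
  proj X Y ∘ₗ act₂ X Y Rinv ∘ₗ (TensorProduct.comm k Y.carrier X.carrier).toLinearMap ∘ₗ incl Y X

open Quasitriangular in
theorem R_mul_e : (R : H ⊗[k] H) * Δ k 1 = R := by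
  obtain ⟨x, hx⟩ := Quasitriangular.R_mem (k := k) (H := H)
  rw [hx, mul_assoc, Δ_mul_e]

open Quasitriangular in
theorem Rinv_mul_ecop : (Rinv : H ⊗[k] H) * Δcop k 1 = Rinv := by
  obtain ⟨x, hx⟩ := Quasitriangular.Rinv_mem (k := k) (H := H)
  have h1 : Δcop k (1 : H) * Δcop k 1 = Δcop k 1 := by
    have := congrArg (Algebra.TensorProduct.comm k H H) (Δ_mul_e k (1 : H))
    rw [map_mul] at this
    exact this
  rw [hx, mul_assoc, h1]

open Quasitriangular in
theorem braidLin_proj (s : X.carrier ⊗[k] Y.carrier) :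
    braidLin X Y (proj X Y s) = proj Y X (TensorProduct.comm k _ _ (act₂ X Y R s)) := by
  unfold braidLin
  rw [LinearMap.comp_apply, LinearMap.comp_apply, LinearMap.comp_apply, incl_proj, act₂_mul,
    R_mul_e]
  rfl

open Quasitriangular in
theorem braidInvLin_proj (s : Y.carrier ⊗[k] X.carrier) :
    braidInvLin X Y (proj Y X s) = proj X Y (act₂ X Y Rinv (TensorProduct.comm k _ _ s)) := by
  unfold braidInvLin
  rw [LinearMap.comp_apply, LinearMap.comp_apply, LinearMap.comp_apply, incl_proj,
    LinearEquiv.coe_coe, comm_act₂]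
  change proj X Y (act₂ X Y Rinv (act₂ X Y (Δcop k 1) _)) = _
  rw [act₂_mul, Rinv_mul_ecop]

/-- The braiding as an isomorphism. -/
noncomputable def braidIso : tensor X Y ≅ tensor Y X :=
  mkIso (braidLin X Y) (braidInvLin X Y)
    (fun h t => by
      obtain ⟨s, rfl⟩ := proj_surj X Y t
      rw [tensor_ρ, braidLin_proj, braidLin_proj, act₂_mul,
        ← Quasitriangular.comulcop_mul_R, ← act₂_mul, tensor_ρ, comm_act₂]
      have : TensorProduct.comm k H H (Δcop k h) = Δ k h := TensorProduct.comm_comm _ _ _ _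
      rw [this])
    (fun t => by
      obtain ⟨s, rfl⟩ := proj_surj X Y t
      rw [braidLin_proj, braidInvLin_proj, TensorProduct.comm_comm, act₂_mul,
        Quasitriangular.Rinv_mul_R, proj_act_e])
    (fun t => by
      obtain ⟨s, rfl⟩ := proj_surj Y X t
      rw [braidInvLin_proj, braidLin_proj, act₂_mul, Quasitriangular.R_mul_Rinv,
        proj_comm_ecop, TensorProduct.comm_comm])

open Quasitriangular in
theorem braidIso_hom_proj (s : X.carrier ⊗[k] Y.carrier) :
    lin (braidIso X Y).hom (proj X Y s) =
      proj Y X (TensorProduct.comm k _ _ (act₂ X Y R s)) := braidLin_proj X Y s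

open Quasitriangular in
theorem braidIso_hom_tm (x : X.carrier) (y : Y.carrier) :
    lin (braidIso X Y).hom (tm x y) =
      proj Y X (TensorProduct.comm k _ _ (act₂ X Y R (x ⊗ₜ[k] y))) := braidLin_proj X Y _

theorem braid_natural {X X' Y Y' : LMod k H} (f : X ⟶ X') (g : Y ⟶ Y')
    (t : (tensor X Y).carrier) :
    lin (braidIso X' Y').hom (lin (tensorMap f g) t) =
      lin (tensorMap g f) (lin (braidIso X Y).hom t) := by
  obtain ⟨s, rfl⟩ := proj_surj X Y t
  rw [tensorMap_proj, braidIso_hom_proj, braidIso_hom_proj, tensorMap_proj, ← map_act₂,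
    TensorProduct.map_comm]

theorem braid_hexagon_forward (X Y Z : LMod k H) (x : X.carrier) (y : Y.carrier)
    (z : Z.carrier) :
    lin (assocIso Y Z X).hom (lin (braidIso X (tensor Y Z)).hom (tm x (tm y z))) =
      lin (tensorMap (𝟙 Y) (braidIso X Z).hom) (lin (assocIso Y X Z).hom
        (lin (tensorMap (braidIso X Y).hom (𝟙 Z)) (tm (tm x y) z))) := by
  rw [braidIso_hom_tm, tensorMap_tm, braidIso_hom_tm]
  refine (hexFwd_left x y z _).trans ?_
  rw [Quasitriangular.id_comul_R]
  refine Eq.symm ?_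
  generalize hs : (Quasitriangular.R : H ⊗[k] H) = s
  rw [lin_id]
  suffices ∀ s : H ⊗[k] H, lin (tensorMap (𝟙 Y) (braidIso X Z).hom) (lin (assocIso Y X Z).hom
      (tm (proj Y X (TensorProduct.comm k _ _ (act₂ X Y s (x ⊗ₜ[k] y)))) z)) =
      hexFwd x y z ((TensorProduct.mk k H H 1).lTensor H Quasitriangular.R *
        TensorProduct.assoc k H H H (s ⊗ₜ[k] 1)) by
    rw [this s, hs]
  intro s
  induction s using TensorProduct.induction_on with
  | zero => simp only [map_zero, LinearMap.zero_apply, TensorProduct.zero_tmul, mul_zero,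
      tm_zero_left]
  | add a b ha hb => simp only [map_add, LinearMap.add_apply, TensorProduct.add_tmul, mul_add,
      tm_add_left, ha, hb]
  | tmul c d =>
    rw [act₂_tmul, TensorProduct.comm_tmul]
    refine (congrArg _ (assocIso_hom_tm Y X Z _ _ _)).trans ?_
    rw [tensorMap_tm, lin_id, braidIso_hom_tm, TensorProduct.assoc_tmul]
    exact hexFwd_right x y z _ c d

theorem braid_hexagon_reverse (X Y Z : LMod k H) (x : X.carrier) (y : Y.carrier)
    (z : Z.carrier) :
    lin (assocIso Z X Y).inv (lin (braidIso (tensor X Y) Z).hom (tm (tm x y) z)) =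
      lin (tensorMap (braidIso X Z).hom (𝟙 Y)) (lin (assocIso X Z Y).inv
        (lin (tensorMap (𝟙 X) (braidIso Y Z).hom) (tm x (tm y z)))) := by
  rw [braidIso_hom_tm, tensorMap_tm, braidIso_hom_tm]
  refine (hexRev_left x y z _).trans ?_
  rw [Quasitriangular.comul_id_R]
  refine Eq.symm ?_
  generalize hs : (Quasitriangular.R : H ⊗[k] H) = s
  rw [lin_id]
  suffices ∀ s : H ⊗[k] H, lin (tensorMap (braidIso X Z).hom (𝟙 Y)) (lin (assocIso X Z Y).inv
      (tm x (proj Z Y (TensorProduct.comm k _ _ (act₂ Y Z s (y ⊗ₜ[k] z)))))) =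
      hexRev x y z ((TensorProduct.mk k H H 1).lTensor H Quasitriangular.R *
        (1 ⊗ₜ[k] s)) by
    rw [this s, hs]
  intro s
  induction s using TensorProduct.induction_on with
  | zero => simp only [map_zero, LinearMap.zero_apply, TensorProduct.tmul_zero, mul_zero,
      tm_zero_right]
  | add a b ha hb => simp only [map_add, LinearMap.add_apply, TensorProduct.tmul_add, mul_add,
      tm_add_right, ha, hb]
  | tmul c d =>
    rw [act₂_tmul, TensorProduct.comm_tmul]
    refine (congrArg _ (assocIso_inv_tm X Z Y _ _ _)).trans ?_
    rw [tensorMap_tm, lin_id, braidIso_hom_tm]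
    exact hexRev_right x y z _ c d

/-- The braided monoidal category of left `H`-modules. -/
noncomputable instance : BraidedCategory (LMod k H) where
  braiding := braidIso
  braiding_naturality_right X _ _ f := hom_ext (fun t => braid_natural (𝟙 X) f t)
  braiding_naturality_left f Z := hom_ext (fun t => braid_natural f (𝟙 Z) t)
  hexagon_forward X Y Z := hom_ext (tm_ext_left (fun x y z => by
    refine Eq.trans ?_ (braid_hexagon_forward X Y Z x y z)
    change lin (assocIso Y Z X).hom (lin (braidIso X (tensor Y Z)).hom
      (lin (assocIso X Y Z).hom (tm (tm x y) z))) = _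
    rw [assocIso_hom_tm]))
  hexagon_reverse X Y Z := hom_ext (tm_ext_right (fun x y z => by
    refine Eq.trans ?_ (braid_hexagon_reverse X Y Z x y z)
    change lin (assocIso Z X Y).inv (lin (braidIso (tensor X Y) Z).hom
      (lin (assocIso X Y Z).inv (tm x (tm y z)))) = _
    rw [assocIso_inv_tm]))

end Braiding

end Tensor

end LMod

/-! ### Structure maps on the centralizer of the source space -/

section Transmutation

variable {k : Type v} {H L : Type u} [Field k] [Ring H] [Algebra k H] [QuantumGroupoid k H]
  [Ring L] [Algebra k L] [QuantumGroupoid k L]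

/-- `a ⊗ b ↦ (l ↦ f(a) l f(S(b)))`. -/
noncomputable def sandwich (f : H →ₐc[k] L) : H ⊗[k] H →ₗ[k] L →ₗ[k] L :=
  TensorProduct.lift (LinearMap.mk₂ k
    (fun a b => LinearMap.mulRight k (f (S k b)) ∘ₗ LinearMap.mulLeft k (f a))
    (fun a a' b => by ext l; simp [add_mul])
    (fun c a b => by ext l; simp)
    (fun a b b' => by ext l; simp [mul_add])
    (fun c a b => by ext l; simp))

/-- The adjoint action `h · l = f(h₁) l f(S(h₂))`. -/
noncomputable def adj (f : H →ₐc[k] L) : H →ₗ[k] L →ₗ[k] L := sandwich f ∘ₗ Δ k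

/-- `p ⊗ q ↦ (x ⊗ y ↦ x f(S(q)) ⊗ p · y)`. -/
noncomputable def comulTwist (f : H →ₐc[k] L) : H ⊗[k] H →ₗ[k] L ⊗[k] L →ₗ[k] L ⊗[k] L :=
  TensorProduct.lift (LinearMap.mk₂ k
    (fun p q => TensorProduct.map (LinearMap.mulRight k (f (S k q))) (adj f p))
    (fun p p' q => by ext x y; simp [TensorProduct.tmul_add])
    (fun c p q => by ext x y; simp)
    (fun p q q' => by ext x y; simp [mul_add, TensorProduct.add_tmul])
    (fun c p q => by ext x y; simp [TensorProduct.smul_tmul]))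

/-- `p ⊗ q ↦ (l ↦ f(q) S(p · l))`, with the antipode `S` of `L`. -/
noncomputable def antipodeTwist (f : H →ₐc[k] L) : H ⊗[k] H →ₗ[k] L →ₗ[k] L :=
  TensorProduct.lift (LinearMap.mk₂ k
    (fun p q => LinearMap.mulLeft k (f q) ∘ₗ (S k (H := L)).toLinearMap ∘ₗ adj f p)
    (fun p p' q => by ext l; simp [mul_add])
    (fun c p q => by ext l; simp)
    (fun p q q' => by ext l; simp [add_mul])
    (fun c p q => by ext l; simp))

/-- `l ↦ ε(f(1₁) l) 1₂`, with the counit `ε` of `L` and `1₁ ⊗ 1₂ = Δ(1)` in `H ⊗ H`. -/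
noncomputable def transCounit (f : H →ₐc[k] L) (l : L) : H :=
  TensorProduct.lid k H (TensorProduct.map
    (ε k ∘ₗ LinearMap.mulRight k l ∘ₗ (f : H →ₗ[k] L)) LinearMap.id (Δ k (1 : H)))

variable [Quasitriangular k H]

/-- `l ↦ l₁ f(S(R⁽²⁾)) ⊗ R⁽¹⁾ · l₂`. -/
noncomputable def transComul (f : H →ₐc[k] L) (l : L) : L ⊗[k] L :=
  comulTwist f Quasitriangular.R (Δ k l)

/-- `l ↦ f(R⁽²⁾) S(R⁽¹⁾ · l)`, with the antipode `S` of `L`. -/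
noncomputable def transAntipode (f : H →ₐc[k] L) (l : L) : L :=
  antipodeTwist f Quasitriangular.R l

end Transmutation

end QG

namespace QG

-- This is the weak Hopf form of transmutation: twisting the coproduct and the antipode of L by R
-- makes it a braided Hopf algebra under the adjoint action. Over a quantum groupoid the unit of H
-- need not act as the identity on L. It acts by l ↦ 1₁ l S(1₂), a projection of L onto C
-- (`adj_mem`, `adj_one_of_mem`). So C is the natural carrier, and inserting this projection allows
-- the legs of a tensor to be treated as elements of C.
--
-- The base algebras are controlled by Δ(1), whose legs lie in H_s and H_t. As f is unital and a
-- coalgebra map, Δ(1) in L is the image of Δ(1) in H. Hence f identifies H_t with L_t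
-- (`exists_targetMap_eq`, `map_targetMap_injective`) and respects the antipodes (`map_S`), and
-- after applying f the counit of C becomes ε_t (`map_transCounit`). Elements of the base slide
-- through Δ(1) and through R, for instance by `sw_e_mul_targetMap` and `sw_R_mul_targetMap`.
--
-- The algebra structure rests on h · (xy) = (h₁ · x)(h₂ · y), which is `adj_apply_mul`. For the
-- coalgebra structure, the intertwining relation of R gives H-linearity (`sw_transComul_adj`), and
-- the two hexagon identities give coassociativity and multiplicativity (`sw_transComul_coassoc`,
-- `sw_transComul_mul`). The counit and unit laws come from the values of ε_t and ε_s on the legs of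
-- R (`sw_targetMap_R`, `sw_sourceMap_R`).
--
-- One half of the antipode axiom follows from a hexagon producing S(R⁽²⁾₁) R⁽²⁾₂ = ε_s(R⁽²⁾). The
-- other half uses the Drinfeld-type element v = R⁽²⁾ S²(R⁽¹⁾): it satisfies v S²(h) = h v
-- (`sw_R_mul_S_S`) and R⁽²⁾ v S(R⁽¹⁾) = 1 (`sw_R_mul_mul_S`), and the braided antipode can be
-- written through it (`transAntipode_eq_sw_S`).
--
-- Sweedler notation is modelled by `sw`, a sum over one fixed decomposition of a tensor. Termwise
-- rewriting and exchange of sums are then free, and multilinearity, left to `fun_prop`, is needed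
-- only when an identity replaces the tensor itself.

attribute [fun_prop] IsLinearMap

/-! ### Sweedler sums and their multilinearity. -/

section SweedlerSums

variable {k : Type*} [Field k] {M N V W X : Type*} [AddCommGroup M] [Module k M]
  [AddCommGroup N] [Module k N] [AddCommGroup V] [Module k V] [AddCommGroup W] [Module k W]
  [AddCommGroup X] [Module k X]

@[fun_prop] theorem isLinearMap_id : IsLinearMap k (fun x : M => x) := ⟨fun _ _ => rfl, fun _ _ => rfl⟩

@[fun_prop] theorem isLinearMap_comp {f : N → V} {g : M → N} (hf : IsLinearMap k f)
    (hg : IsLinearMap k g) : IsLinearMap k (fun x => f (g x)) :=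
  ⟨fun x y => by rw [hg.map_add, hf.map_add], fun c x => by rw [hg.map_smul, hf.map_smul]⟩

@[fun_prop] theorem isLinearMap_coe (f : M →ₗ[k] N) : IsLinearMap k (fun x => f x) :=
  f.isLinear

@[fun_prop] theorem isLinearMap_equiv (f : M ≃ₗ[k] N) : IsLinearMap k (fun x => f x) :=
  f.toLinearMap.isLinear

@[fun_prop] theorem isLinearMap_apply {f : M → N →ₗ[k] V} (hf : IsLinearMap k f) (n : N) :
    IsLinearMap k (fun x => f x n) :=
  ⟨fun x y => by rw [hf.map_add, LinearMap.add_apply],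
    fun c x => by rw [hf.map_smul, LinearMap.smul_apply]⟩

section Algebra

variable {A : Type*} [Ring A] [Algebra k A] {B : Type*} [Ring B] [Algebra k B]

@[fun_prop] theorem isLinearMap_algHom (f : A →ₐ[k] B) : IsLinearMap k (fun x => f x) :=
  f.toLinearMap.isLinear

@[fun_prop] theorem isLinearMap_bialgHom [CoalgebraStruct k A] [CoalgebraStruct k B]
    (f : A →ₐc[k] B) : IsLinearMap k (fun x => f x) :=
  (f : A →ₗ[k] B).isLinear

@[fun_prop] theorem isLinearMap_mul_const {f : M → A} (hf : IsLinearMap k f) (a : A) :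
    IsLinearMap k (fun x => f x * a) :=
  ⟨fun x y => by rw [hf.map_add, add_mul], fun c x => by rw [hf.map_smul, smul_mul_assoc]⟩

@[fun_prop] theorem isLinearMap_const_mul {f : M → A} (hf : IsLinearMap k f) (a : A) :
    IsLinearMap k (fun x => a * f x) :=
  ⟨fun x y => by rw [hf.map_add, mul_add], fun c x => by rw [hf.map_smul, mul_smul_comm]⟩

end Algebra

@[fun_prop] theorem isLinearMap_smul_const {f : M → k} (hf : IsLinearMap k f) (a : N) :
    IsLinearMap k (fun x => f x • a) :=
  ⟨fun x y => by rw [hf.map_add, add_smul], fun c x => by rw [hf.map_smul, smul_assoc]⟩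

@[fun_prop] theorem isLinearMap_const_smul {f : M → N} (hf : IsLinearMap k f) (a : k) :
    IsLinearMap k (fun x => a • f x) :=
  ⟨fun x y => by rw [hf.map_add, smul_add], fun c x => by rw [hf.map_smul, smul_comm]⟩

@[fun_prop] theorem isLinearMap_tmul_const {f : M → N} (hf : IsLinearMap k f) (a : V) :
    IsLinearMap k (fun x => f x ⊗ₜ[k] a) :=
  ⟨fun x y => by rw [hf.map_add, TensorProduct.add_tmul],
    fun c x => by rw [hf.map_smul, TensorProduct.smul_tmul']⟩

@[fun_prop] theorem isLinearMap_const_tmul {f : M → N} (hf : IsLinearMap k f) (a : V) :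
    IsLinearMap k (fun x => a ⊗ₜ[k] f x) :=
  ⟨fun x y => by rw [hf.map_add, TensorProduct.tmul_add],
    fun c x => by rw [hf.map_smul, TensorProduct.tmul_smul]⟩

/-- The sum of `F a b` over a chosen decomposition `t = ∑ a ⊗ b`.  For bilinear `F` it does not
depend on the decomposition. -/
noncomputable def sw (t : M ⊗[k] N) (F : M → N → V) : V :=
  ∑ p ∈ (TensorProduct.exists_finset t).choose, F p.1 p.2

theorem sw_tmul_self (t : M ⊗[k] N) : sw t (fun a b => a ⊗ₜ[k] b) = t :=
  (TensorProduct.exists_finset t).choose_spec.symm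

omit [Module k V] in
theorem sw_congr {t : M ⊗[k] N} {F G : M → N → V} (h : ∀ a b, F a b = G a b) :
    sw t F = sw t G := Finset.sum_congr rfl fun _ _ => h _ _

theorem map_sw (G : V →ₗ[k] W) (t : M ⊗[k] N) (F : M → N → V) :
    G (sw t F) = sw t (fun a b => G (F a b)) := map_sum G _ _

theorem apply_sw {G : V → W} (t : M ⊗[k] N) (F : M → N → V)
    (hG : IsLinearMap k G := by fun_prop) :
    G (sw t F) = sw t (fun a b => G (F a b)) := map_sum hG.mk' _ _

/-- Bilinear maps are evaluated on tensors by `sw`. -/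
theorem sw_eq_lift (t : M ⊗[k] N) (B : M →ₗ[k] N →ₗ[k] V) :
    sw t (fun a b => B a b) = TensorProduct.lift B t := by
  conv_rhs => rw [← sw_tmul_self t, map_sw]
  exact sw_congr fun a b => (TensorProduct.lift.tmul a b).symm

theorem exists_bilin {F : M → N → V} (h1 : ∀ b, IsLinearMap k (fun a => F a b))
    (h2 : ∀ a, IsLinearMap k (fun b => F a b)) :
    ∃ B : M →ₗ[k] N →ₗ[k] V, ∀ a b, B a b = F a b :=
  ⟨LinearMap.mk₂ k F (fun a a' b => (h1 b).map_add a a') (fun c a b => (h1 b).map_smul c a)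
    (fun a b b' => (h2 a).map_add b b') (fun c a b => (h2 a).map_smul c b), fun _ _ => rfl⟩

/-- Bilinearity makes F factor through the tensor product, so its sum is the value of one linear
map; this is the independence of the decomposition, in the form in which it is used. -/
theorem exists_lift {F : M → N → V} (h1 : ∀ b, IsLinearMap k (fun a => F a b))
    (h2 : ∀ a, IsLinearMap k (fun b => F a b)) :
    ∃ B : M ⊗[k] N →ₗ[k] V, (∀ a b, B (a ⊗ₜ[k] b) = F a b) ∧ ∀ t, sw t F = B t := by
  obtain ⟨B, hB⟩ := exists_bilin h1 h2
  refine ⟨TensorProduct.lift B, fun a b => by simp [hB], fun t => ?_⟩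
  rw [← sw_eq_lift]
  exact sw_congr fun a b => (hB a b).symm

@[fun_prop] theorem isLinearMap_sw {F : M → N → V} (h1 : ∀ b, IsLinearMap k (fun a => F a b))
    (h2 : ∀ a, IsLinearMap k (fun b => F a b)) {T : X → M ⊗[k] N} (hT : IsLinearMap k T) :
    IsLinearMap k (fun x => sw (T x) F) := by
  obtain ⟨B, -, hB⟩ := exists_lift h1 h2
  simp only [hB]
  fun_prop

@[fun_prop] theorem isLinearMap_sw_fun {F : X → M → N → V}
    (hF : ∀ a b, IsLinearMap k (fun x => F x a b)) (t : M ⊗[k] N) :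
    IsLinearMap k (fun x => sw t (F x)) :=
  ⟨fun x y => by simp only [sw, (hF _ _).map_add, Finset.sum_add_distrib],
    fun c x => by simp only [sw, (hF _ _).map_smul, Finset.smul_sum]⟩

theorem sw_tmul {F : M → N → V} (a : M) (b : N)
    (h1 : ∀ b, IsLinearMap k (fun a => F a b) := by fun_prop)
    (h2 : ∀ a, IsLinearMap k (fun b => F a b) := by fun_prop) : sw (a ⊗ₜ[k] b) F = F a b := by
  obtain ⟨B, hB', hB⟩ := exists_lift h1 h2
  rw [hB, hB']

-- Both decompositions are fixed, so this is an exchange of finite sums and needs no linearity, just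
-- as `sw_congr` needs none.
omit [Module k V] in
theorem sw_comm {M' N' : Type*} [AddCommGroup M'] [Module k M'] [AddCommGroup N'] [Module k N']
    (t : M ⊗[k] N) (s : M' ⊗[k] N') (F : M → N → M' → N' → V) :
    sw t (fun a b => sw s (fun c d => F a b c d)) =
      sw s (fun c d => sw t (fun a b => F a b c d)) := Finset.sum_comm

theorem sw_mul_const {A : Type*} [Ring A] [Algebra k A] (t : M ⊗[k] N) (F : M → N → A) (x : A) :
    (sw t fun a b => F a b * x) = sw t F * x := (Finset.sum_mul _ _ _).symm

theorem sw_const_mul {A : Type*} [Ring A] [Algebra k A] (t : M ⊗[k] N) (F : M → N → A) (x : A) :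
    (sw t fun a b => x * F a b) = x * sw t F := (Finset.mul_sum _ _ _).symm

theorem exists_lift₃ {F : M → N → W → V} (h1 : ∀ b c, IsLinearMap k (fun a => F a b c))
    (h2 : ∀ a c, IsLinearMap k (fun b => F a b c)) (h3 : ∀ a b, IsLinearMap k (fun c => F a b c)) :
    ∃ Φ : M ⊗[k] (N ⊗[k] W) →ₗ[k] V, ∀ a b c, Φ (a ⊗ₜ[k] (b ⊗ₜ[k] c)) = F a b c := by
  have key : ∀ a, ∃ B : N ⊗[k] W →ₗ[k] V, (∀ b c, B (b ⊗ₜ[k] c) = F a b c) ∧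
      ∀ t, sw t (F a) = B t := fun a => exists_lift (h2 a) (h3 a)
  choose B hB hB' using key
  obtain ⟨Φ, hΦ, -⟩ := exists_lift (k := k) (F := fun a t => B a t)
    -- `B a` is chosen separately for each `a`, so its linearity in `a` is not automatic; it is read
    -- off from the sum that computes it.
    (fun t => by simp only [← hB']; fun_prop) (fun a => (B a).isLinear)
  exact ⟨Φ, fun a b c => by rw [hΦ, hB]⟩

end SweedlerSums

/-! ### Weak bialgebra axioms as identities of sums. -/

section Axioms

variable {k : Type v} {H : Type u} [Field k] [Ring H] [Algebra k H] [WeakBialgebra k H]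
  {V : Type*} [AddCommGroup V] [Module k V]

omit [WeakBialgebra k H] in
theorem sw_mul (s t : H ⊗[k] H) {F : H → H → V}
    (h1 : ∀ b, IsLinearMap k (fun a => F a b) := by fun_prop)
    (h2 : ∀ a, IsLinearMap k (fun b => F a b) := by fun_prop) :
    sw (s * t) F = sw s fun a b => sw t fun c d => F (a * c) (b * d) := by
  obtain ⟨B, hB', hB⟩ := exists_lift h1 h2
  rw [hB]
  conv_lhs => rw [← sw_tmul_self s, ← sw_tmul_self t]
  simp only [sw, Finset.sum_mul_sum, map_sum, Algebra.TensorProduct.tmul_mul_tmul, hB']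

omit [WeakBialgebra k H] in
theorem sw_mul_tmul (t : H ⊗[k] H) (x y : H) {F : H → H → V}
    (h1 : ∀ b, IsLinearMap k (fun a => F a b) := by fun_prop)
    (h2 : ∀ a, IsLinearMap k (fun b => F a b) := by fun_prop) :
    sw (t * (x ⊗ₜ[k] y)) F = sw t fun a b => F (a * x) (b * y) := by
  rw [sw_mul _ _ h1 h2]
  exact sw_congr fun a b => sw_tmul x y

omit [WeakBialgebra k H] in
theorem sw_tmul_mul (t : H ⊗[k] H) (x y : H) {F : H → H → V}
    (h1 : ∀ b, IsLinearMap k (fun a => F a b) := by fun_prop)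
    (h2 : ∀ a, IsLinearMap k (fun b => F a b) := by fun_prop) :
    sw ((x ⊗ₜ[k] y) * t) F = sw t fun a b => F (x * a) (y * b) := by
  rw [sw_mul _ _ h1 h2]
  exact sw_tmul x y

omit [WeakBialgebra k H] in
theorem sw_swap (t : H ⊗[k] H) {F : H → H → V}
    (h1 : ∀ b, IsLinearMap k (fun a => F a b) := by fun_prop)
    (h2 : ∀ a, IsLinearMap k (fun b => F a b) := by fun_prop) :
    sw (TensorProduct.comm k H H t) F = sw t fun a b => F b a := by
  obtain ⟨B, hB', hB⟩ := exists_lift h1 h2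
  rw [hB]
  conv_lhs => rw [← sw_tmul_self t]
  simp only [sw, map_sum, TensorProduct.comm_tmul, hB']

theorem sw_Δcop (h : H) {F : H → H → V}
    (h1 : ∀ b, IsLinearMap k (fun a => F a b) := by fun_prop)
    (h2 : ∀ a, IsLinearMap k (fun b => F a b) := by fun_prop) :
    sw (Δcop k h) F = sw (Δ k h) fun a b => F b a := sw_swap _ h1 h2

omit [WeakBialgebra k H] in
theorem map_lTensor {t : H ⊗[k] H} (D : H →ₗ[k] H ⊗[k] H) {Φ : H ⊗[k] (H ⊗[k] H) →ₗ[k] V} :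
    Φ (D.lTensor H t) = sw t fun a b => sw (D b) fun c d => Φ (a ⊗ₜ[k] (c ⊗ₜ[k] d)) := by
  conv_lhs => rw [← sw_tmul_self t]
  rw [map_sw, map_sw]
  refine sw_congr fun a b => ?_
  rw [LinearMap.lTensor_tmul]
  conv_lhs => rw [← sw_tmul_self (D b)]
  exact apply_sw (G := fun t => Φ (a ⊗ₜ t)) _ _

omit [WeakBialgebra k H] in
theorem map_rTensor {t : H ⊗[k] H} (D : H →ₗ[k] H ⊗[k] H) {Φ : H ⊗[k] (H ⊗[k] H) →ₗ[k] V} :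
    Φ (TensorProduct.assoc k H H H (D.rTensor H t)) =
      sw t fun a b => sw (D a) fun c d => Φ (c ⊗ₜ[k] (d ⊗ₜ[k] b)) := by
  conv_lhs => rw [← sw_tmul_self t]
  rw [map_sw, apply_sw (G := fun t => Φ (TensorProduct.assoc k H H H t))]
  refine sw_congr fun a b => ?_
  rw [LinearMap.rTensor_tmul]
  conv_lhs => rw [← sw_tmul_self (D a)]
  exact apply_sw (G := fun t => Φ (TensorProduct.assoc k H H H (t ⊗ₜ b))) _ _

-- Leaving the embeddings p and q of H ⊗ H into the triple tensor product arbitrary covers the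
-- products in both weak unit axioms and in both hexagon identities.
omit [WeakBialgebra k H] in
theorem map_mul_sw (s t : H ⊗[k] H) {p q : H ⊗[k] H →ₗ[k] H ⊗[k] (H ⊗[k] H)}
    {Φ : H ⊗[k] (H ⊗[k] H) →ₗ[k] V} :
    Φ (p s * q t) = sw s fun a b => sw t fun c d => Φ (p (a ⊗ₜ[k] b) * q (c ⊗ₜ[k] d)) := by
  conv_lhs => rw [← sw_tmul_self s, ← sw_tmul_self t]
  simp only [sw, map_sum, Finset.sum_mul_sum]

/-- `F(h₁₁, h₁₂, h₂) = F(h₁, h₂₁, h₂₂)`. -/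
theorem sw_coassoc (h : H) {F : H → H → H → V}
    (h1 : ∀ b c, IsLinearMap k (fun a => F a b c) := by fun_prop)
    (h2 : ∀ a c, IsLinearMap k (fun b => F a b c) := by fun_prop)
    (h3 : ∀ a b, IsLinearMap k (fun c => F a b c) := by fun_prop) :
    (sw (Δ k h) fun a b => sw (Δ k a) fun c d => F c d b) =
      sw (Δ k h) fun a b => sw (Δ k b) fun c d => F a c d := by
  obtain ⟨Φ, hΦ⟩ := exists_lift₃ h1 h2 h3
  simpa only [map_lTensor, map_rTensor, hΦ] using congrArg Φ (coassoc_e k h)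

/-- `F(1₁, 1₂, 1₃) = F(1₁, 1₂ 1'₁, 1'₂)`. -/
theorem sw_comul_one {F : H → H → H → V}
    (h1 : ∀ b c, IsLinearMap k (fun a => F a b c) := by fun_prop)
    (h2 : ∀ a c, IsLinearMap k (fun b => F a b c) := by fun_prop)
    (h3 : ∀ a b, IsLinearMap k (fun c => F a b c) := by fun_prop) :
    (sw (Δ k 1) fun a b => sw (Δ k b) fun c d => F a c d) =
      sw (Δ k 1) fun a b => sw (Δ k 1) fun c d => F a (b * c) d := by
  obtain ⟨Φ, hΦ⟩ := exists_lift₃ h1 h2 h3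
  have h := congrArg Φ (WeakBialgebra.comul_comul_one (k := k) (H := H))
  rw [map_lTensor] at h
  simp only [hΦ] at h
  rw [h]
  refine (map_mul_sw (p := (TensorProduct.assoc k H H H).toLinearMap ∘ₗ
    (TensorProduct.mk k (H ⊗[k] H) H).flip 1) (q := TensorProduct.mk k H (H ⊗[k] H) 1) _ _).trans ?_
  simp [hΦ]

/-- `F(1₁, 1₂, 1₃) = F(1₁, 1'₁ 1₂, 1'₂)`. -/
theorem sw_comul_one_op {F : H → H → H → V}
    (h1 : ∀ b c, IsLinearMap k (fun a => F a b c) := by fun_prop)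
    (h2 : ∀ a c, IsLinearMap k (fun b => F a b c) := by fun_prop)
    (h3 : ∀ a b, IsLinearMap k (fun c => F a b c) := by fun_prop) :
    (sw (Δ k 1) fun a b => sw (Δ k b) fun c d => F a c d) =
      sw (Δ k 1) fun a b => sw (Δ k 1) fun c d => F a (c * b) d := by
  obtain ⟨Φ, hΦ⟩ := exists_lift₃ h1 h2 h3
  have h := congrArg Φ (WeakBialgebra.comul_comul_one_op (k := k) (H := H))
  rw [map_lTensor] at h
  simp only [hΦ] at h
  rw [h, sw_comm]
  refine (map_mul_sw (q := (TensorProduct.assoc k H H H).toLinearMap ∘ₗ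
    (TensorProduct.mk k (H ⊗[k] H) H).flip 1) (p := TensorProduct.mk k H (H ⊗[k] H) 1) _ _).trans ?_
  simp [hΦ]

theorem sw_counit_left (h : H) {F : H → V} (hF : IsLinearMap k F := by fun_prop) :
    (sw (Δ k h) fun a b => ε k a • F b) = F h := by
  conv_rhs => rw [← counitLeft_Δ k h, ← sw_tmul_self (Δ k h), map_sw, apply_sw (G := F)]
  simp [hF.map_smul]

theorem sw_counit_right (h : H) {F : H → V} (hF : IsLinearMap k F := by fun_prop) :
    (sw (Δ k h) fun a b => ε k b • F a) = F h := by
  conv_rhs => rw [← counitRight_Δ k h, ← sw_tmul_self (Δ k h), map_sw, apply_sw (G := F)]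
  simp [hF.map_smul]

theorem sw_Δ_mul (g h : H) {F : H → H → V}
    (h1 : ∀ b, IsLinearMap k (fun a => F a b) := by fun_prop)
    (h2 : ∀ a, IsLinearMap k (fun b => F a b) := by fun_prop) :
    sw (Δ k (g * h)) F = sw (Δ k g) fun a b => sw (Δ k h) fun c d => F (a * c) (b * d) := by
  rw [Δ_mul, sw_mul _ _ h1 h2]

end Axioms

/-! ### Quasitriangularity as identities of sums. -/

section QuasitriangularSums

variable {k : Type v} {H : Type u} [Field k] [Ring H] [Algebra k H] [QuantumGroupoid k H]
  [Quasitriangular k H] {V : Type*} [AddCommGroup V] [Module k V]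

open Quasitriangular

/-- `F(R⁽¹⁾, R⁽²⁾₁, R⁽²⁾₂) = F(R⁽¹⁾ R'⁽¹⁾, R'⁽²⁾, R⁽²⁾)`. -/
theorem sw_id_comul_R {F : H → H → H → V}
    (h1 : ∀ b c, IsLinearMap k (fun a => F a b c) := by fun_prop)
    (h2 : ∀ a c, IsLinearMap k (fun b => F a b c) := by fun_prop)
    (h3 : ∀ a b, IsLinearMap k (fun c => F a b c) := by fun_prop) :
    (sw (R : H ⊗[k] H) fun a b => sw (Δ k b) fun c d => F a c d) =
      sw (R : H ⊗[k] H) fun a b => sw (R : H ⊗[k] H) fun c d => F (a * c) d b := by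
  obtain ⟨Φ, hΦ⟩ := exists_lift₃ h1 h2 h3
  have h := congrArg Φ (id_comul_R (k := k) (H := H))
  rw [map_lTensor] at h
  simp only [hΦ] at h
  rw [h]
  refine (map_mul_sw (p := (TensorProduct.mk k H H 1).lTensor H)
    (q := (TensorProduct.assoc k H H H).toLinearMap ∘ₗ
      (TensorProduct.mk k (H ⊗[k] H) H).flip 1) _ _).trans ?_
  simp [hΦ]

/-- `F(R⁽¹⁾₁, R⁽¹⁾₂, R⁽²⁾) = F(R⁽¹⁾, R'⁽¹⁾, R⁽²⁾ R'⁽²⁾)`. -/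
theorem sw_comul_id_R {F : H → H → H → V}
    (h1 : ∀ b c, IsLinearMap k (fun a => F a b c) := by fun_prop)
    (h2 : ∀ a c, IsLinearMap k (fun b => F a b c) := by fun_prop)
    (h3 : ∀ a b, IsLinearMap k (fun c => F a b c) := by fun_prop) :
    (sw (R : H ⊗[k] H) fun a b => sw (Δ k a) fun c d => F c d b) =
      sw (R : H ⊗[k] H) fun a b => sw (R : H ⊗[k] H) fun c d => F a c (b * d) := by
  obtain ⟨Φ, hΦ⟩ := exists_lift₃ h1 h2 h3
  have h := congrArg Φ (comul_id_R (k := k) (H := H))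
  rw [map_rTensor] at h
  simp only [hΦ] at h
  rw [h]
  refine (map_mul_sw (p := (TensorProduct.mk k H H 1).lTensor H)
    (q := TensorProduct.mk k H (H ⊗[k] H) 1) _ _).trans ?_
  simp [hΦ]

/-- `F(h₂ R⁽¹⁾, h₁ R⁽²⁾) = F(R⁽¹⁾ h₁, R⁽²⁾ h₂)`. -/
theorem sw_comulcop_mul_R (h : H) {F : H → H → V}
    (h1 : ∀ b, IsLinearMap k (fun a => F a b) := by fun_prop)
    (h2 : ∀ a, IsLinearMap k (fun b => F a b) := by fun_prop) :
    (sw (Δ k h) fun a b => sw (R : H ⊗[k] H) fun p q => F (b * p) (a * q)) =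
      sw (R : H ⊗[k] H) fun p q => sw (Δ k h) fun a b => F (p * a) (q * b) := by
  rw [← sw_mul _ _ h1 h2, ← comulcop_mul_R, sw_mul _ _ h1 h2]
  exact (sw_Δcop h).symm

/-- The intertwining relation at h = 1 turns absorption of Δ(1) on the right into absorption of
Δ^cop(1) on the left. -/
theorem ecop_mul_R : Δcop k 1 * (R : H ⊗[k] H) = R := by
  rw [comulcop_mul_R, LMod.R_mul_e]

/-- Mostly read backwards: it creates a copy of Δ(1) to the right of R, which can then be turned
into h₁ ⊗ ε_t(h₂). -/
theorem sw_R_mul_e {F : H → H → V}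
    (h1 : ∀ b, IsLinearMap k (fun a => F a b) := by fun_prop)
    (h2 : ∀ a, IsLinearMap k (fun b => F a b) := by fun_prop) :
    (sw (R : H ⊗[k] H) fun p q => sw (Δ k 1) fun a b => F (p * a) (q * b)) = sw (R : H ⊗[k] H) F := by
  conv_rhs => rw [← LMod.R_mul_e, sw_mul _ _ h1 h2]

end QuasitriangularSums

/-! ### Sums over the coproduct of an image. -/

section BialgHomSums

variable {k : Type v} {H L : Type u} [Field k] [Ring H] [Algebra k H] [WeakBialgebra k H]
  [Ring L] [Algebra k L] [WeakBialgebra k L] {V : Type*} [AddCommGroup V] [Module k V]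

theorem sw_Δ_map (f : H →ₐc[k] L) (h : H) {F : L → L → V}
    (h1 : ∀ b, IsLinearMap k (fun a => F a b) := by fun_prop)
    (h2 : ∀ a, IsLinearMap k (fun b => F a b) := by fun_prop) :
    sw (Δ k (f h)) F = sw (Δ k h) fun a b => F (f a) (f b) := by
  obtain ⟨B, hB', hB⟩ := exists_lift h1 h2
  have : Δ k (f h) = TensorProduct.map (f : H →ₗ[k] L) (f : H →ₗ[k] L) (Δ k h) :=
    (CoalgHomClass.map_comp_comul_apply f h).symm
  rw [hB, this]
  conv_lhs => rw [← sw_tmul_self (Δ k h)]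
  rw [map_sw, map_sw]
  exact sw_congr fun a b => hB' _ _

end BialgHomSums


/-! ### Source and target maps in a weak Hopf algebra. -/

section WeakHopf

variable {k : Type v} {H : Type u} [Field k] [Ring H] [Algebra k H] [QuantumGroupoid k H]
  {V : Type*} [AddCommGroup V] [Module k V]

theorem targetMap_eq_sw (h : H) : targetMap k h = sw (Δ k 1) fun a b => ε k (a * h) • b := by
  rw [targetMap_apply]
  conv_lhs => rw [← sw_tmul_self (Δ k (1 : H))]
  simp [sw, Finset.sum_mul]

theorem sourceMap_apply (h : H) : sourceMap k h = counitRight k ((1 ⊗ₜ[k] h) * Δ k 1) := rfl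

theorem sourceMap_eq_sw (h : H) : sourceMap k h = sw (Δ k 1) fun a b => ε k (h * b) • a := by
  rw [sourceMap_apply]
  conv_lhs => rw [← sw_tmul_self (Δ k (1 : H))]
  simp [sw, Finset.mul_sum]

theorem sw_mul_antipode (h : H) : (sw (Δ k h) fun a b => a * S k b) = targetMap k h := by
  rw [targetMap_eq_conv]
  conv_rhs => rw [← sw_tmul_self (Δ k h)]
  simp [sw]

theorem sw_antipode_mul (h : H) : (sw (Δ k h) fun a b => S k a * b) = sourceMap k h := by
  rw [← QuantumGroupoid.antipode_conv_id]
  change _ = LinearMap.mul' k H (TensorProduct.map (S k).toLinearMap LinearMap.id (Δ k h))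
  conv_rhs => rw [← sw_tmul_self (Δ k h)]
  simp [sw]

/-- This is S * (id * S) = S with id * S = ε_t; the other bracketing gives the companion with ε_s.
-/
theorem sw_antipode_mul_targetMap (h : H) :
    (sw (Δ k h) fun a b => S k a * targetMap k b) = S k h := by
  have h1 : conv k (S k (H := H)).toLinearMap (conv k LinearMap.id (S k).toLinearMap) =
    (S k).toLinearMap := QuantumGroupoid.antipode_conv_id_conv_antipode
  have h2 : conv k LinearMap.id (S k).toLinearMap = targetMap k (H := H) :=
    QuantumGroupoid.id_conv_antipode
  rw [h2] at h1
  refine Eq.trans ?_ (LinearMap.congr_fun h1 h)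
  change _ = LinearMap.mul' k H (TensorProduct.map (S k).toLinearMap (targetMap k) (Δ k h))
  conv_rhs => rw [← sw_tmul_self (Δ k h)]
  simp [sw]

theorem sw_sourceMap_mul_antipode (h : H) :
    (sw (Δ k h) fun a b => sourceMap k a * S k b) = S k h := by
  rw [← sw_antipode_mul_targetMap]
  simp only [← sw_mul_antipode, ← sw_antipode_mul, ← sw_mul_const, ← sw_const_mul, mul_assoc]
  exact sw_coassoc (F := fun a b c => S k a * (b * S k c)) h

/-- `F(h₁, ε_t(h₂)) = F(1₁ h, 1₂)`. -/
theorem sw_id_targetMap (h : H) {F : H → H → V}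
    (h1 : ∀ b, IsLinearMap k (fun a => F a b) := by fun_prop)
    (h2 : ∀ a, IsLinearMap k (fun b => F a b) := by fun_prop) :
    (sw (Δ k h) fun a b => F a (targetMap k b)) = sw (Δ k 1) fun a b => F (a * h) b := by
  obtain ⟨B, hB', hB⟩ := exists_lift h1 h2
  have := congrArg B (id_targetMap_Δ k h)
  conv_lhs at this => rw [← sw_tmul_self (Δ k h)]
  conv_rhs at this => rw [← sw_tmul_self (Δ k (1 : H))]
  simpa [sw, hB', Finset.sum_mul] using this

theorem sw_Δ_mul_e (h : H) {F : H → H → V}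
    (h1 : ∀ b, IsLinearMap k (fun a => F a b) := by fun_prop)
    (h2 : ∀ a, IsLinearMap k (fun b => F a b) := by fun_prop) :
    (sw (Δ k h) fun a b => sw (Δ k 1) fun c d => F (a * c) (b * d)) = sw (Δ k h) F := by
  rw [← sw_mul _ _ h1 h2, Δ_mul_e]

theorem sw_e_mul_Δ (h : H) {F : H → H → V}
    (h1 : ∀ b, IsLinearMap k (fun a => F a b) := by fun_prop)
    (h2 : ∀ a, IsLinearMap k (fun b => F a b) := by fun_prop) :
    (sw (Δ k 1) fun a b => sw (Δ k h) fun c d => F (a * c) (b * d)) = sw (Δ k h) F := by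
  rw [← sw_mul _ _ h1 h2, e_mul_Δ]

/-- `F(ε_s(h₁), h₂) = F(1₁, h 1₂)`. -/
theorem sw_sourceMap_id (h : H) {F : H → H → V}
    (h1 : ∀ b, IsLinearMap k (fun a => F a b) := by fun_prop)
    (h2 : ∀ a, IsLinearMap k (fun b => F a b) := by fun_prop) :
    (sw (Δ k h) fun a b => F (sourceMap k a) b) = sw (Δ k 1) fun a b => F a (h * b) := by
  calc (sw (Δ k h) fun a b => F (sourceMap k a) b)
    _ = sw (Δ k h) fun a b => sw (Δ k 1) fun c d => ε k (a * d) • F c b := sw_congr fun a b => by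
        rw [sourceMap_eq_sw, apply_sw (G := fun x => F x b) _ _ (h1 b)]
        exact sw_congr fun c d => (h1 b).map_smul _ _
    _ = sw (Δ k 1) fun c d => sw (Δ k h) fun a b => ε k (a * d) • F c b := sw_comm _ _ _
    -- Δ(h) = Δ(h)Δ(1) supplies a second copy of Δ(1). The weak unit axiom then fuses the two copies
    -- into Δ(1₂), and the counit collapses Δ(h 1₂).
    _ = sw (Δ k 1) fun c d => sw (Δ k 1) fun x y => sw (Δ k h) fun a b =>
          ε k (a * (x * d)) • F c (b * y) := sw_congr fun c d => by
        rw [sw_comm]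
        simp only [← mul_assoc]
        exact (sw_Δ_mul_e h (F := fun a b => ε k (a * d) • F c b)).symm
    _ = sw (Δ k 1) fun c d => sw (Δ k d) fun x y => sw (Δ k h) fun a b =>
          ε k (a * x) • F c (b * y) := (sw_comul_one_op (F := fun c x y => sw (Δ k h) fun a b =>
            ε k (a * x) • F c (b * y))).symm
    _ = sw (Δ k 1) fun c d => F c (h * d) := sw_congr fun c d => by
        rw [sw_comm, ← sw_counit_left (h * d) (F := F c)]
        exact (sw_Δ_mul h d (F := fun a b => ε k a • F c b)).symm

/-- The two weak unit axioms express 1₁ ⊗ 1₂ ⊗ 1₃ with its middle leg multiplied in opposite orders.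
Pairing the first leg with ε(· h) and the third with ε(g ·) turns the two expressions into the two
products. -/
theorem sourceMap_mul_targetMap_comm (g h : H) :
    sourceMap k g * targetMap k h = targetMap k h * sourceMap k g := by
  have h1 := (sw_comul_one (k := k) (H := H) (F := fun a b c => (ε k (g * c) * ε k (a * h)) • b)).symm.trans
    sw_comul_one_op
  have h2 : (sw (Δ k 1) fun a b => (sw (Δ k 1) fun c d =>
      (ε k (g * d) * ε k (a * h)) • (b * c))) = targetMap k h * sourceMap k g := by
    rw [targetMap_eq_sw, sourceMap_eq_sw, ← sw_mul_const]
    refine sw_congr fun a b => ?_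
    rw [← sw_const_mul]
    exact sw_congr fun c d => by simp only [smul_mul_assoc, mul_smul_comm, smul_smul, mul_comm (ε k (g * d))]
  have h3 : (sw (Δ k 1) fun a b => (sw (Δ k 1) fun c d =>
      (ε k (g * d) * ε k (a * h)) • (c * b))) = sourceMap k g * targetMap k h := by
    rw [targetMap_eq_sw, sourceMap_eq_sw, ← sw_const_mul]
    refine sw_congr fun a b => ?_
    rw [← sw_mul_const]
    exact sw_congr fun c d => by simp only [smul_mul_assoc, mul_smul_comm, smul_smul, mul_comm (ε k (g * d))]
  rw [← h2, ← h3]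
  exact h1.symm

/-- `Δ(ε_s(h)) = Δ(1) (1 ⊗ ε_s(h))`. -/
theorem sw_Δ_sourceMap (h : H) {F : H → H → V}
    (h1 : ∀ b, IsLinearMap k (fun a => F a b) := by fun_prop)
    (h2 : ∀ a, IsLinearMap k (fun b => F a b) := by fun_prop) :
    sw (Δ k (sourceMap k h)) F = sw (Δ k 1) fun a b => F a (b * sourceMap k h) := by
  calc sw (Δ k (sourceMap k h)) F
    _ = sw (Δ k 1) fun a b => sw (Δ k a) fun c d => ε k (h * b) • F c d := by
        rw [sourceMap_eq_sw, apply_sw (G := fun x => sw (Δ k x) F)]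
        exact sw_congr fun a b => by
          rw [LinearMap.map_smul, (isLinearMap_sw h1 h2 isLinearMap_id).map_smul]
          exact apply_sw (G := fun x => ε k (h * b) • x) _ _
    _ = sw (Δ k 1) fun a b => sw (Δ k b) fun c d => ε k (h * d) • F a c := sw_coassoc _
    _ = sw (Δ k 1) fun a b => sw (Δ k 1) fun c d => ε k (h * d) • F a (b * c) := sw_comul_one
    _ = sw (Δ k 1) fun a b => F a (b * sourceMap k h) := sw_congr fun a b => by
        rw [sourceMap_eq_sw, apply_sw (G := fun x => F a (b * x))]
        exact sw_congr fun c d => by rw [mul_smul_comm, (h2 a).map_smul]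

/-- `Δ(ε_s(h)) = (1 ⊗ ε_s(h)) Δ(1)`. -/
theorem sw_Δ_sourceMap_op (h : H) {F : H → H → V}
    (h1 : ∀ b, IsLinearMap k (fun a => F a b) := by fun_prop)
    (h2 : ∀ a, IsLinearMap k (fun b => F a b) := by fun_prop) :
    sw (Δ k (sourceMap k h)) F = sw (Δ k 1) fun a b => F a (sourceMap k h * b) := by
  calc sw (Δ k (sourceMap k h)) F
    _ = sw (Δ k 1) fun a b => sw (Δ k a) fun c d => ε k (h * b) • F c d := by
        rw [sourceMap_eq_sw, apply_sw (G := fun x => sw (Δ k x) F)]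
        exact sw_congr fun a b => by
          rw [LinearMap.map_smul, (isLinearMap_sw h1 h2 isLinearMap_id).map_smul]
          exact apply_sw (G := fun x => ε k (h * b) • x) _ _
    _ = sw (Δ k 1) fun a b => sw (Δ k b) fun c d => ε k (h * d) • F a c := sw_coassoc _
    _ = sw (Δ k 1) fun a b => sw (Δ k 1) fun c d => ε k (h * d) • F a (c * b) := sw_comul_one_op
    _ = sw (Δ k 1) fun a b => F a (sourceMap k h * b) := sw_congr fun a b => by
        rw [sourceMap_eq_sw, apply_sw (G := fun x => F a (x * b))]
        exact sw_congr fun c d => by rw [smul_mul_assoc, (h2 a).map_smul]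

/-- `Δ(ε_t(h)) = Δ(1) (ε_t(h) ⊗ 1)`. -/
theorem sw_Δ_targetMap (h : H) {F : H → H → V}
    (h1 : ∀ b, IsLinearMap k (fun a => F a b) := by fun_prop)
    (h2 : ∀ a, IsLinearMap k (fun b => F a b) := by fun_prop) :
    sw (Δ k (targetMap k h)) F = sw (Δ k 1) fun a b => F (a * targetMap k h) b := by
  rw [Δ_targetMap, sw_mul _ _ h1 h2]
  exact sw_congr fun a b => by
    rw [sw_tmul _ _ (by fun_prop) (by fun_prop), mul_one]

/-- `Δ(ε_t(h)) = (ε_t(h) ⊗ 1) Δ(1)`. -/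
theorem sw_Δ_targetMap_op (h : H) {F : H → H → V}
    (h1 : ∀ b, IsLinearMap k (fun a => F a b) := by fun_prop)
    (h2 : ∀ a, IsLinearMap k (fun b => F a b) := by fun_prop) :
    sw (Δ k (targetMap k h)) F = sw (Δ k 1) fun a b => F (targetMap k h * a) b := by
  rw [Δ_targetMap_op, sw_mul _ _ h1 h2, sw_tmul _ _ (by fun_prop) (by fun_prop)]
  simp only [one_mul]

/-- `Δ(h ε_t(x)) = Δ(h) (ε_t(x) ⊗ 1)`. -/
theorem sw_Δ_mul_targetMap (h x : H) {F : H → H → V}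
    (h1 : ∀ b, IsLinearMap k (fun a => F a b) := by fun_prop)
    (h2 : ∀ a, IsLinearMap k (fun b => F a b) := by fun_prop) :
    sw (Δ k (h * targetMap k x)) F = sw (Δ k h) fun a b => F (a * targetMap k x) b := by
  rw [sw_Δ_mul _ _ h1 h2]
  refine Eq.trans ?_ (sw_Δ_mul_e h)
  refine sw_congr fun a b => ?_
  simp only [mul_assoc]
  exact sw_Δ_targetMap x

/-- `Δ(h ε_s(x)) = Δ(h) (1 ⊗ ε_s(x))`. -/
theorem sw_Δ_mul_sourceMap (h x : H) {F : H → H → V}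
    (h1 : ∀ b, IsLinearMap k (fun a => F a b) := by fun_prop)
    (h2 : ∀ a, IsLinearMap k (fun b => F a b) := by fun_prop) :
    sw (Δ k (h * sourceMap k x)) F = sw (Δ k h) fun a b => F a (b * sourceMap k x) := by
  rw [sw_Δ_mul _ _ h1 h2]
  refine Eq.trans ?_ (sw_Δ_mul_e h)
  refine sw_congr fun a b => ?_
  simp only [mul_assoc]
  exact sw_Δ_sourceMap x

/-- `Δ(ε_s(x) h) = (1 ⊗ ε_s(x)) Δ(h)`. -/
theorem sw_Δ_sourceMap_mul (x h : H) {F : H → H → V}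
    (h1 : ∀ b, IsLinearMap k (fun a => F a b) := by fun_prop)
    (h2 : ∀ a, IsLinearMap k (fun b => F a b) := by fun_prop) :
    sw (Δ k (sourceMap k x * h)) F = sw (Δ k h) fun a b => F a (sourceMap k x * b) := by
  rw [sw_Δ_mul _ _ h1 h2]
  refine Eq.trans ?_ (sw_e_mul_Δ h)
  simp only [← mul_assoc]
  exact sw_Δ_sourceMap_op x (F := fun a b => sw (Δ k h) fun c d => F (a * c) (b * d))

theorem sourceMap_one : sourceMap k (1 : H) = 1 := by
  rw [sourceMap_apply, ← Algebra.TensorProduct.one_def, one_mul, counitRight_Δ]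

theorem sw_targetMap_mul (h : H) : (sw (Δ k h) fun a b => targetMap k a * b) = h := by
  have h1 := mul_targetMap k (Δ k h)
  rw [e_mul_Δ, counitLeft_Δ] at h1
  conv_rhs => rw [← h1]
  conv_rhs => rw [← sw_tmul_self (Δ k h)]
  simp [sw]

/-- By coassociativity id * ε_s = id * S * id = ε_t * id, and the last is the identity. -/
theorem sw_mul_sourceMap (h : H) : (sw (Δ k h) fun a b => a * sourceMap k b) = h := by
  conv_rhs => rw [← sw_targetMap_mul (k := k) h]
  simp only [← sw_mul_antipode, ← sw_antipode_mul, ← sw_mul_const, ← sw_const_mul, mul_assoc]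
  exact (sw_coassoc (F := fun a b c => a * (S k b * c)) h).symm

/-- For z in H_t one has Δ(hz) = h₁z ⊗ h₂, so the sum is id * S evaluated at hz. -/
theorem sw_mul_targetMap_mul_antipode (h x : H) :
    (sw (Δ k h) fun a b => a * targetMap k x * S k b) = targetMap k (h * targetMap k x) := by
  rw [← sw_mul_antipode (h * targetMap k x)]
  exact Eq.symm (sw_Δ_mul_targetMap h x)

theorem sw_antipode_mul_sourceMap_mul (h x : H) :
    (sw (Δ k h) fun a b => S k a * sourceMap k x * b) = sourceMap k (sourceMap k x * h) := by
  rw [← sw_antipode_mul (sourceMap k x * h)]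
  simp only [mul_assoc]
  exact Eq.symm (sw_Δ_sourceMap_mul x h)

theorem sourceMap_mul_sourceMap (h x : H) :
    sourceMap k (h * sourceMap k x) = sourceMap k h * sourceMap k x := by
  rw [← sw_antipode_mul (h * _), ← sw_antipode_mul h, ← sw_mul_const]
  simp only [mul_assoc]
  exact sw_Δ_mul_sourceMap h x

/-- The weak counit axiom with middle factor 1 gives ε(gh) = ε(g 1₂) ε(1₁ h). -/
theorem counit_sourceMap_mul (g h : H) : ε k (sourceMap k g * h) = ε k (g * h) := by
  have h1 := WeakBialgebra.counit_mul_mul_op (k := k) g 1 h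
  rw [mul_one] at h1
  rw [h1, sourceMap_eq_sw]
  conv_rhs => rw [← sw_tmul_self (Δ k (1 : H))]
  simp [sw, Finset.sum_mul, mul_comm]

theorem sourceMap_sourceMap_mul (g h : H) :
    sourceMap k (sourceMap k g * h) = sourceMap k (g * h) := by
  rw [sourceMap_eq_sw (_ * h), sourceMap_eq_sw (g * h)]
  simp only [mul_assoc, counit_sourceMap_mul]

/-- `F(1₁, ε_t(1₂)) = F(1₁, 1₂)`. -/
theorem sw_e_targetMap {F : H → H → V}
    (h1 : ∀ b, IsLinearMap k (fun a => F a b) := by fun_prop)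
    (h2 : ∀ a, IsLinearMap k (fun b => F a b) := by fun_prop) :
    (sw (Δ k 1) fun a b => F a (targetMap k b)) = sw (Δ k 1) F := by
  rw [sw_id_targetMap 1 h1 h2]
  simp only [mul_one]

/-- `F(ε_s(1₁), 1₂) = F(1₁, 1₂)`. -/
theorem sw_e_sourceMap {F : H → H → V}
    (h1 : ∀ b, IsLinearMap k (fun a => F a b) := by fun_prop)
    (h2 : ∀ a, IsLinearMap k (fun b => F a b) := by fun_prop) :
    (sw (Δ k 1) fun a b => F (sourceMap k a) b) = sw (Δ k 1) F := by
  rw [sw_sourceMap_id 1 h1 h2]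
  simp only [one_mul]

end WeakHopf


/-! ### The antipode reverses products and coproducts. -/

section Antipode

variable {k : Type v} {H : Type u} [Field k] [Ring H] [Algebra k H] [QuantumGroupoid k H]
  {V : Type*} [AddCommGroup V] [Module k V]

/-- The antipode is antimultiplicative. -/
theorem S_mul (g h : H) : S k (g * h) = S k h * S k g := by
  -- From ε_t(gh) = ε_t(g ε_t(h)) = g₁ ε_t(h) S(g₂). It shows that h ↦ S(h₂)-type factors appear in
  -- reversed order, before S is known to be antimultiplicative.
  have ht : ∀ g h : H, targetMap k (g * h) =
      sw (Δ k g) fun a b => sw (Δ k h) fun c d => a * c * S k d * S k b := fun g h => by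
    rw [← targetMap_mul_targetMap, ← sw_mul_targetMap_mul_antipode]
    refine sw_congr fun a b => ?_
    rw [sw_mul_const, ← sw_mul_antipode h, ← sw_const_mul]
    simp only [mul_assoc]
  have hs : ∀ g h : H, sourceMap k (g * h) =
      sw (Δ k h) fun a b => S k a * sourceMap k g * b := fun g h => by
    rw [← sourceMap_sourceMap_mul, ← sw_antipode_mul_sourceMap_mul]
  -- Uniqueness of a weak convolution inverse: S(gh) and S(h)S(g) both invert gh, so expanding
  -- S(g₁h₁) ε_t(g₂h₂) and regrouping the first two factors as ε_s(g₁h₁) passes from one to the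
  -- other.
  calc S k (g * h)
    _ = sw (Δ k g) fun a b => sw (Δ k h) fun c d => S k (a * c) * targetMap k (b * d) := by
        rw [← sw_antipode_mul_targetMap (g * h)]
        exact sw_Δ_mul g h
    _ = sw (Δ k g) fun a b => sw (Δ k h) fun c d => sw (Δ k b) fun b₁ b₂ =>
          sw (Δ k d) fun d₁ d₂ => S k (a * c) * (b₁ * d₁ * S k d₂ * S k b₂) := by
        simp only [ht, sw_const_mul]
    _ = sw (Δ k g) fun a b => sw (Δ k b) fun b₁ b₂ => sw (Δ k h) fun c d =>
          sw (Δ k c) fun c₁ c₂ => S k (a * c₁) * (b₁ * c₂ * S k d * S k b₂) :=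
        sw_congr fun a b => (sw_comm _ _ _).trans <| sw_congr fun b₁ b₂ =>
          Eq.symm (sw_coassoc (F := fun c d e => S k (a * c) * (b₁ * d * S k e * S k b₂)) h)
    _ = sw (Δ k g) fun a b => sw (Δ k a) fun a₁ a₂ => sw (Δ k h) fun c d =>
          sw (Δ k c) fun c₁ c₂ => S k (a₁ * c₁) * (a₂ * c₂ * S k d * S k b) :=
        Eq.symm (sw_coassoc (F := fun x y z => sw (Δ k h) fun c d =>
          sw (Δ k c) fun c₁ c₂ => S k (x * c₁) * (y * c₂ * S k d * S k z)) g)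
    _ = sw (Δ k g) fun a b => sw (Δ k h) fun c d => sourceMap k (a * c) * S k d * S k b :=
        sw_congr fun a b => by
          rw [sw_comm]
          refine sw_congr fun c d => ?_
          rw [← sw_antipode_mul, ← sw_mul_const, ← sw_mul_const]
          refine Eq.trans ?_ (Eq.symm (sw_Δ_mul a c))
          simp only [mul_assoc]
    _ = sw (Δ k g) fun a b => sw (Δ k h) fun c d => sw (Δ k c) fun c₁ c₂ =>
          S k c₁ * sourceMap k a * c₂ * S k d * S k b := by
        simp only [hs, sw_mul_const]
    _ = sw (Δ k g) fun a b => sw (Δ k h) fun c d => sw (Δ k d) fun d₁ d₂ =>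
          S k c * sourceMap k a * d₁ * S k d₂ * S k b := sw_congr fun a b => sw_coassoc h
    _ = sw (Δ k g) fun a b => sw (Δ k h) fun c d =>
          S k c * targetMap k d * (sourceMap k a * S k b) :=
        sw_congr fun a b => sw_congr fun c d => by
          -- Commutation of H_s with H_t separates the factors depending on g from those depending
          -- on h.
          rw [mul_assoc, ← mul_assoc (targetMap k d), ← sourceMap_mul_targetMap_comm,
            ← sw_mul_antipode d]
          simp only [mul_assoc, sw_const_mul]
          simp only [← mul_assoc, sw_mul_const]
    _ = S k h * S k g := by
        simp only [sw_mul_const, sw_const_mul, sw_antipode_mul_targetMap,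
          sw_sourceMap_mul_antipode]

theorem S_one : S k (1 : H) = 1 := by
  rw [← LMod.S_symm_one (k := k) (H := H), LinearEquiv.apply_symm_apply, LMod.S_symm_one]

/-- For z in H_t, inserting 1 = 1₁ S(1₂) gives ε_s(z) = ε_s(z 1₁) S(1₂) = ε_s(z₁) S(z₂) = S(z),
because 1₁ lies in H_s and Δ(z) = z 1₁ ⊗ 1₂. So the antipode acts on H_t as ε_s; its companion below
is the mirror statement on H_s. -/
theorem sourceMap_targetMap (x : H) : sourceMap k (targetMap k x) = S k (targetMap k x) := by
  calc sourceMap k (targetMap k x)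
    _ = sourceMap k (targetMap k x) * targetMap k 1 := by rw [targetMap_one, mul_one]
    _ = sw (Δ k 1) fun a b => sourceMap k (targetMap k x * a) * S k b := by
        rw [← sw_mul_antipode (1 : H), ← sw_const_mul]
        -- A device used throughout: a leg of Δ(1) is written as ε_s(1₁) or ε_t(1₂) so that lemmas
        -- about H_s or H_t apply to it, and the replacement is undone afterwards.
        refine (Eq.symm (sw_e_sourceMap
          (F := fun a b => sourceMap k (targetMap k x) * (a * S k b)))).trans ?_
        refine Eq.trans ?_ (sw_e_sourceMap
          (F := fun a b => sourceMap k (targetMap k x * a) * S k b))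
        simp only [sourceMap_mul_sourceMap, mul_assoc]
    _ = S k (targetMap k x) := by
        rw [← sw_sourceMap_mul_antipode (targetMap k x)]
        exact Eq.symm (sw_Δ_targetMap_op x)

theorem targetMap_sourceMap (x : H) : targetMap k (sourceMap k x) = S k (sourceMap k x) := by
  calc targetMap k (sourceMap k x)
    _ = sourceMap k 1 * targetMap k (sourceMap k x) := by rw [sourceMap_one, one_mul]
    _ = sw (Δ k 1) fun a b => S k a * targetMap k (b * sourceMap k x) := by
        rw [← sw_antipode_mul, ← sw_mul_const]
        refine (Eq.symm (sw_e_targetMap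
          (F := fun a b => S k a * b * targetMap k (sourceMap k x)))).trans ?_
        refine Eq.trans ?_ (sw_e_targetMap
          (F := fun a b => S k a * targetMap k (b * sourceMap k x)))
        simp only [targetMap_targetMap_mul, mul_assoc]
    _ = S k (sourceMap k x) := by
        rw [← sw_antipode_mul_targetMap (sourceMap k x)]
        exact Eq.symm (sw_Δ_sourceMap x)

/-- `Δ(1) (1 ⊗ ε_t(x)) = Δ(1) (ε_t'(x) ⊗ 1)`. -/
theorem sw_e_mul_targetMap (x : H) {F : H → H → V}
    (h1 : ∀ b, IsLinearMap k (fun a => F a b) := by fun_prop)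
    (h2 : ∀ a, IsLinearMap k (fun b => F a b) := by fun_prop) :
    (sw (Δ k 1) fun a b => F a (b * targetMap k x)) =
      sw (Δ k 1) fun a b => F (a * barTargetMap k x) b := by
  obtain ⟨B, hB', hB⟩ := exists_lift h1 h2
  have := congrArg B (e_mul_tmul_targetMap k x)
  conv_lhs at this => rw [← sw_tmul_self (Δ k (1 : H))]
  conv_rhs at this => rw [← sw_tmul_self (Δ k (1 : H))]
  simpa [sw, hB', Finset.sum_mul] using this

/-- `Δ(1) (ε_s(x) ⊗ 1) = Δ(1) (1 ⊗ S(ε_s(x)))`. -/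
theorem sw_e_mul_sourceMap (x : H) {F : H → H → V}
    (h1 : ∀ b, IsLinearMap k (fun a => F a b) := by fun_prop)
    (h2 : ∀ a, IsLinearMap k (fun b => F a b) := by fun_prop) :
    (sw (Δ k 1) fun a b => F (a * sourceMap k x) b) =
      sw (Δ k 1) fun a b => F a (b * S k (sourceMap k x)) := by
  -- For y = ε_s(x), both sides are y₁ ⊗ ε_t(y₂): one through 1₁y ⊗ 1₂, the other through Δ(y) = 1₁
  -- ⊗ 1₂y and ε_t = S on H_s.
  rw [← sw_id_targetMap _ h1 h2]
  refine (sw_Δ_sourceMap x).trans ?_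
  refine (Eq.symm (sw_e_targetMap (F := fun a b => F a (targetMap k (b * sourceMap k x))))).trans ?_
  simp only [targetMap_targetMap_mul, targetMap_sourceMap]
  exact sw_e_targetMap (F := fun a b => F a (b * S k (sourceMap k x)))

/-- `(1 ⊗ ε_t(x)) Δ(1) = (S(ε_t(x)) ⊗ 1) Δ(1)`. -/
theorem sw_targetMap_mul_e (x : H) {F : H → H → V}
    (h1 : ∀ b, IsLinearMap k (fun a => F a b) := by fun_prop)
    (h2 : ∀ a, IsLinearMap k (fun b => F a b) := by fun_prop) :
    (sw (Δ k 1) fun a b => F a (targetMap k x * b)) =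
      sw (Δ k 1) fun a b => F (S k (targetMap k x) * a) b := by
  rw [← sw_sourceMap_id _ h1 h2]
  refine (sw_Δ_targetMap_op x).trans ?_
  refine (Eq.symm (sw_e_sourceMap (F := fun a b => F (sourceMap k (targetMap k x * a)) b))).trans ?_
  simp only [sourceMap_mul_sourceMap, sourceMap_targetMap]
  exact sw_e_sourceMap (F := fun a b => F (S k (targetMap k x) * a) b)

theorem sw_S_mul_e : (sw (Δ k (1 : H)) fun a b => S k a * b) = 1 := by
  rw [sw_antipode_mul, sourceMap_one]

theorem sw_mul_S_e : (sw (Δ k (1 : H)) fun a b => a * S k b) = 1 := by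
  rw [sw_mul_antipode, targetMap_one]

/-- `S(1₂) ⊗ S(1₁) = 1₁ ⊗ 1₂`. -/
theorem sw_S_S_e {F : H → H → V}
    (h1 : ∀ b, IsLinearMap k (fun a => F a b) := by fun_prop)
    (h2 : ∀ a, IsLinearMap k (fun b => F a b) := by fun_prop) :
    (sw (Δ k 1) fun a b => F (S k b) (S k a)) = sw (Δ k 1) F := by
  -- After inserting a second copy of Δ(1) through 1 = 1'₁ S(1'₂), elements of the base slide across
  -- Δ(1) until one copy reads 1₁ ⊗ 1₂ and the other has become S(1'₁ S(1'₂)) = 1.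
  calc (sw (Δ k 1) fun a b => F (S k b) (S k a))
    _ = sw (Δ k 1) fun a b => sw (Δ k 1) fun c d => F (c * S k d * S k b) (S k a) :=
        sw_congr fun a b => by
          rw [← apply_sw (k := k) (G := fun x => F (x * S k b) (S k a)), sw_mul_S_e, one_mul]
    _ = sw (Δ k 1) fun a b => sw (Δ k 1) fun c d => F (a * S k d) (b * S k c) := by
        rw [sw_comm]
        refine Eq.trans ?_ ((sw_e_targetMap (F := fun a b => sw (Δ k 1) fun c d =>
          F (a * S k d) (b * S k c))))
        refine Eq.trans (Eq.symm (sw_e_targetMap (F := fun a b => sw (Δ k 1) fun c d =>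
          F (a * S k b * S k d) (S k c)))) ?_
        refine sw_congr fun a b => ?_
        have h3 := sw_e_mul_targetMap b (k := k) (F := fun c d => F (a * S k d) (S k c))
        simp only [S_mul, S_barTargetMap] at h3
        rw [← h3]
        simp only [mul_assoc]
    _ = sw (Δ k 1) fun a b => sw (Δ k 1) fun c d => F a (b * (S k (S k d) * S k c)) := by
        rw [sw_comm]
        refine Eq.trans ?_ (sw_comm _ _ _)
        refine Eq.trans ?_ (sw_e_targetMap (F := fun c d => sw (Δ k 1) fun a b =>
          F a (b * (S k (S k d) * S k c))))
        refine Eq.trans (Eq.symm (sw_e_targetMap (F := fun c d => sw (Δ k 1) fun a b =>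
          F (a * S k d) (b * S k c)))) ?_
        refine sw_congr fun c d => ?_
        have h3 := sw_e_mul_sourceMap (targetMap k d) (k := k) (F := fun a b => F a (b * S k c))
        simpa only [sourceMap_targetMap, mul_assoc] using h3
    _ = sw (Δ k 1) F := sw_congr fun a b => by
        simp only [← S_mul]
        rw [← apply_sw (k := k) (G := fun x => F a (b * S k x)), sw_mul_S_e, S_one, mul_one]

/-- The antipode is anticomultiplicative: `F(S(h)₁, S(h)₂) = F(S(h₂), S(h₁))`. -/
theorem sw_Δ_S (h : H) {F : H → H → V}
    (h1 : ∀ b, IsLinearMap k (fun a => F a b) := by fun_prop)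
    (h2 : ∀ a, IsLinearMap k (fun b => F a b) := by fun_prop) :
    sw (Δ k (S k h)) F = sw (Δ k h) fun a b => F (S k b) (S k a) := by
  symm
  -- Uniqueness of a weak inverse again, now for coproducts. Write S(h₂) as S(h₂) ε_t(h₃), turn
  -- ε_t(h₃) next to Δ(1) into Δ(h₃)Δ(S(h₄)), collapse the factors to the left of Δ(S(h₄)) to ε_s,
  -- and reassemble Δ(ε_s(h₁) S(h₂)) = Δ(S(h)).
  calc (sw (Δ k h) fun a b => F (S k b) (S k a))
    _ = sw (Δ k 1) fun x y => sw (Δ k h) fun a b => F (S k b * S k y) (S k a * S k x) := by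
        refine Eq.trans (Eq.symm (sw_e_mul_Δ h (F := fun a b => F (S k b) (S k a)))) ?_
        simp only [S_mul]
    _ = sw (Δ k h) fun a b => sw (Δ k 1) fun x y => F (S k b * x) (S k a * y) := by
        rw [sw_comm]
        exact sw_congr fun a b => sw_S_S_e (F := fun x y => F (S k b * x) (S k a * y))
    _ = sw (Δ k h) fun a b => sw (Δ k b) fun c d => sw (Δ k 1) fun x y =>
          F (S k c * targetMap k d * x) (S k a * y) := sw_congr fun a b => by
        rw [sw_comm]
        refine sw_congr fun x y => ?_
        rw [← apply_sw (k := k) (G := fun s => F (s * x) (S k a * y)), sw_antipode_mul_targetMap]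
    _ = sw (Δ k h) fun a b => sw (Δ k a) fun c d => sw (Δ k 1) fun x y =>
          F (S k d * targetMap k b * x) (S k c * y) :=
        Eq.symm (sw_coassoc (F := fun a c d => sw (Δ k 1) fun x y =>
          F (S k c * targetMap k d * x) (S k a * y)) h)
    _ = sw (Δ k h) fun a b => sw (Δ k a) fun c d => sw (Δ k b) fun p q => sw (Δ k p) fun p₁ p₂ =>
          sw (Δ k (S k q)) fun q₁ q₂ => F (S k d * p₁ * q₁) (S k c * p₂ * q₂) :=
        sw_congr fun a b => sw_congr fun c d => by
          simp only [mul_assoc]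
          refine (Eq.symm (sw_Δ_targetMap_op b (F := fun x y => F (S k d * x) (S k c * y)))).trans ?_
          rw [← sw_mul_antipode, apply_sw (k := k)
            (G := fun z => sw (Δ k z) (fun x y => F (S k d * x) (S k c * y)))]
          exact sw_congr fun p q => sw_Δ_mul p (S k q)
    _ = sw (Δ k h) fun a b => sw (Δ k a) fun r s => sw (Δ k r) fun c d => sw (Δ k s) fun p₁ p₂ =>
          sw (Δ k (S k b)) fun q₁ q₂ => F (S k d * p₁ * q₁) (S k c * p₂ * q₂) := by
        refine Eq.trans (Eq.symm ?_) (Eq.symm (sw_coassoc (F := fun r s b => sw (Δ k r) fun c d =>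
          sw (Δ k s) fun p₁ p₂ => sw (Δ k (S k b)) fun q₁ q₂ =>
            F (S k d * p₁ * q₁) (S k c * p₂ * q₂)) h))
        exact sw_congr fun a b => sw_comm _ _ _
    _ = sw (Δ k h) fun a b => sw (Δ k 1) fun x y => sw (Δ k (S k b)) fun q₁ q₂ =>
          F (x * q₁) (sourceMap k a * y * q₂) := sw_congr fun a b => by
        refine (sw_coassoc (F := fun c d s => sw (Δ k s) fun p₁ p₂ => sw (Δ k (S k b)) fun q₁ q₂ =>
            F (S k d * p₁ * q₁) (S k c * p₂ * q₂)) a).trans ?_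
        refine Eq.trans (b := sw (Δ k a) fun c t => sw (Δ k 1) fun x y =>
          sw (Δ k (S k b)) fun q₁ q₂ => F (x * q₁) (S k c * (t * y) * q₂))
          (sw_congr fun c t => ?_) ?_
        · refine (Eq.symm (sw_coassoc (F := fun d p₁ p₂ => sw (Δ k (S k b)) fun q₁ q₂ =>
            F (S k d * p₁ * q₁) (S k c * p₂ * q₂)) t)).trans ?_
          refine Eq.trans (sw_congr fun u p₂ => ?_)
            (sw_sourceMap_id t (F := fun x y => sw (Δ k (S k b)) fun q₁ q₂ =>
              F (x * q₁) (S k c * y * q₂)))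
          rw [← apply_sw (k := k) (G := fun z => sw (Δ k (S k b)) fun q₁ q₂ =>
              F (z * q₁) (S k c * p₂ * q₂)), sw_antipode_mul]
        · rw [sw_comm]
          refine sw_congr fun x y => ?_
          simp only [← mul_assoc]
          rw [← apply_sw (k := k) (G := fun z => sw (Δ k (S k b)) fun q₁ q₂ =>
              F (x * q₁) (z * y * q₂)), sw_antipode_mul]
    _ = sw (Δ k h) fun a b => sw (Δ k (sourceMap k a * S k b)) F := sw_congr fun a b => by
        refine Eq.trans ?_ (Eq.symm (sw_Δ_mul _ _))
        exact Eq.symm (sw_Δ_sourceMap_op a (F := fun x y => sw (Δ k (S k b)) fun c d =>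
          F (x * c) (y * d)))
    _ = sw (Δ k (S k h)) F := by
        rw [← apply_sw (k := k) (G := fun z => sw (Δ k z) F), sw_sourceMap_mul_antipode]

end Antipode


/-! ### Source elements as antipodes of target elements. -/

section Source

variable {k : Type v} {H : Type u} [Field k] [Ring H] [Algebra k H] [QuantumGroupoid k H]
  {V : Type*} [AddCommGroup V] [Module k V]

theorem exists_sourceMap_eq (g : H) : ∃ x, sourceMap k g = S k (targetMap k x) := by
  -- Found by rewriting 1₁ ε(g 1₂) with S(1₂) ⊗ S(1₁) = 1₁ ⊗ 1₂.
  refine ⟨sw (Δ k 1) fun a b => ε k (g * S k a) • b, ?_⟩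
  rw [map_sw, apply_sw (k := k) (G := fun x => S k x), sourceMap_eq_sw]
  refine (Eq.symm (sw_S_S_e (F := fun a b => ε k (g * b) • a))).trans ?_
  refine (Eq.symm (sw_e_targetMap (F := fun a b => ε k (g * S k a) • S k b))).trans ?_
  refine sw_congr fun a b => ?_
  rw [LinearMap.map_smul, LinearEquiv.map_smul]

theorem targetMap_mul_S_sourceMap (g x : H) :
    targetMap k (g * S k (sourceMap k x)) = targetMap k (g * sourceMap k x) := by
  rw [← targetMap_sourceMap, targetMap_mul_targetMap]

/-- Apply ε_t to S(h) = S(h₁) ε_t(h₂): the inner ε_t may be dropped, which leaves ε_t(ε_s(h)), and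
on H_s the target map is S. -/
theorem targetMap_S (h : H) : targetMap k (S k h) = S k (sourceMap k h) := by
  rw [← targetMap_sourceMap, ← sw_antipode_mul, ← sw_antipode_mul_targetMap, map_sw, map_sw]
  exact sw_congr fun a b => targetMap_mul_targetMap k _ _

end Source

/-! ### Quantum groupoid maps and the base algebras. -/

section Homs

variable {k : Type v} {H L : Type u} [Field k] [Ring H] [Algebra k H] [QuantumGroupoid k H]
  [Ring L] [Algebra k L] [QuantumGroupoid k L] {V : Type*} [AddCommGroup V] [Module k V]
  (f : H →ₐc[k] L)

theorem sw_e_map {F : L → L → V}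
    (h1 : ∀ b, IsLinearMap k (fun a => F a b) := by fun_prop)
    (h2 : ∀ a, IsLinearMap k (fun b => F a b) := by fun_prop) :
    sw (Δ k (1 : L)) F = sw (Δ k (1 : H)) fun a b => F (f a) (f b) := by
  rw [← map_one f, sw_Δ_map f 1 h1 h2]

theorem counit_map (h : H) : ε k (f h) = ε k h := CoalgHomClass.counit_comp_apply f h

theorem map_targetMap (h : H) : f (targetMap k h) = targetMap k (f h) := by
  rw [targetMap_eq_sw, targetMap_eq_sw, apply_sw (k := k) (G := fun x => f x), sw_e_map f]
  refine sw_congr fun a b => ?_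
  rw [map_smul, ← map_mul, counit_map]

theorem map_sourceMap (h : H) : f (sourceMap k h) = sourceMap k (f h) := by
  rw [sourceMap_eq_sw, sourceMap_eq_sw, apply_sw (k := k) (G := fun x => f x), sw_e_map f]
  refine sw_congr fun a b => ?_
  rw [map_smul, ← map_mul, counit_map]

/-- Preservation of the antipode is automatic: f ∘ S and S ∘ f are both weak convolution inverses of
f, and f commutes with ε_s and ε_t. -/
theorem map_S (h : H) : f (S k h) = S k (f h) := by
  calc f (S k h)
    _ = sw (Δ k h) fun a b => sw (Δ k b) fun c d => f (S k a) * (f c * S k (f d)) := by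
        rw [← sw_antipode_mul_targetMap, apply_sw (k := k) (G := fun x => f x)]
        refine sw_congr fun a b => ?_
        rw [map_mul, map_targetMap, ← sw_mul_antipode (f b), ← sw_const_mul,
          sw_Δ_map f b (by fun_prop) (by fun_prop)]
    _ = sw (Δ k h) fun a b => sw (Δ k a) fun c d => f (S k c) * (f d * S k (f b)) :=
        Eq.symm (sw_coassoc (F := fun a c d => f (S k a) * (f c * S k (f d))) h)
    _ = sw (Δ k h) fun a b => sourceMap k (f a) * S k (f b) := sw_congr fun a b => by
        rw [← map_sourceMap, ← sw_antipode_mul, apply_sw (k := k) (G := fun x => f x),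
          ← sw_mul_const]
        exact sw_congr fun c d => by rw [map_mul, mul_assoc]
    _ = S k (f h) := by
        rw [← sw_sourceMap_mul_antipode (f h), sw_Δ_map f h (by fun_prop) (by fun_prop)]

theorem transCounit_eq_sw (l : L) :
    transCounit f l = sw (Δ k (1 : H)) fun a b => ε k (f a * l) • b := by
  unfold transCounit
  conv_lhs => rw [← sw_tmul_self (Δ k (1 : H))]
  simp [sw]

theorem targetMap_transCounit (l : L) : targetMap k (transCounit f l) = transCounit f l := by
  rw [transCounit_eq_sw, map_sw]
  simp only [map_smul]
  exact sw_e_targetMap (F := fun a b => ε k (f a * l) • b)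

/-- As Δ(1) in L comes from H, the counit of C becomes ε_t after applying f; counit identities can
therefore be checked in L. -/
theorem map_transCounit (l : L) : f (transCounit f l) = targetMap k l := by
  rw [transCounit_eq_sw, apply_sw (k := k) (G := fun x => f x), targetMap_eq_sw, sw_e_map f]
  simp only [map_smul]

theorem exists_targetMap_eq (l : L) : ∃ x : H, targetMap k l = f (targetMap k x) :=
  ⟨transCounit f l, by rw [targetMap_transCounit, map_transCounit]⟩

/-- `f` is injective on the target space. -/
theorem map_targetMap_injective {x y : H} (h : f (targetMap k x) = f (targetMap k y)) :
    targetMap k x = targetMap k y := by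
  -- The counit formula is a left inverse of f on H_t, because f preserves counits.
  have key : ∀ x : H, transCounit f (f (targetMap k x)) = targetMap k x := fun x => by
    rw [transCounit_eq_sw]
    simp only [← map_mul, counit_map]
    rw [← targetMap_eq_sw, targetMap_targetMap]
  rw [← key, h, key]

end Homs

/-! ### How the R-matrix meets the base, the counit and S². -/

section RMatrix

variable {k : Type v} {H : Type u} [Field k] [Ring H] [Algebra k H] [QuantumGroupoid k H]
  [Quasitriangular k H] {V : Type*} [AddCommGroup V] [Module k V]

open Quasitriangular

omit [QuantumGroupoid k H] [Quasitriangular k H] in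
theorem comm_mul (s t : H ⊗[k] H) : TensorProduct.comm k H H (s * t) =
    TensorProduct.comm k H H s * TensorProduct.comm k H H t :=
  map_mul (Algebra.TensorProduct.comm k H H) s t

/-- `R (ε_t(x) ⊗ 1) = (1 ⊗ ε_t(x)) R`. -/
theorem R_mul_targetMap_tmul (x : H) :
    (R : H ⊗[k] H) * (targetMap k x ⊗ₜ[k] 1) = (1 ⊗ₜ[k] targetMap k x) * R := by
  -- With Δ(1) inserted, Δ(1)(z ⊗ 1) becomes Δ(z) for z in H_t, which crosses R as Δ^cop(z) = (1 ⊗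
  -- z) Δ^cop(1).
  conv_lhs => rw [← LMod.R_mul_e, mul_assoc, ← Δ_targetMap, ← comulcop_mul_R]
  conv_rhs => rw [← ecop_mul_R, ← mul_assoc]
  congr 1
  change TensorProduct.comm k H H _ = _
  rw [Δ_targetMap_op, comm_mul]
  rfl

omit [Quasitriangular k H] in
theorem Δ_sourceMap (x : H) : Δ k (sourceMap k x) = Δ k 1 * (1 ⊗ₜ[k] sourceMap k x) := by
  conv_lhs => rw [← sw_tmul_self (Δ k (sourceMap k x)), sw_Δ_sourceMap _ (by fun_prop) (by fun_prop)]
  conv_rhs => rw [← sw_tmul_self (Δ k (1 : H) * _), sw_mul_tmul _ _ _ (by fun_prop) (by fun_prop)]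
  simp only [mul_one]

omit [Quasitriangular k H] in
theorem Δ_sourceMap_op (x : H) : Δ k (sourceMap k x) = (1 ⊗ₜ[k] sourceMap k x) * Δ k 1 := by
  conv_lhs => rw [← sw_tmul_self (Δ k (sourceMap k x)),
    sw_Δ_sourceMap_op _ (by fun_prop) (by fun_prop)]
  conv_rhs => rw [← sw_tmul_self (_ * Δ k (1 : H)), sw_tmul_mul _ _ _ (by fun_prop) (by fun_prop)]
  simp only [one_mul]

/-- `R (1 ⊗ ε_s(x)) = (ε_s(x) ⊗ 1) R`. -/
theorem R_mul_tmul_sourceMap (x : H) :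
    (R : H ⊗[k] H) * (1 ⊗ₜ[k] sourceMap k x) = (sourceMap k x ⊗ₜ[k] 1) * R := by
  conv_lhs => rw [← LMod.R_mul_e, mul_assoc, ← Δ_sourceMap, ← comulcop_mul_R]
  conv_rhs => rw [← ecop_mul_R, ← mul_assoc]
  congr 1
  change TensorProduct.comm k H H _ = _
  rw [Δ_sourceMap_op, comm_mul]
  rfl

/-- `(1 ⊗ S(ε_t(x))) R = (ε_t(x) ⊗ 1) R`. -/
theorem S_targetMap_tmul_mul_R (x : H) :
    (1 ⊗ₜ[k] S k (targetMap k x)) * (R : H ⊗[k] H) = (targetMap k x ⊗ₜ[k] 1) * R := by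
  have h : (1 ⊗ₜ[k] targetMap k x) * Δ k (1 : H) = (S k (targetMap k x) ⊗ₜ[k] 1) * Δ k 1 := by
    rw [← sw_tmul_self (_ * Δ k (1 : H)), sw_tmul_mul _ _ _ (by fun_prop) (by fun_prop),
      ← sw_tmul_self ((S k (targetMap k x) ⊗ₜ[k] 1) * Δ k (1 : H)),
      sw_tmul_mul _ _ _ (by fun_prop) (by fun_prop)]
    simp only [one_mul]
    exact sw_targetMap_mul_e x
  have h' := congrArg (TensorProduct.comm k H H) h
  rw [comm_mul, comm_mul] at h'
  rw [← ecop_mul_R, ← mul_assoc, ← mul_assoc]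
  exact congrArg (· * R) h'.symm

/-- `R (ε_t(x) ⊗ 1) = (1 ⊗ ε_t(x)) R`. -/
theorem sw_R_mul_targetMap (x : H) {F : H → H → V}
    (h1 : ∀ b, IsLinearMap k (fun a => F a b) := by fun_prop)
    (h2 : ∀ a, IsLinearMap k (fun b => F a b) := by fun_prop) :
    (sw (R : H ⊗[k] H) fun p q => F (p * targetMap k x) q) =
      sw (R : H ⊗[k] H) fun p q => F p (targetMap k x * q) := by
  simpa only [sw_mul_tmul _ _ _ h1 h2, sw_tmul_mul _ _ _ h1 h2, mul_one, one_mul] using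
    congrArg (sw · F) (R_mul_targetMap_tmul (k := k) x)

/-- `R (1 ⊗ ε_s(x)) = (ε_s(x) ⊗ 1) R`. -/
theorem sw_R_mul_sourceMap (x : H) {F : H → H → V}
    (h1 : ∀ b, IsLinearMap k (fun a => F a b) := by fun_prop)
    (h2 : ∀ a, IsLinearMap k (fun b => F a b) := by fun_prop) :
    (sw (R : H ⊗[k] H) fun p q => F p (q * sourceMap k x)) =
      sw (R : H ⊗[k] H) fun p q => F (sourceMap k x * p) q := by
  simpa only [sw_mul_tmul _ _ _ h1 h2, sw_tmul_mul _ _ _ h1 h2, mul_one, one_mul] using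
    congrArg (sw · F) (R_mul_tmul_sourceMap (k := k) x)

/-- `R (1 ⊗ ε_t(x)) = R (ε_t'(x) ⊗ 1)`. -/
theorem sw_R_mul_targetMap_right (x : H) {F : H → H → V}
    (h1 : ∀ b, IsLinearMap k (fun a => F a b) := by fun_prop)
    (h2 : ∀ a, IsLinearMap k (fun b => F a b) := by fun_prop) :
    (sw (R : H ⊗[k] H) fun p q => F p (q * targetMap k x)) =
      sw (R : H ⊗[k] H) fun p q => F (p * barTargetMap k x) q := by
  have h : (R : H ⊗[k] H) * (1 ⊗ₜ[k] targetMap k x) = R * (barTargetMap k x ⊗ₜ[k] 1) := by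
    rw [← LMod.R_mul_e, mul_assoc, e_mul_tmul_targetMap, mul_assoc]
  simpa only [sw_mul_tmul _ _ _ h1 h2, mul_one] using congrArg (sw · F) h

/-- `(ε_t(x) ⊗ 1) R = (1 ⊗ S(ε_t(x))) R`. -/
theorem sw_targetMap_mul_R (x : H) {F : H → H → V}
    (h1 : ∀ b, IsLinearMap k (fun a => F a b) := by fun_prop)
    (h2 : ∀ a, IsLinearMap k (fun b => F a b) := by fun_prop) :
    (sw (R : H ⊗[k] H) fun p q => F (targetMap k x * p) q) =
      sw (R : H ⊗[k] H) fun p q => F p (S k (targetMap k x) * q) := by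
  simpa only [sw_tmul_mul _ _ _ h1 h2, one_mul] using
    congrArg (sw · F) (S_targetMap_tmul_mul_R (k := k) x).symm

/-- `(ε ⊗ id)(R) = 1`. -/
theorem sw_counit_R_left : (sw (R : H ⊗[k] H) fun p q => ε k p • q) = 1 := by
  set w := sw (R : H ⊗[k] H) fun p q => ε k p • q with hw
  -- Apply ε to the first leg of the hexagon for (Δ ⊗ id)(R).
  have h1 : (1 ⊗ₜ[k] w) * (R : H ⊗[k] H) = R := by
    calc (1 ⊗ₜ[k] w) * (R : H ⊗[k] H)
      _ = sw (R : H ⊗[k] H) fun a b => sw (R : H ⊗[k] H) fun c d => ε k a • (c ⊗ₜ[k] (b * d)) := by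
          rw [← sw_tmul_self ((1 ⊗ₜ[k] w) * R), sw_tmul_mul _ _ _ (by fun_prop) (by fun_prop),
            sw_comm]
          refine sw_congr fun c d => ?_
          rw [hw, apply_sw (k := k) (G := fun w => (1 * c) ⊗ₜ[k] (w * d))]
          simp only [one_mul, smul_mul_assoc, TensorProduct.tmul_smul]
      _ = R := by
          refine (Eq.symm (sw_comul_id_R (F := fun a c b => ε k a • (c ⊗ₜ[k] b)))).trans ?_
          conv_rhs => rw [← sw_tmul_self (R : H ⊗[k] H)]
          exact sw_congr fun a b => sw_counit_left a (F := fun c => c ⊗ₜ[k] b)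
  have h2 : (1 ⊗ₜ[k] w) * Δcop k (1 : H) = Δcop k 1 := by
    rw [← R_mul_Rinv, ← mul_assoc, h1]
  -- Multiplication by R⁻¹ left only Δ^cop(1), and applying ε to its first leg recovers w = 1.
  have h3 := congrArg (fun t => sw t (fun a b => ε k a • b)) h2
  rw [sw_tmul_mul _ _ _ (by fun_prop) (by fun_prop), sw_Δcop _ (by fun_prop) (by fun_prop),
    sw_Δcop _ (by fun_prop) (by fun_prop)] at h3
  simp only [one_mul] at h3
  rw [sw_counit_right 1 (F := fun x => w * x) (by fun_prop),
    sw_counit_right 1 (F := fun x => x) (by fun_prop), mul_one] at h3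
  exact h3

/-- `(id ⊗ ε)(R) = 1`. -/
theorem sw_counit_R_right : (sw (R : H ⊗[k] H) fun p q => ε k q • p) = 1 := by
  set w := sw (R : H ⊗[k] H) fun p q => ε k q • p with hw
  have h1 : (w ⊗ₜ[k] 1) * (R : H ⊗[k] H) = R := by
    calc (w ⊗ₜ[k] 1) * (R : H ⊗[k] H)
      _ = sw (R : H ⊗[k] H) fun a b => sw (R : H ⊗[k] H) fun c d => ε k b • ((a * c) ⊗ₜ[k] d) := by
          rw [← sw_tmul_self ((w ⊗ₜ[k] 1) * R), sw_tmul_mul _ _ _ (by fun_prop) (by fun_prop),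
            sw_comm]
          refine sw_congr fun c d => ?_
          rw [hw, apply_sw (k := k) (G := fun w => (w * c) ⊗ₜ[k] (1 * d))]
          simp only [one_mul, smul_mul_assoc, TensorProduct.smul_tmul']
      _ = R := by
          refine (Eq.symm (sw_id_comul_R (F := fun a c b => ε k b • (a ⊗ₜ[k] c)))).trans ?_
          conv_rhs => rw [← sw_tmul_self (R : H ⊗[k] H)]
          exact sw_congr fun a b => sw_counit_right b (F := fun c => a ⊗ₜ[k] c)
  have h2 : (w ⊗ₜ[k] 1) * Δcop k (1 : H) = Δcop k 1 := by
    rw [← R_mul_Rinv, ← mul_assoc, h1]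
  have h3 := congrArg (fun t => sw t (fun a b => ε k b • a)) h2
  rw [sw_tmul_mul _ _ _ (by fun_prop) (by fun_prop), sw_Δcop _ (by fun_prop) (by fun_prop),
    sw_Δcop _ (by fun_prop) (by fun_prop)] at h3
  simp only [one_mul] at h3
  rw [sw_counit_left 1 (F := fun x => w * x) (by fun_prop),
    sw_counit_left 1 (F := fun x => x) (by fun_prop), mul_one] at h3
  exact h3

/-- `ε_t(R⁽¹⁾) ⊗ R⁽²⁾ = 1₂ ⊗ 1₁`. -/
theorem sw_targetMap_R {F : H → H → V}
    (h1 : ∀ b, IsLinearMap k (fun a => F a b) := by fun_prop)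
    (h2 : ∀ a, IsLinearMap k (fun b => F a b) := by fun_prop) :
    (sw (R : H ⊗[k] H) fun p q => F (targetMap k p) q) = sw (Δ k (1 : H)) fun a b => F b a := by
  calc (sw (R : H ⊗[k] H) fun p q => F (targetMap k p) q)
    _ = sw (Δ k (1 : H)) fun a b => sw (R : H ⊗[k] H) fun p q => ε k (a * p) • F b q := by
        rw [sw_comm]
        refine sw_congr fun p q => ?_
        rw [targetMap_eq_sw, apply_sw (G := fun x => F x q) _ _ (h1 q)]
        exact sw_congr fun a b => (h1 q).map_smul _ _
    _ = sw (Δ k (1 : H)) fun a b => sw (R : H ⊗[k] H) fun p q => ε k p • F b (q * a) := by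
        -- The leg 1₁, an element of H_s, passes from the left of R⁽¹⁾ to the right of R⁽²⁾. Only (ε
        -- ⊗ id)(R) = 1 is then left.
        refine (Eq.symm (sw_e_sourceMap (F := fun a b => sw (R : H ⊗[k] H) fun p q =>
          ε k (a * p) • F b q))).trans (Eq.trans ?_ (sw_e_sourceMap (F := fun a b =>
            sw (R : H ⊗[k] H) fun p q => ε k p • F b (q * a))))
        exact sw_congr fun a b =>
          Eq.symm (sw_R_mul_sourceMap a (F := fun p q => ε k p • F b q))
    _ = sw (Δ k (1 : H)) fun a b => F b a := sw_congr fun a b => by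
        have := apply_sw (k := k) (R : H ⊗[k] H) (fun p q => ε k p • q) (G := fun x => F b (x * a))
        simp only [sw_counit_R_left, one_mul, smul_mul_assoc, (h2 b).map_smul] at this
        exact this.symm

/-- `R⁽¹⁾ ⊗ ε_s(R⁽²⁾) = ε_t'(1₂) ⊗ 1₁`. -/
theorem sw_sourceMap_R {F : H → H → V}
    (h1 : ∀ b, IsLinearMap k (fun a => F a b) := by fun_prop)
    (h2 : ∀ a, IsLinearMap k (fun b => F a b) := by fun_prop) :
    (sw (R : H ⊗[k] H) fun p q => F p (sourceMap k q)) =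
      sw (Δ k (1 : H)) fun a b => F (barTargetMap k b) a := by
  calc (sw (R : H ⊗[k] H) fun p q => F p (sourceMap k q))
    _ = sw (Δ k (1 : H)) fun a b => sw (R : H ⊗[k] H) fun p q => ε k (q * b) • F p a := by
        rw [sw_comm]
        refine sw_congr fun p q => ?_
        rw [sourceMap_eq_sw, apply_sw (G := fun x => F p x) _ _ (h2 p)]
        exact sw_congr fun a b => (h2 p).map_smul _ _
    _ = sw (Δ k (1 : H)) fun a b => sw (R : H ⊗[k] H) fun p q =>
          ε k q • F (p * barTargetMap k b) a := by
        refine (Eq.symm (sw_e_targetMap (F := fun a b => sw (R : H ⊗[k] H) fun p q =>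
          ε k (q * b) • F p a))).trans (sw_congr fun a b => ?_)
        exact sw_R_mul_targetMap_right b (F := fun p q => ε k q • F p a)
    _ = sw (Δ k (1 : H)) fun a b => F (barTargetMap k b) a := sw_congr fun a b => by
        have := apply_sw (k := k) (R : H ⊗[k] H) (fun p q => ε k q • p)
          (G := fun x => F (x * barTargetMap k b) a)
        simp only [sw_counit_R_right, one_mul, smul_mul_assoc, (h1 a).map_smul] at this
        exact this.symm

/-- The element `R⁽²⁾ S²(R⁽¹⁾)` intertwines `S²` with the identity. -/
theorem sw_R_mul_S_S (h : H) :
    (sw (R : H ⊗[k] H) fun p q => q * S k (S k p)) * S k (S k h) =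
      h * sw (R : H ⊗[k] H) fun p q => q * S k (S k p) := by
  -- The classical Drinfeld element argument, with Δ(1) inserted first: 1₁h ⊗ 1₂ = h₁ ⊗ h₂ S(h₃)
  -- makes a coproduct of h appear beside R, and the intertwining relation moves it to the left.
  calc (sw (R : H ⊗[k] H) fun p q => q * S k (S k p)) * S k (S k h)
    _ = sw (R : H ⊗[k] H) fun p q => sw (Δ k (1 : H)) fun a b =>
          (q * b) * S k (S k (p * (a * h))) := by
        rw [← sw_mul_const]
        refine Eq.trans ?_ (Eq.trans (Eq.symm (sw_R_mul_e (k := k)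
          (F := fun p q => q * S k (S k (p * h))))) ?_)
        · simp only [S_mul, mul_assoc]
        · simp only [mul_assoc]
    _ = sw (R : H ⊗[k] H) fun p q => sw (Δ k h) fun a b => sw (Δ k b) fun c d =>
          (q * (c * S k d)) * S k (S k (p * a)) := sw_congr fun p q => by
        refine (Eq.symm (sw_id_targetMap h
          (F := fun a b => (q * b) * S k (S k (p * a))))).trans ?_
        refine sw_congr fun a b => ?_
        rw [← sw_mul_antipode, ← sw_const_mul, ← sw_mul_const]
    _ = sw (Δ k h) fun a b => sw (R : H ⊗[k] H) fun p q => sw (Δ k a) fun c d =>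
          (q * d) * S k b * S k (S k (p * c)) := by
        rw [sw_comm]
        simp only [← mul_assoc]
        refine Eq.trans ?_ (sw_congr fun a b => sw_comm _ _ _)
        refine Eq.trans ?_ (Eq.symm (sw_coassoc (F := fun c d b => sw (R : H ⊗[k] H) fun p q =>
          q * d * S k b * S k (S k (p * c))) h))
        exact sw_congr fun a b => sw_comm _ _ _
    _ = sw (Δ k h) fun a b => sw (Δ k a) fun c d => sw (R : H ⊗[k] H) fun p q =>
          (c * q) * S k b * S k (S k (d * p)) := sw_congr fun a b =>
        Eq.symm (sw_comulcop_mul_R a (F := fun x y => y * S k b * S k (S k x)))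
    _ = sw (Δ k h) fun a b => sw (Δ k b) fun c d => sw (R : H ⊗[k] H) fun p q =>
          (a * q) * S k d * S k (S k (c * p)) :=
        sw_coassoc (F := fun c d b => sw (R : H ⊗[k] H) fun p q =>
          (c * q) * S k b * S k (S k (d * p))) h
    _ = sw (Δ k h) fun a b => sw (R : H ⊗[k] H) fun p q =>
          a * q * S k (S k p * sourceMap k b) := sw_congr fun a b => by
        rw [sw_comm]
        refine sw_congr fun p q => ?_
        rw [← sw_antipode_mul, ← sw_const_mul, ← LinearEquiv.coe_coe, map_sw, ← sw_const_mul]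
        simp only [LinearEquiv.coe_coe, S_mul, mul_assoc]
    _ = sw (Δ k h) fun a b => sw (R : H ⊗[k] H) fun p q => a * (sourceMap k b * q * S k (S k p)) :=
        sw_congr fun a b => by
          -- In a Hopf algebra ε_s(b) would be a scalar. Here it is S of an element of H_t, which
          -- can cross R and end as the left factor ε_s(b).
          obtain ⟨x, hx⟩ := exists_sourceMap_eq (k := k) b
          rw [hx]
          refine Eq.trans ?_ (sw_targetMap_mul_R x (F := fun p q => a * (q * S k (S k p))))
          simp only [S_mul, mul_assoc]
    _ = h * sw (R : H ⊗[k] H) fun p q => q * S k (S k p) := by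
        simp only [sw_const_mul, mul_assoc]
        simp only [← mul_assoc, sw_mul_const, sw_mul_sourceMap]

end RMatrix


/-! ### The adjoint action and the centralizer. -/

section Adjoint

variable {k : Type v} {H L : Type u} [Field k] [Ring H] [Algebra k H] [QuantumGroupoid k H]
  [Ring L] [Algebra k L] [QuantumGroupoid k L] {V : Type*} [AddCommGroup V] [Module k V]
  (f : H →ₐc[k] L)

theorem adj_eq_sw (h : H) (l : L) :
    adj f h l = sw (Δ k h) fun a b => f a * l * f (S k b) := by
  change sandwich f (Δ k h) l = _
  conv_lhs => rw [← sw_tmul_self (Δ k h)]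
  rw [apply_sw (k := k) (G := fun t => sandwich f t l)]
  rfl

theorem adj_mul (g h : H) (l : L) : adj f (g * h) l = adj f g (adj f h l) := by
  simp only [adj_eq_sw]
  refine (sw_Δ_mul g h).trans (sw_congr fun a b => ?_)
  rw [← sw_const_mul, ← sw_mul_const]
  simp only [S_mul, map_mul, mul_assoc]

variable {f}

theorem sourceMap_mul_of_mem {x : L} (hx : x ∈ sourceCentralizer k L) (g : L) :
    sourceMap k g * x = x * sourceMap k g :=
  (Subalgebra.mem_centralizer_iff k).1 hx _ ⟨g, rfl⟩

theorem mem_sourceCentralizer {x : L} (hx : ∀ g : L, sourceMap k g * x = x * sourceMap k g) :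
    x ∈ sourceCentralizer k L :=
  (Subalgebra.mem_centralizer_iff k).2 (by rintro _ ⟨g, rfl⟩; exact hx g)

theorem map_sourceMap_mul_of_mem {x : L} (hx : x ∈ sourceCentralizer k L) (g : H) :
    f (sourceMap k g) * x = x * f (sourceMap k g) := by
  rw [map_sourceMap, sourceMap_mul_of_mem hx]

theorem targetMap_mem (x : L) : targetMap k x ∈ sourceCentralizer k L :=
  mem_sourceCentralizer fun g => sourceMap_mul_targetMap_comm g x

variable (f)

theorem adj_one_eq_sw (x : L) : adj f 1 x = sw (Δ k (1 : L)) fun a b => a * x * S k b := by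
  rw [adj_eq_sw, sw_e_map f (by fun_prop) (by fun_prop)]
  simp only [map_S]

/-- No condition on x is needed: h · x = 1 · (h · x) has the form 1₁ y S(1₂), and S(z) 1₁ ⊗ 1₂ = 1₁
⊗ z 1₂ carries an element S(z) of L_s from the far left to the far right. -/
theorem adj_mem (h : H) (x : L) : adj f h x ∈ sourceCentralizer k L := by
  rw [← one_mul h, adj_mul]
  refine mem_sourceCentralizer fun g => ?_
  obtain ⟨z, hz⟩ := exists_sourceMap_eq (k := k) g
  rw [hz, adj_one_eq_sw, ← sw_const_mul, ← sw_mul_const]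
  refine Eq.trans ?_ ((Eq.symm (sw_targetMap_mul_e (k := k) z
    (F := fun a b => a * adj f h x * S k b))).trans ?_)
  · simp only [mul_assoc]
  · simp only [S_mul, mul_assoc]

variable {f}

/-- The leg 1₁ lies in L_s, so it commutes with x, and 1₁ S(1₂) = 1 remains. -/
theorem adj_one_of_mem {x : L} (hx : x ∈ sourceCentralizer k L) : adj f 1 x = x := by
  rw [adj_one_eq_sw]
  refine (Eq.symm (sw_e_sourceMap (F := fun a b => a * x * S k b))).trans ?_
  simp only [sourceMap_mul_of_mem hx]
  refine (sw_e_sourceMap (F := fun a b => x * a * S k b)).trans ?_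
  simp only [mul_assoc, sw_const_mul, sw_mul_S_e, mul_one]

/-- `(h₁ · x) h₂ = h x`. -/
theorem sw_adj_mul {x : L} (hx : x ∈ sourceCentralizer k L) (h : H) :
    (sw (Δ k h) fun a b => adj f a x * f b) = f h * x := by
  calc (sw (Δ k h) fun a b => adj f a x * f b)
    _ = sw (Δ k h) fun a b => sw (Δ k b) fun c d => f a * x * f (S k c * d) := by
        simp only [adj_eq_sw, ← sw_mul_const, map_mul]
        simp only [mul_assoc]
        exact sw_coassoc (F := fun a c d => f a * (x * (f (S k c) * f d))) h
    -- S(h₂) h₃ has collapsed to ε_s(h₂), whose image lies in L_s and so commutes with x; this is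
    -- where membership in C enters.
    _ = sw (Δ k h) fun a b => f (a * sourceMap k b) * x := sw_congr fun a b => by
        rw [map_mul, mul_assoc, map_sourceMap_mul_of_mem hx, ← sw_antipode_mul,
          apply_sw (k := k) (G := fun y => f a * (x * f y))]
        simp only [mul_assoc]
    _ = f h * x := by
        rw [← apply_sw (k := k) (G := fun y => f y * x), sw_mul_sourceMap]

/-- `S(h₁) (h₂ · x) = x S(h)`. -/
theorem sw_S_mul_adj {x : L} (hx : x ∈ sourceCentralizer k L) (h : H) :
    (sw (Δ k h) fun a b => f (S k a) * adj f b x) = x * f (S k h) := by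
  calc (sw (Δ k h) fun a b => f (S k a) * adj f b x)
    _ = sw (Δ k h) fun a b => sw (Δ k a) fun c d => f (S k c * d) * x * f (S k b) := by
        simp only [adj_eq_sw, ← sw_const_mul, map_mul]
        simp only [mul_assoc]
        exact Eq.symm (sw_coassoc (F := fun a c d => f (S k a) * (f c * (x * f (S k d)))) h)
    _ = sw (Δ k h) fun a b => x * f (sourceMap k a * S k b) := sw_congr fun a b => by
        rw [map_mul, ← mul_assoc, ← map_sourceMap_mul_of_mem hx, ← sw_antipode_mul,
          apply_sw (k := k) (G := fun y => f y * x * f (S k b))]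
    _ = x * f (S k h) := by
        rw [← apply_sw (k := k) (G := fun y => x * f y), sw_sourceMap_mul_antipode]

/-- `h · (x y) = (h₁ · x) (h₂ · y)`. -/
theorem adj_apply_mul {x : L} (hx : x ∈ sourceCentralizer k L) (y : L) (h : H) :
    adj f h (x * y) = sw (Δ k h) fun a b => adj f a x * adj f b y := by
  calc adj f h (x * y)
    _ = sw (Δ k h) fun a b => sw (Δ k a) fun c d => adj f c x * f d * y * f (S k b) := by
        rw [adj_eq_sw]
        refine sw_congr fun a b => ?_
        rw [← mul_assoc, ← sw_adj_mul hx a, ← sw_mul_const, ← sw_mul_const]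
    _ = sw (Δ k h) fun a b => sw (Δ k b) fun c d => adj f a x * f c * y * f (S k d) :=
        sw_coassoc h
    _ = sw (Δ k h) fun a b => adj f a x * adj f b y := sw_congr fun a b => by
        rw [adj_eq_sw f b, ← sw_const_mul]
        simp only [mul_assoc]

theorem adj_map_targetMap (h z : H) :
    adj f h (f (targetMap k z)) = f (targetMap k (h * targetMap k z)) := by
  rw [← sw_mul_targetMap_mul_antipode, adj_eq_sw, apply_sw (k := k) (G := fun y => f y)]
  simp only [map_mul]

/-- For s in H_s, Δ(s) = 1₁ ⊗ 1₂ s, so s acts by right multiplication by S(s) followed by the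
projection. -/
theorem adj_sourceMap (y : H) (x : L) :
    adj f (sourceMap k y) x = adj f 1 (x * f (S k (sourceMap k y))) := by
  rw [adj_eq_sw, adj_eq_sw]
  refine (sw_Δ_sourceMap y).trans ?_
  simp only [S_mul, map_mul, mul_assoc]

theorem adj_targetMap (z : H) (x : L) :
    adj f (targetMap k z) x = f (targetMap k z) * adj f 1 x := by
  rw [adj_eq_sw, adj_eq_sw, ← sw_const_mul]
  refine (sw_Δ_targetMap_op z).trans ?_
  simp only [map_mul, mul_assoc]

/-- Since Δ(y) = 1₁ ⊗ 1₂ y for y = ε_t'(x), the sum S(y₁) y₂ is y itself; so y lies in the source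
space. -/
theorem sourceMap_barTargetMap (x : H) : sourceMap k (barTargetMap k x) = barTargetMap k x := by
  rw [← sw_antipode_mul, Δ_barTargetMap, sw_mul_tmul _ _ _ (by fun_prop) (by fun_prop)]
  simp only [mul_one, ← mul_assoc, sw_mul_const, sw_S_mul_e, one_mul]

theorem adj_barTargetMap (y : H) (x : L) :
    adj f (barTargetMap k y) x = adj f 1 (x * f (targetMap k y)) := by
  rw [← sourceMap_barTargetMap, adj_sourceMap, sourceMap_barTargetMap, S_barTargetMap]

/-- `Δ(h · x) = h₁ x₁ S(h₃) ⊗ h₂ · x₂`. -/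
theorem sw_Δ_adj (h : H) (x : L) {F : L → L → V}
    (h1 : ∀ b, IsLinearMap k (fun a => F a b) := by fun_prop)
    (h2 : ∀ a, IsLinearMap k (fun b => F a b) := by fun_prop) :
    sw (Δ k (adj f h x)) F = sw (Δ k h) fun a b => sw (Δ k b) fun c d => sw (Δ k x) fun p q =>
      F (f a * p * f (S k d)) (adj f c q) := by
  calc sw (Δ k (adj f h x)) F
    _ = sw (Δ k h) fun a b => sw (Δ k a) fun a₁ a₂ => sw (Δ k x) fun p q =>
          sw (Δ k b) fun b₁ b₂ => F (f a₁ * p * f (S k b₂)) (f a₂ * q * f (S k b₁)) := by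
        rw [adj_eq_sw, apply_sw (k := k) (G := fun y => sw (Δ k y) F)]
        refine sw_congr fun a b => ?_
        refine (sw_Δ_mul _ _).trans ((sw_Δ_mul _ _).trans ((sw_Δ_map f a).trans ?_))
        refine sw_congr fun a₁ a₂ => sw_congr fun p q => ?_
        -- The antipode crosses the legs of the coproduct, so the two inner components of h will act
        -- together on x₂.
        exact (sw_Δ_map f (S k b)).trans (sw_Δ_S b)
    _ = sw (Δ k h) fun a b => sw (Δ k b) fun c d => sw (Δ k c) fun c₁ c₂ => sw (Δ k x) fun p q =>
          F (f a * p * f (S k d)) (f c₁ * q * f (S k c₂)) := by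
        refine (sw_coassoc (F := fun a₁ a₂ b => sw (Δ k x) fun p q =>
          sw (Δ k b) fun b₁ b₂ => F (f a₁ * p * f (S k b₂)) (f a₂ * q * f (S k b₁))) h).trans ?_
        refine sw_congr fun a t => ?_
        refine Eq.trans ?_ (Eq.symm (sw_coassoc (F := fun c₁ c₂ d => sw (Δ k x) fun p q =>
          F (f a * p * f (S k d)) (f c₁ * q * f (S k c₂))) t))
        exact sw_congr fun u w => sw_comm _ _ _
    _ = _ := sw_congr fun a b => sw_congr fun c d => by
        rw [sw_comm]
        refine sw_congr fun p q => ?_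
        rw [adj_eq_sw, apply_sw (k := k) (G := fun y => F (f a * p * f (S k d)) y)]

/-- For `l` in the centralizer, `Δ(l)` commutes with `1 ⊗ ε_s(g)`. -/
theorem sw_Δ_comm_sourceMap {l : L} (hl : l ∈ sourceCentralizer k L) (g : L) {F : L → L → V}
    (h1 : ∀ b, IsLinearMap k (fun a => F a b) := by fun_prop)
    (h2 : ∀ a, IsLinearMap k (fun b => F a b) := by fun_prop) :
    (sw (Δ k l) fun a b => F a (sourceMap k g * b)) =
      sw (Δ k l) fun a b => F a (b * sourceMap k g) := by
  rw [← sw_Δ_mul_sourceMap _ _ h1 h2, ← sw_Δ_sourceMap_mul _ _ h1 h2, sourceMap_mul_of_mem hl]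

-- As Δ(l) commutes with 1 ⊗ L_s, its second leg is fixed by the projection for the same reason that
-- an element of C is.
variable (f) in
theorem sw_Δ_adj_one {l : L} (hl : l ∈ sourceCentralizer k L) {F : L → L → V}
    (h1 : ∀ b, IsLinearMap k (fun a => F a b) := by fun_prop)
    (h2 : ∀ a, IsLinearMap k (fun b => F a b) := by fun_prop) :
    (sw (Δ k l) fun a b => F a (adj f 1 b)) = sw (Δ k l) F := by
  calc (sw (Δ k l) fun a b => F a (adj f 1 b))
    _ = sw (Δ k (1 : L)) fun c d => sw (Δ k l) fun a b => F a (c * b * S k d) := by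
        rw [sw_comm]
        refine sw_congr fun a b => ?_
        rw [adj_one_eq_sw, apply_sw (k := k) (G := fun y => F a y)]
    _ = sw (Δ k (1 : L)) fun c d => sw (Δ k l) fun a b => F a (b * c * S k d) := by
        refine (Eq.symm (sw_e_sourceMap (F := fun c d => sw (Δ k l) fun a b =>
          F a (c * b * S k d)))).trans (Eq.trans ?_ (sw_e_sourceMap (F := fun c d =>
            sw (Δ k l) fun a b => F a (b * c * S k d))))
        exact sw_congr fun c d => sw_Δ_comm_sourceMap hl c (F := fun a b => F a (b * S k d))
    _ = sw (Δ k l) F := by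
        rw [sw_comm]
        refine sw_congr fun a b => ?_
        rw [← apply_sw (k := k) (G := fun y => F a y)]
        simp only [mul_assoc, sw_const_mul, sw_mul_S_e, mul_one]

theorem targetMap_mul_map_S (g : L) (b : H) :
    targetMap k (g * f (S k b)) = targetMap k (g * f (sourceMap k b)) := by
  rw [map_S, ← targetMap_mul_targetMap, targetMap_S, targetMap_mul_S_sourceMap, map_sourceMap]

/-- `ε_t(h · x) = ε_t(h x)`. -/
theorem targetMap_adj {x : L} (hx : x ∈ sourceCentralizer k L) (h : H) :
    targetMap k (adj f h x) = targetMap k (f h * x) := by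
  rw [adj_eq_sw, map_sw]
  simp only [targetMap_mul_map_S]
  simp only [mul_assoc, ← map_sourceMap_mul_of_mem hx]
  conv_rhs => rw [← sw_mul_sourceMap (k := k) h, apply_sw (k := k) (G := fun y => targetMap k (f y * x))]
  simp only [map_mul, mul_assoc]

theorem targetMap_mul_barTargetMap (g h : L) :
    targetMap k (g * barTargetMap k h) = targetMap k (g * h) :=
  counitLeft_congr k (fun x => by
    rw [← mul_assoc, counit_mul_barTargetMap, mul_assoc]) _

/-- Under ε_t the right factor b may be replaced by ε_t'(b), which lies in L_s and so passes to the
left of a. Then a may be replaced by ε_t(a), and the exchange is reversed. This is multiplicativity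
of the counit of C. -/
theorem targetMap_mul_of_mem {a : L} (ha : a ∈ sourceCentralizer k L) (b : L) :
    targetMap k (a * b) = targetMap k (targetMap k a * targetMap k b) := by
  rw [← targetMap_mul_barTargetMap a b, ← sourceMap_barTargetMap, ← sourceMap_mul_of_mem ha,
    ← targetMap_mul_targetMap, sourceMap_mul_targetMap_comm, sourceMap_barTargetMap,
    targetMap_mul_barTargetMap, targetMap_mul_targetMap]

/-- Write 1₁ ε(l 1₂) as S(1₂) ε(l S(1₁)). On L_s the antipode is ε_t, which ε absorbs, and then 1₁
commutes with l. -/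
theorem sourceMap_eq_S_targetMap {l : L} (hl : l ∈ sourceCentralizer k L) :
    sourceMap k l = S k (targetMap k l) := by
  rw [targetMap_eq_sw, apply_sw (k := k) (G := fun y => S k y), sourceMap_eq_sw]
  refine (Eq.symm (sw_S_S_e (F := fun a b => ε k (l * b) • a))).trans ?_
  refine (Eq.symm (sw_e_sourceMap (F := fun a b => ε k (l * S k a) • S k b))).trans ?_
  refine Eq.trans ?_ (sw_e_sourceMap (F := fun a b => S k (ε k (a * l) • b)))
  refine sw_congr fun a b => ?_
  rw [← targetMap_sourceMap, counit_mul_targetMap, LinearEquiv.map_smul, sourceMap_mul_of_mem hl]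

end Adjoint


/-! ### The transmuted coproduct and its bialgebra identities. -/

section Transmutation

variable {k : Type v} {H L : Type u} [Field k] [Ring H] [Algebra k H] [QuantumGroupoid k H]
  [Quasitriangular k H]
  [Ring L] [Algebra k L] [QuantumGroupoid k L] {V : Type*} [AddCommGroup V] [Module k V]
  (f : H →ₐc[k] L)

open Quasitriangular

theorem transComul_eq_sw (l : L) : transComul f l = sw (R : H ⊗[k] H) fun p q =>
    sw (Δ k l) fun a b => (a * f (S k q)) ⊗ₜ[k] adj f p b := by
  change comulTwist f R (Δ k l) = _
  conv_lhs => rw [← sw_tmul_self (R : H ⊗[k] H), ← sw_tmul_self (Δ k l)]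
  rw [apply_sw (k := k) (G := fun t => comulTwist f t _)]
  refine sw_congr fun p q => ?_
  rw [map_sw]
  exact sw_congr fun a b => rfl

theorem sw_transComul (l : L) {F : L → L → V}
    (h1 : ∀ b, IsLinearMap k (fun a => F a b) := by fun_prop)
    (h2 : ∀ a, IsLinearMap k (fun b => F a b) := by fun_prop) :
    sw (transComul f l) F = sw (R : H ⊗[k] H) fun p q =>
      sw (Δ k l) fun a b => F (a * f (S k q)) (adj f p b) := by
  obtain ⟨B, hB', hB⟩ := exists_lift h1 h2
  simp only [hB, transComul_eq_sw, map_sw, hB']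

@[fun_prop] theorem isLinearMap_transComul : IsLinearMap k (transComul f) :=
  (comulTwist f R ∘ₗ Δ k).isLinear

theorem transAntipode_eq_sw (l : L) : transAntipode f l = sw (R : H ⊗[k] H) fun p q =>
    f q * S k (adj f p l) := by
  change antipodeTwist f R l = _
  conv_lhs => rw [← sw_tmul_self (R : H ⊗[k] H)]
  rw [apply_sw (k := k) (G := fun t => antipodeTwist f t _)]
  exact sw_congr fun p q => rfl

@[fun_prop] theorem isLinearMap_transAntipode : IsLinearMap k (transAntipode f) :=
  (antipodeTwist f R).isLinear

/-- The transmuted coproduct is `H`-linear. -/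
theorem sw_transComul_adj (h : H) (x : L) {F : L → L → V}
    (h1 : ∀ b, IsLinearMap k (fun a => F a b) := by fun_prop)
    (h2 : ∀ a, IsLinearMap k (fun b => F a b) := by fun_prop) :
    sw (transComul f (adj f h x)) F = sw (Δ k h) fun a b => sw (transComul f x) fun c d =>
      F (adj f a c) (adj f b d) := by
  calc sw (transComul f (adj f h x)) F
    _ = sw (R : H ⊗[k] H) fun p q => sw (Δ k h) fun a b => sw (Δ k b) fun c d =>
          sw (Δ k x) fun u w => F (f a * u * f (S k (q * d))) (adj f (p * c) w) := by
        rw [sw_transComul f _ h1 h2]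
        refine sw_congr fun p q => (sw_Δ_adj h x).trans ?_
        simp only [S_mul, map_mul, adj_mul, mul_assoc]
    _ = sw (Δ k h) fun a b => sw (Δ k b) fun c d => sw (R : H ⊗[k] H) fun p q =>
          sw (Δ k x) fun u w => F (f a * u * f (S k (c * q))) (adj f (d * p) w) := by
        rw [sw_comm]
        -- Δ(h · x) brings h₂ and h₃ to the right of R; the intertwining relation moves them to its
        -- left in exchanged order, ready to be read as an action on both legs.
        exact sw_congr fun a b => Eq.symm (sw_comulcop_mul_R b (F := fun p q =>
          sw (Δ k x) fun u w => F (f a * u * f (S k q)) (adj f p w)))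
    _ = sw (Δ k h) fun a b => sw (Δ k a) fun c d => sw (R : H ⊗[k] H) fun p q =>
          sw (Δ k x) fun u w => F (f c * u * f (S k (d * q))) (adj f (b * p) w) :=
        Eq.symm (sw_coassoc (F := fun a c d => sw (R : H ⊗[k] H) fun p q =>
          sw (Δ k x) fun u w => F (f a * u * f (S k (c * q))) (adj f (d * p) w)) h)
    _ = sw (Δ k h) fun a b => sw (transComul f x) fun c d => F (adj f a c) (adj f b d) :=
        sw_congr fun a b => by
          rw [sw_transComul f x (by fun_prop) (by fun_prop), sw_comm]
          refine sw_congr fun p q => ?_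
          rw [sw_comm]
          refine sw_congr fun u w => ?_
          rw [adj_eq_sw f a, apply_sw (k := k) (G := fun y => F y (adj f b (adj f p w)))]
          simp only [S_mul, map_mul, adj_mul, mul_assoc]

-- H-linearity at h = 1, together with 1 · l = l, shows that the coproduct of l is fixed by Δ(1), so
-- it lies in C ⊗_t C.
variable {f} in
theorem sw_transComul_eq_adj {l : L} (hl : l ∈ sourceCentralizer k L) {F : L → L → V}
    (h1 : ∀ b, IsLinearMap k (fun a => F a b) := by fun_prop)
    (h2 : ∀ a, IsLinearMap k (fun b => F a b) := by fun_prop) :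
    sw (transComul f l) F = sw (Δ k (1 : H)) fun a b => sw (transComul f l) fun c d =>
      F (adj f a c) (adj f b d) := by
  rw [← sw_transComul_adj f 1 l h1 h2, adj_one_of_mem hl]

-- Lets both legs of the coproduct of l be replaced by their projections, so that lemmas for
-- elements of C apply to each.
variable {f} in
theorem sw_transComul_adj_one {l : L} (hl : l ∈ sourceCentralizer k L) {F : L → L → V}
    (h1 : ∀ b, IsLinearMap k (fun a => F a b) := by fun_prop)
    (h2 : ∀ a, IsLinearMap k (fun b => F a b) := by fun_prop) :
    (sw (transComul f l) fun a b => F (adj f 1 a) (adj f 1 b)) = sw (transComul f l) F := by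
  rw [sw_transComul_eq_adj hl h1 h2, sw_transComul_eq_adj hl (by fun_prop) (by fun_prop)]
  simp only [← adj_mul, one_mul]

/-- The transmuted coproduct is coassociative. -/
theorem sw_transComul_coassoc (l : L) {F : L → L → L → V}
    (h1 : ∀ b c, IsLinearMap k (fun a => F a b c) := by fun_prop)
    (h2 : ∀ a c, IsLinearMap k (fun b => F a b c) := by fun_prop)
    (h3 : ∀ a b, IsLinearMap k (fun c => F a b c) := by fun_prop) :
    (sw (transComul f l) fun a b => sw (transComul f a) fun c d => F c d b) =
      sw (transComul f l) fun a b => sw (transComul f b) fun c d => F a c d := by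
  -- Both sides reduce to a sum over three copies of R. On the left the coproduct of S(R⁽²⁾) calls
  -- for the hexagon (id ⊗ Δ)(R); on the right, H-linearity applied to R⁽¹⁾ · l₂ calls for (Δ ⊗
  -- id)(R).
  calc (sw (transComul f l) fun a b => sw (transComul f a) fun c d => F c d b)
    _ = sw (R : H ⊗[k] H) fun p q => sw (Δ k l) fun x y => sw (R : H ⊗[k] H) fun r s =>
          sw (Δ k x) fun u w => sw (Δ k q) fun c d =>
            F (u * f (S k (s * d))) (adj f r (w * f (S k c))) (adj f p y) := by
        rw [sw_transComul f _ (by fun_prop) (by fun_prop)]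
        refine sw_congr fun p q => sw_congr fun x y => ?_
        rw [sw_transComul f _ (by fun_prop) (by fun_prop)]
        refine sw_congr fun r s => ?_
        refine (sw_Δ_mul _ _).trans (sw_congr fun u w => ?_)
        refine (sw_Δ_map f _).trans ((sw_Δ_S q).trans ?_)
        simp only [S_mul, map_mul, mul_assoc]
    _ = sw (R : H ⊗[k] H) fun p q => sw (Δ k l) fun x y => sw (Δ k q) fun c d =>
          sw (R : H ⊗[k] H) fun r s => sw (Δ k y) fun u w =>
            F (x * f (S k (s * d))) (adj f r (u * f (S k c))) (adj f p w) :=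
        sw_congr fun p q => by
          refine Eq.trans ?_ ((sw_coassoc (F := fun u w y => sw (Δ k q) fun c d =>
            sw (R : H ⊗[k] H) fun r s =>
            F (u * f (S k (s * d))) (adj f r (w * f (S k c))) (adj f p y)) l).trans ?_)
          · refine sw_congr fun x y => ?_
            rw [sw_comm]
            refine sw_congr fun u w => ?_
            rw [sw_comm]
          · refine sw_congr fun x y => ?_
            rw [sw_comm]
            refine sw_congr fun c d => ?_
            rw [sw_comm]
    _ = sw (R : H ⊗[k] H) fun p q => sw (R : H ⊗[k] H) fun a b => sw (R : H ⊗[k] H) fun r s =>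
          sw (Δ k l) fun x y => sw (Δ k y) fun u w =>
            F (x * f (S k (s * q))) (adj f r (u * f (S k b))) (adj f (p * a) w) := by
        refine Eq.trans ?_ (sw_id_comul_R (F := fun p b q => sw (R : H ⊗[k] H) fun r s =>
          sw (Δ k l) fun x y => sw (Δ k y) fun u w =>
            F (x * f (S k (s * q))) (adj f r (u * f (S k b))) (adj f p w)))
        refine sw_congr fun p q => ?_
        rw [sw_comm]
        refine sw_congr fun c d => ?_
        rw [sw_comm]
    _ = sw (R : H ⊗[k] H) fun p q => sw (Δ k p) fun c d => sw (R : H ⊗[k] H) fun a b =>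
          sw (Δ k l) fun x y => sw (Δ k y) fun u w =>
            F (x * f (S k q)) (adj f c (u * f (S k b))) (adj f (d * a) w) := by
        refine Eq.trans ?_ (Eq.symm (sw_comul_id_R (F := fun r p q => sw (R : H ⊗[k] H) fun a b =>
          sw (Δ k l) fun x y => sw (Δ k y) fun u w =>
            F (x * f (S k q)) (adj f r (u * f (S k b))) (adj f (p * a) w))))
        rw [sw_comm (R : H ⊗[k] H) (R : H ⊗[k] H) (fun a b c d => sw (R : H ⊗[k] H) fun p q =>
          sw (Δ k l) fun x y => sw (Δ k y) fun u w =>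
            F (x * f (S k (b * d))) (adj f a (u * f (S k q))) (adj f (c * p) w))]
        exact sw_congr fun p q => sw_comm _ _ _
    _ = sw (transComul f l) fun a b => sw (transComul f b) fun c d => F a c d := by
        rw [sw_transComul f l (by fun_prop) (by fun_prop)]
        refine sw_congr fun p q => ?_
        refine Eq.trans ?_ (sw_congr fun x y => Eq.symm (sw_transComul_adj f p y))
        refine Eq.trans ?_ (sw_comm _ _ _)
        refine sw_congr fun c d => ?_
        rw [sw_comm]
        refine sw_congr fun x y => ?_
        rw [sw_transComul f y (by fun_prop) (by fun_prop)]
        simp only [adj_mul]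

/-- The transmuted coproduct is multiplicative for the braided product on the tensor square. -/
theorem sw_transComul_mul {a b : L} (ha : a ∈ sourceCentralizer k L)
    (hb : b ∈ sourceCentralizer k L) {F : L → L → V}
    (h1 : ∀ b, IsLinearMap k (fun a => F a b) := by fun_prop)
    (h2 : ∀ a, IsLinearMap k (fun b => F a b) := by fun_prop) :
    sw (transComul f (a * b)) F = sw (transComul f a) fun a₁ a₂ => sw (transComul f b) fun b₁ b₂ =>
      sw (R : H ⊗[k] H) fun p q => F (a₁ * adj f q b₁) (adj f p a₂ * b₂) := by
  symm
  calc (sw (transComul f a) fun a₁ a₂ => sw (transComul f b) fun b₁ b₂ =>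
      sw (R : H ⊗[k] H) fun p q => F (a₁ * adj f q b₁) (adj f p a₂ * b₂))
    _ = sw (R : H ⊗[k] H) fun p q => sw (R : H ⊗[k] H) fun r s => sw (Δ k a) fun x y =>
          sw (transComul f b) fun b₁ b₂ =>
            F (x * (f (S k s) * adj f q b₁)) (adj f (p * r) y * b₂) := by
        rw [sw_transComul f a (by fun_prop) (by fun_prop)]
        refine Eq.trans ?_ (sw_comm _ _ _)
        refine sw_congr fun r s => ?_
        refine Eq.trans ?_ (sw_comm _ _ _)
        refine sw_congr fun x y => ?_
        refine Eq.trans (sw_comm _ _ _) ?_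
        simp only [adj_mul, mul_assoc]
    _ = sw (R : H ⊗[k] H) fun p q => sw (Δ k a) fun x y =>
          sw (transComul f b) fun b₁ b₂ => F (x * (b₁ * f (S k q))) (adj f p y * b₂) := by
        refine Eq.trans (Eq.symm (sw_id_comul_R (F := fun p s q => sw (Δ k a) fun x y =>
          sw (transComul f b) fun b₁ b₂ =>
            F (x * (f (S k s) * adj f q b₁)) (adj f p y * b₂)))) ?_
        refine sw_congr fun p q => ?_
        rw [sw_comm]
        refine sw_congr fun x y => ?_
        rw [sw_comm]
        refine Eq.trans ?_ (sw_transComul_adj_one hb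
          (F := fun b₁ b₂ => F (x * (b₁ * f (S k q))) (adj f p y * b₂)))
        -- The first hexagon has produced S(q₁)(q₂ · b₁), which equals b₁ S(q) only for b₁ in C;
        -- hence the legs are projected first.
        refine Eq.trans (Eq.symm (sw_transComul_adj_one hb
          (F := fun b₁ b₂ => sw (Δ k q) fun s q =>
            F (x * (f (S k s) * adj f q b₁)) (adj f p y * b₂)))) ?_
        refine sw_congr fun b₁ b₂ => ?_
        rw [← sw_S_mul_adj (adj_mem f 1 b₁), apply_sw (k := k)
          (G := fun z => F (x * z) (adj f p y * adj f 1 b₂))]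
    _ = sw (R : H ⊗[k] H) fun p q => sw (R : H ⊗[k] H) fun r s => sw (Δ k a) fun x y =>
          sw (Δ k b) fun u w => F (x * u * f (S k (q * s))) (adj f p y * adj f r w) := by
        refine sw_congr fun p q => ?_
        rw [sw_comm (R : H ⊗[k] H) (Δ k a)]
        refine sw_congr fun x y => ?_
        rw [sw_transComul f b (by fun_prop) (by fun_prop)]
        simp only [S_mul, map_mul, mul_assoc]
    _ = sw (R : H ⊗[k] H) fun p q => sw (Δ k p) fun c d => sw (Δ k a) fun x y =>
          sw (Δ k b) fun u w => F (x * u * f (S k q)) (adj f c y * adj f d w) :=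
        Eq.symm (sw_comul_id_R (F := fun c d q => sw (Δ k a) fun x y =>
          sw (Δ k b) fun u w => F (x * u * f (S k q)) (adj f c y * adj f d w)))
    _ = sw (R : H ⊗[k] H) fun p q => sw (Δ k a) fun x y =>
          sw (Δ k b) fun u w => F (x * u * f (S k q)) (adj f p (y * w)) :=
        sw_congr fun p q => by
          rw [sw_comm]
          -- The second leg of Δ(a) is projected into C so that (p₁ · y)(p₂ · w) can be recombined
          -- into p · (yw).
          refine Eq.trans (Eq.symm (sw_Δ_adj_one f ha (F := fun x y => sw (Δ k p) fun c d =>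
            sw (Δ k b) fun u w => F (x * u * f (S k q)) (adj f c y * adj f d w)))) ?_
          refine Eq.trans ?_ (sw_Δ_adj_one f ha (F := fun x y =>
            sw (Δ k b) fun u w => F (x * u * f (S k q)) (adj f p (y * w))))
          refine sw_congr fun x y => ?_
          rw [sw_comm]
          refine sw_congr fun u w => ?_
          rw [adj_apply_mul (adj_mem f 1 y), apply_sw (k := k) (G := fun z => F _ z)]
    _ = sw (transComul f (a * b)) F := by
        rw [sw_transComul f _ h1 h2]
        exact sw_congr fun p q => Eq.symm (sw_Δ_mul a b)

/-- The transmuted coproduct is unital. -/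
theorem sw_transComul_one {F : L → L → V}
    (h1 : ∀ b, IsLinearMap k (fun a => F a b) := by fun_prop)
    (h2 : ∀ a, IsLinearMap k (fun b => F a b) := by fun_prop) :
    sw (transComul f 1) F = sw (Δ k (1 : H)) fun a b => F (adj f a 1) (adj f b 1) := by
  have hone : ∀ h : H, adj f h 1 = f (targetMap k h) := fun h => by
    have := adj_map_targetMap (f := f) h 1
    rwa [targetMap_one, map_one, mul_one] at this
  calc sw (transComul f 1) F
    _ = sw (Δ k (1 : H)) fun a b => sw (R : H ⊗[k] H) fun p q =>
          F (f (a * S k q)) (f (targetMap k (p * targetMap k b))) := by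
        rw [sw_transComul f _ h1 h2, sw_comm, sw_e_map f (by fun_prop) (by fun_prop)]
        refine Eq.trans (Eq.symm (sw_e_targetMap (F := fun a b => sw (R : H ⊗[k] H) fun p q =>
          F (f a * f (S k q)) (adj f p (f b))))) ?_
        simp only [adj_map_targetMap, map_mul]
    _ = sw (Δ k (1 : H)) fun a b => sw (R : H ⊗[k] H) fun p q =>
          F (f (a * S k q * S k (targetMap k b))) (f (targetMap k p)) := by
        refine sw_congr fun a b => ?_
        refine (sw_R_mul_targetMap b (F := fun p q =>
          F (f (a * S k q)) (f (targetMap k p)))).trans ?_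
        simp only [S_mul, mul_assoc]
    _ = sw (Δ k (1 : H)) fun c d => sw (Δ k (1 : H)) fun a b =>
          F (f (S k (sourceMap k c) * (a * S k b))) (f d) := by
        rw [sw_comm]
        -- R⁽¹⁾ now occurs only through ε_t, so R becomes a flipped Δ(1); commuting H_s with H_t
        -- then cancels the other copy.
        refine (sw_targetMap_R (F := fun p q => sw (Δ k (1 : H)) fun a b =>
          F (f (a * S k q * S k (targetMap k b))) (f p))).trans ?_
        refine (Eq.symm (sw_e_sourceMap (F := fun c d => sw (Δ k (1 : H)) fun a b =>
          F (f (a * S k c * S k (targetMap k b))) (f d)))).trans ?_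
        refine sw_congr fun c d => ?_
        refine (sw_e_targetMap (F := fun a b =>
          F (f (a * S k (sourceMap k c) * S k b)) (f d))).trans ?_
        refine (Eq.symm (sw_e_sourceMap (F := fun a b =>
          F (f (a * S k (sourceMap k c) * S k b)) (f d)))).trans ?_
        simp only [← targetMap_sourceMap, sourceMap_mul_targetMap_comm]
        refine (sw_e_sourceMap (F := fun a b =>
          F (f (targetMap k (sourceMap k c) * a * S k b)) (f d))).trans ?_
        simp only [mul_assoc]
    _ = sw (Δ k (1 : H)) fun c d => F (f (S k (sourceMap k c))) (f d) := sw_congr fun c d => by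
        rw [← apply_sw (k := k) (G := fun z => F (f (S k (sourceMap k c) * z)) (f d)),
          sw_mul_S_e, mul_one]
    _ = sw (Δ k (1 : H)) fun a b => F (adj f a 1) (adj f b 1) := by
        simp only [hone, ← targetMap_sourceMap]
        refine (sw_e_sourceMap (F := fun c d => F (f (targetMap k c)) (f d))).trans ?_
        exact Eq.symm (sw_e_targetMap (F := fun c d => F (f (targetMap k c)) (f d)))

variable {f} in
/-- Left counitality of the transmuted coproduct. -/
theorem sw_transComul_targetMap_mul {l : L} (hl : l ∈ sourceCentralizer k L) :
    (sw (transComul f l) fun a b => targetMap k a * b) = l := by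
  calc (sw (transComul f l) fun a b => targetMap k a * b)
    _ = sw (R : H ⊗[k] H) fun p q => sw (Δ k l) fun x y =>
          targetMap k (x * f (sourceMap k q)) * adj f p y := by
        rw [sw_transComul f l (by fun_prop) (by fun_prop)]
        simp only [targetMap_mul_map_S]
    _ = sw (Δ k (1 : H)) fun a b => sw (Δ k l) fun x y =>
          targetMap k (x * f a) * adj f 1 (y * f b) := by
        -- Under ε_t the antipode of R⁽²⁾ has become ε_s(R⁽²⁾), so R reduces to a copy of Δ(1),
        -- which Δ(l) absorbs.
        refine (sw_sourceMap_R (F := fun p q => sw (Δ k l) fun x y =>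
          targetMap k (x * f q) * adj f p y)).trans ?_
        simp only [adj_barTargetMap]
        exact sw_e_targetMap (F := fun a b => sw (Δ k l) fun x y =>
          targetMap k (x * f a) * adj f 1 (y * f b))
    _ = sw (Δ k l) fun x y => targetMap k x * adj f 1 y := by
        rw [← sw_e_map f (F := fun a b => sw (Δ k l) fun x y =>
          targetMap k (x * a) * adj f 1 (y * b)) (by fun_prop) (by fun_prop), sw_comm]
        exact sw_Δ_mul_e l (F := fun x y => targetMap k x * adj f 1 y)
    _ = l := by
        rw [sw_Δ_adj_one f hl (F := fun x y => targetMap k x * y) (by fun_prop) (by fun_prop),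
          sw_targetMap_mul]

variable {f} in
/-- Right counitality of the transmuted coproduct. -/
theorem sw_transComul_mul_targetMap {l : L} (hl : l ∈ sourceCentralizer k L) :
    (sw (transComul f l) fun a b => a * targetMap k b) = l := by
  calc (sw (transComul f l) fun a b => a * targetMap k b)
    _ = sw (Δ k l) fun x y => sw (R : H ⊗[k] H) fun p q =>
          x * f (S k q) * targetMap k (f p * y) := by
        rw [sw_transComul f l (by fun_prop) (by fun_prop), sw_comm]
        refine (Eq.symm (sw_Δ_adj_one f hl (F := fun x y => sw (R : H ⊗[k] H) fun p q =>
          x * f (S k q) * targetMap k (adj f p y)))).trans ?_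
        simp only [targetMap_adj (adj_mem f _ _)]
        exact sw_Δ_adj_one f hl (F := fun x y => sw (R : H ⊗[k] H) fun p q =>
          x * f (S k q) * targetMap k (f p * y))
    _ = sw (Δ k l) fun x y => x * S k (targetMap k y) := sw_congr fun x y => by
        -- ε_t(y) comes from H_t, so it can cross R even though y lies in L; then ε_t(R⁽¹⁾) ⊗ R⁽²⁾
        -- is computed.
        obtain ⟨z, hz⟩ := exists_targetMap_eq f y
        rw [hz, ← map_S]
        simp only [← targetMap_mul_targetMap k _ y, hz, ← map_mul, ← map_targetMap]
        refine (sw_R_mul_targetMap z (F := fun p q =>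
          x * f (S k q) * f (targetMap k p))).trans ?_
        refine (sw_targetMap_R (F := fun p q =>
          x * f (S k (targetMap k z * q)) * f p)).trans ?_
        simp only [S_mul, ← sourceMap_targetMap z]
        refine (Eq.symm (sw_e_targetMap (F := fun a b =>
          x * f (S k a * sourceMap k (targetMap k z)) * f b))).trans ?_
        simp only [mul_assoc, ← map_mul, sourceMap_mul_targetMap_comm]
        refine (sw_e_targetMap (F := fun a b =>
          x * f (S k a * (b * sourceMap k (targetMap k z))))).trans ?_
        simp only [← mul_assoc]
        rw [← apply_sw (k := k) (G := fun t => x * f (t * sourceMap k (targetMap k z))),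
          sw_S_mul_e, one_mul]
    _ = l := by
        refine (sw_id_targetMap l (F := fun x y => x * S k y)).trans ?_
        rw [← adj_one_eq_sw f, adj_one_of_mem hl]

end Transmutation


/-! ### The braided antipode and its two convolution identities. -/

section TransmutationAntipode

variable {k : Type v} {H L : Type u} [Field k] [Ring H] [Algebra k H] [QuantumGroupoid k H]
  [Quasitriangular k H]
  [Ring L] [Algebra k L] [QuantumGroupoid k L] {V : Type*} [AddCommGroup V] [Module k V]
  (f : H →ₐc[k] L)

open Quasitriangular

/-- The transmuted antipode is `H`-linear. -/
theorem transAntipode_adj (h : H) (l : L) :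
    transAntipode f (adj f h l) = adj f h (transAntipode f l) := by
  calc transAntipode f (adj f h l)
    _ = sw (R : H ⊗[k] H) fun p q => sw (Δ k (1 : H)) fun a b =>
          -- The pattern of `sw_R_mul_S_S`: insert Δ(1), turn it into h₁ ⊗ h₂ S(h₃), and let R
          -- intertwine.
          f (q * b) * S k (adj f (p * (a * h)) l) := by
        rw [transAntipode_eq_sw]
        simp only [← adj_mul, ← mul_assoc _ _ h]
        exact Eq.symm (sw_R_mul_e (F := fun p q => f q * S k (adj f (p * h) l)))
    _ = sw (R : H ⊗[k] H) fun p q => sw (Δ k h) fun a b => sw (Δ k b) fun c d =>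
          f (q * c * S k d) * S k (adj f (p * a) l) := by
        refine sw_congr fun p q => ?_
        refine (Eq.symm (sw_id_targetMap h (F := fun a b =>
          f (q * b) * S k (adj f (p * a) l)))).trans ?_
        refine sw_congr fun a b => ?_
        rw [← sw_mul_antipode, apply_sw (k := k)
          (G := fun z => f (q * z) * S k (adj f (p * a) l))]
        simp only [mul_assoc]
    _ = sw (Δ k h) fun a b => sw (R : H ⊗[k] H) fun p q => sw (Δ k a) fun c d =>
          f (q * d * S k b) * S k (adj f (p * c) l) := by
        refine Eq.trans (sw_congr fun p q => Eq.symm (sw_coassoc (F := fun c d b =>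
          f (q * d * S k b) * S k (adj f (p * c) l)) h)) (sw_comm _ _ _)
    _ = sw (Δ k h) fun a b => sw (Δ k a) fun c d => sw (R : H ⊗[k] H) fun p q =>
          f (c * q * S k b) * S k (adj f (d * p) l) := sw_congr fun a b =>
        Eq.symm (sw_comulcop_mul_R a (F := fun p q => f (q * S k b) * S k (adj f p l)))
    _ = sw (Δ k h) fun a b => sw (Δ k b) fun c d => sw (R : H ⊗[k] H) fun p q =>
          f (a * q * S k d) * S k (adj f (c * p) l) :=
        sw_coassoc (F := fun c d b => sw (R : H ⊗[k] H) fun p q =>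
          f (c * q * S k b) * S k (adj f (d * p) l)) h
    _ = sw (Δ k h) fun a b => sw (R : H ⊗[k] H) fun p q =>
          f a * f q * S k (f b * adj f p l) := sw_congr fun a b => by
        rw [sw_comm]
        refine sw_congr fun p q => ?_
        rw [← sw_adj_mul (adj_mem f p l), apply_sw (k := k) (G := fun z => f a * f q * S k z)]
        simp only [S_mul, adj_mul, map_mul, map_S, mul_assoc]
    _ = adj f h (transAntipode f l) := by
        rw [adj_eq_sw, transAntipode_eq_sw]
        refine sw_congr fun a b => ?_
        rw [← sw_const_mul, ← sw_mul_const]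
        simp only [S_mul, map_S, mul_assoc]

variable {f} in
theorem transAntipode_mem {l : L} (hl : l ∈ sourceCentralizer k L) :
    transAntipode f l ∈ sourceCentralizer k L := by
  rw [← adj_one_of_mem (f := f) hl, transAntipode_adj]
  exact adj_mem f 1 _

variable {f} in
/-- The transmuted antipode is a right convolution inverse of the identity. -/
theorem sw_transComul_mul_transAntipode {l : L} (hl : l ∈ sourceCentralizer k L) :
    (sw (transComul f l) fun a b => a * transAntipode f b) = targetMap k l := by
  calc (sw (transComul f l) fun a b => a * transAntipode f b)
    _ = sw (Δ k l) fun x y => sw (R : H ⊗[k] H) fun p q => sw (R : H ⊗[k] H) fun r s =>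
          x * f (S k s * q) * S k (adj f (p * r) y) := by
        rw [sw_transComul f l (by fun_prop) (by fun_prop), sw_comm]
        refine sw_congr fun x y => ?_
        rw [sw_comm]
        simp only [transAntipode_eq_sw, ← sw_const_mul]
        simp only [adj_mul, map_mul, mul_assoc]
    _ = sw (Δ k l) fun x y => sw (R : H ⊗[k] H) fun p q =>
          x * f (sourceMap k q) * S k (adj f p y) := sw_congr fun x y => by
        -- The hexagon merges the R of the coproduct with that of the antipode, leaving S(R⁽²⁾₁)
        -- R⁽²⁾₂ = ε_s(R⁽²⁾).
        refine (Eq.symm (sw_id_comul_R (F := fun p s q =>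
          x * f (S k s * q) * S k (adj f p y)))).trans ?_
        refine sw_congr fun p q => ?_
        rw [← sw_antipode_mul, apply_sw (k := k) (G := fun z => x * f z * S k (adj f p y))]
    _ = sw (Δ k l) fun x y => sw (Δ k (1 : H)) fun a b =>
          x * f a * S k (adj f 1 (y * f b)) := sw_congr fun x y => by
        refine (sw_sourceMap_R (F := fun p q => x * f q * S k (adj f p y))).trans ?_
        simp only [adj_barTargetMap]
        exact sw_e_targetMap (F := fun a b => x * f a * S k (adj f 1 (y * f b)))
    _ = sw (Δ k l) fun x y => x * S k (adj f 1 y) := by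
        refine Eq.trans (sw_congr fun x y => Eq.symm (sw_e_map f (F := fun a b =>
          x * a * S k (adj f 1 (y * b))))) ?_
        exact sw_Δ_mul_e l (F := fun x y => x * S k (adj f 1 y))
    _ = targetMap k l := by
        rw [sw_Δ_adj_one f hl (F := fun x y => x * S k y) (by fun_prop) (by fun_prop),
          sw_mul_antipode]

/-- `ε_s(R⁽¹⁾) ⊗ R⁽²⁾ = 1₁ ⊗ 1₂`. -/
theorem sw_sourceMap_R_left {F : H → H → V}
    (h1 : ∀ b, IsLinearMap k (fun a => F a b) := by fun_prop)
    (h2 : ∀ a, IsLinearMap k (fun b => F a b) := by fun_prop) :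
    (sw (R : H ⊗[k] H) fun p q => F (sourceMap k p) q) = sw (Δ k (1 : H)) F := by
  calc (sw (R : H ⊗[k] H) fun p q => F (sourceMap k p) q)
    _ = sw (Δ k (1 : H)) fun a b => sw (R : H ⊗[k] H) fun p q => ε k (p * b) • F a q := by
        rw [sw_comm]
        refine sw_congr fun p q => ?_
        rw [sourceMap_eq_sw, apply_sw (G := fun x => F x q) _ _ (h1 q)]
        exact sw_congr fun a b => (h1 q).map_smul _ _
    _ = sw (Δ k (1 : H)) fun a b => sw (R : H ⊗[k] H) fun p q => ε k p • F a (b * q) := by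
        refine (Eq.symm (sw_e_targetMap (F := fun a b => sw (R : H ⊗[k] H) fun p q =>
          ε k (p * b) • F a q))).trans (Eq.trans ?_ (sw_e_targetMap (F := fun a b =>
            sw (R : H ⊗[k] H) fun p q => ε k p • F a (b * q))))
        exact sw_congr fun a b => sw_R_mul_targetMap b (F := fun p q => ε k p • F a q)
    _ = sw (Δ k (1 : H)) F := sw_congr fun a b => by
        have := apply_sw (k := k) (R : H ⊗[k] H) (fun p q => ε k p • q) (G := fun x => F a (b * x))
        simp only [sw_counit_R_left, mul_one, mul_smul_comm, (h2 a).map_smul] at this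
        exact this.symm

/-- `S_R(x) = R⁽²⁾ v S(x) S(R⁽¹⁾)` with `v = R⁽²⁾ S²(R⁽¹⁾)`. -/
theorem transAntipode_eq_sw_S (x : L) :
    transAntipode f x = sw (R : H ⊗[k] H) fun p q =>
      f (q * sw (R : H ⊗[k] H) fun r s => s * S k (S k r)) * S k x * f (S k p) := by
  calc transAntipode f x
    _ = sw (R : H ⊗[k] H) fun p q => sw (Δ k p) fun a b =>
          f (q * S k (S k b)) * S k x * f (S k a) := by
        rw [transAntipode_eq_sw]
        refine sw_congr fun p q => ?_
        rw [adj_eq_sw, apply_sw (k := k) (G := fun z => f q * S k z)]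
        simp only [S_mul, map_mul, map_S, mul_assoc]
    _ = sw (R : H ⊗[k] H) fun p q => sw (R : H ⊗[k] H) fun r s =>
          f (q * s * S k (S k r)) * S k x * f (S k p) :=
        sw_comul_id_R (F := fun a b q => f (q * S k (S k b)) * S k x * f (S k a))
    _ = _ := by
        refine sw_congr fun p q => ?_
        rw [apply_sw (k := k) (G := fun z => f (q * z) * S k x * f (S k p))]
        simp only [mul_assoc]

/-- With `v = R⁽²⁾ S²(R⁽¹⁾)` one has `R⁽²⁾ v S(R⁽¹⁾) = 1`. -/
theorem sw_R_mul_mul_S :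
    (sw (R : H ⊗[k] H) fun p q => q * (sw (R : H ⊗[k] H) fun r s => s * S k (S k r)) * S k p) =
      1 := by
  calc (sw (R : H ⊗[k] H) fun p q =>
        q * (sw (R : H ⊗[k] H) fun r s => s * S k (S k r)) * S k p)
    _ = sw (R : H ⊗[k] H) fun p q => sw (R : H ⊗[k] H) fun r s => q * s * S k (p * S k r) := by
        simp only [← sw_const_mul, ← sw_mul_const, S_mul, mul_assoc]
    _ = sw (R : H ⊗[k] H) fun p q => q * S k (targetMap k p) := by
        -- The two copies of R fuse into R⁽²⁾ S(R⁽¹⁾₁ S(R⁽¹⁾₂)), whose inner factor is ε_t(R⁽¹⁾).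
        refine (Eq.symm (sw_comul_id_R (F := fun p r q => q * S k (p * S k r)))).trans ?_
        refine sw_congr fun p q => ?_
        rw [← sw_mul_antipode, apply_sw (k := k) (G := fun z => q * S k z)]
    _ = 1 := by
        refine (sw_targetMap_R (F := fun p q => q * S k p)).trans sw_mul_S_e

variable {f} in
/-- The transmuted antipode is a left convolution inverse of the identity. -/
theorem sw_transAntipode_mul {l : L} (hl : l ∈ sourceCentralizer k L) :
    (sw (transComul f l) fun a b => transAntipode f a * b) = targetMap k l := by
  obtain ⟨v, hv⟩ : ∃ v : H, (sw (R : H ⊗[k] H) fun r s => s * S k (S k r)) = v := ⟨_, rfl⟩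
  have hvS : ∀ h, v * S k (S k h) = h * v := hv ▸ sw_R_mul_S_S
  calc (sw (transComul f l) fun a b => transAntipode f a * b)
    _ = sw (Δ k l) fun x y => sw (R : H ⊗[k] H) fun p q => sw (R : H ⊗[k] H) fun r s =>
          f (q * s * v) * S k x * f (S k p) * adj f r y := by
        rw [sw_transComul f l (by fun_prop) (by fun_prop), sw_comm]
        refine sw_congr fun x y => Eq.trans (sw_congr fun r s => ?_) (sw_comm _ _ _)
        rw [transAntipode_eq_sw_S, ← sw_mul_const]
        refine sw_congr fun p q => ?_
        -- The antipode of x S(s) contains S²(s) next to v, and commuting it past v turns it into s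
        -- on the left.
        rw [hv, mul_assoc q s v, ← hvS s, S_mul]
        simp only [map_mul, map_S, mul_assoc]
    _ = sw (Δ k l) fun x y => sw (R : H ⊗[k] H) fun p q => sw (R : H ⊗[k] H) fun r s =>
          sw (R : H ⊗[k] H) fun t u =>
          f (q * (s * u) * v) * S k x * f (S k p * r) * y * f (S k t) := by
        refine sw_congr fun x y => sw_congr fun p q => ?_
        refine Eq.trans ?_ (sw_comul_id_R (F := fun r t s =>
          f (q * s * v) * S k x * f (S k p * r) * y * f (S k t)))
        simp only [adj_eq_sw, ← sw_const_mul]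
        simp only [map_mul, mul_assoc]
    _ = sw (Δ k l) fun x y => sw (Δ k (1 : H)) fun a b => sw (R : H ⊗[k] H) fun t u =>
          f (b * u * v) * S k x * f a * y * f (S k t) := by
        refine sw_congr fun x y => ?_
        refine Eq.trans ?_ (sw_sourceMap_R_left (F := fun a b => sw (R : H ⊗[k] H) fun t u =>
          f (b * u * v) * S k x * f a * y * f (S k t)))
        -- The factors of f(S(p) r) combine through the hexagon into S(p₁) p₂ = ε_s(p), which
        -- reduces this copy of R to Δ(1).
        refine Eq.trans (b := sw (R : H ⊗[k] H) fun p q => sw (Δ k p) fun c d =>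
          sw (R : H ⊗[k] H) fun t u =>
            f (q * u * v) * S k x * f (S k c * d) * y * f (S k t)) ?_ (sw_congr fun p q => ?_)
        swap
        · rw [← sw_antipode_mul, apply_sw (k := k) (G := fun z => sw (R : H ⊗[k] H) fun t u =>
            f (q * u * v) * S k x * f z * y * f (S k t))]
        · refine Eq.trans ?_ (Eq.symm (sw_comul_id_R (F := fun c d q =>
            sw (R : H ⊗[k] H) fun t u =>
              f (q * u * v) * S k x * f (S k c * d) * y * f (S k t))))
          simp only [mul_assoc]
    _ = sw (Δ k (1 : H)) fun a b => sw (R : H ⊗[k] H) fun t u =>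
          f (b * u * v) * S k (targetMap k l) * f a * f (S k t) := by
        rw [sw_comm]
        refine (Eq.symm (sw_e_sourceMap (F := fun a b => sw (Δ k l) fun x y =>
          sw (R : H ⊗[k] H) fun t u =>
            f (b * u * v) * S k x * f a * y * f (S k t)))).trans ?_
        refine Eq.trans ?_ (sw_e_sourceMap (F := fun a b => sw (R : H ⊗[k] H) fun t u =>
          f (b * u * v) * S k (targetMap k l) * f a * f (S k t)))
        refine sw_congr fun a b => ?_
        rw [sw_comm]
        refine sw_congr fun t u => ?_
        rw [map_sourceMap, ← sourceMap_eq_S_targetMap hl, ← sw_antipode_mul l]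
        rw [← sw_const_mul, ← sw_mul_const, ← sw_mul_const]
        -- The element of L_s sitting between S(l₁) and l₂ moves out, so that they meet and give
        -- ε_s(l) = S(ε_t(l)).
        refine Eq.trans ?_ ((sw_Δ_comm_sourceMap hl (f a) (F := fun x y =>
          f (b * u * v) * S k x * y * f (S k t))).trans ?_)
        · simp only [mul_assoc]
        · simp only [mul_assoc]
    _ = sw (R : H ⊗[k] H) fun t u => f (u * v) * S k (targetMap k l) * f (S k t) := by
        refine (Eq.symm (sw_e_targetMap (F := fun a b => sw (R : H ⊗[k] H) fun t u =>
          f (b * u * v) * S k (targetMap k l) * f a * f (S k t)))).trans ?_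
        refine Eq.trans (b := sw (Δ k (1 : H)) fun a b => sw (R : H ⊗[k] H) fun t u =>
          f (u * v) * S k (targetMap k l) * f (a * S k (targetMap k b)) * f (S k t))
          (sw_congr fun a b => ?_) ?_
        · refine (Eq.symm (sw_R_mul_targetMap b (F := fun t u =>
            f (u * v) * S k (targetMap k l) * f a * f (S k t)))).trans ?_
          simp only [S_mul, map_mul, mul_assoc]
        · refine (sw_e_targetMap (F := fun a b => sw (R : H ⊗[k] H) fun t u =>
            f (u * v) * S k (targetMap k l) * f (a * S k b) * f (S k t))).trans ?_
          rw [← apply_sw (k := k) (G := fun z => sw (R : H ⊗[k] H) fun t u =>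
            f (u * v) * S k (targetMap k l) * f z * f (S k t)), sw_mul_S_e]
          simp only [map_one, mul_one]
    _ = targetMap k l := by
        obtain ⟨z, hz⟩ := exists_targetMap_eq f l
        -- ε_t(l) = f(z) crosses R to the far left, where R⁽²⁾ v S(R⁽¹⁾) = 1 finishes.
        have h1 := sw_R_mul_targetMap (k := k) z (F := fun t u => f (u * v * S k t))
        have h2 := sw_R_mul_mul_S (k := k) (H := H)
        rw [hv] at h2
        simp only [S_mul, mul_assoc] at h1
        rw [← apply_sw (k := k) (G := fun t => f (targetMap k z * t))] at h1
        simp only [mul_assoc] at h2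
        rw [h2, mul_one] at h1
        rw [hz, ← map_S, ← h1]
        simp only [map_mul, mul_assoc]

end TransmutationAntipode


/-! ### Elementwise formulas in the module category. -/

namespace LMod

variable {k : Type v} {H : Type u} [Field k] [Ring H] [Algebra k H]

@[fun_prop] theorem isLinearMap_ρ (X : LMod k H) (x : X.carrier) :
    IsLinearMap k (fun h => X.ρ h x) :=
  (LinearMap.applyₗ x ∘ₗ X.ρ.toLinearMap).isLinear

theorem act₂_eq_sw (X Y : LMod k H) (t : H ⊗[k] H) (x : X.carrier) (y : Y.carrier) :
    act₂ X Y t (x ⊗ₜ[k] y) = sw t fun a b => X.ρ a x ⊗ₜ[k] Y.ρ b y := by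
  conv_lhs => rw [← sw_tmul_self t]
  exact map_sw (LinearMap.applyₗ (x ⊗ₜ[k] y) ∘ₗ (act₂ X Y).toLinearMap) _ _

variable [QuantumGroupoid k H] {X Y : LMod k H}

@[fun_prop] theorem isLinearMap_tm_left {M : Type*} [AddCommGroup M] [Module k M]
    {g : M → X.carrier} (hg : IsLinearMap k g) (y : Y.carrier) :
    IsLinearMap k (fun m => tm (g m) y) :=
  isLinearMap_comp (f := (tmL X Y).flip y) (LinearMap.isLinear _) hg

@[fun_prop] theorem isLinearMap_tm_right {M : Type*} [AddCommGroup M] [Module k M]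
    {g : M → Y.carrier} (hg : IsLinearMap k g) (x : X.carrier) :
    IsLinearMap k (fun m => tm x (g m)) :=
  isLinearMap_comp (tmL X Y x).isLinear hg

theorem incl_tm (x : X.carrier) (y : Y.carrier) :
    incl X Y (tm x y) = sw (Δ k (1 : H)) fun a b => X.ρ a x ⊗ₜ[k] Y.ρ b y :=
  act₂_eq_sw X Y _ x y

theorem tensor_ρ_tm (h : H) (x : X.carrier) (y : Y.carrier) :
    (tensor X Y).ρ h (tm x y) = sw (Δ k h) fun a b => tm (X.ρ a x) (Y.ρ b y) := by
  rw [tm, tensor_ρ, act₂_eq_sw, map_sw]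
  rfl

theorem sw_e_tm (x : X.carrier) (y : Y.carrier) :
    (sw (Δ k (1 : H)) fun a b => tm (X.ρ a x) (Y.ρ b y)) = tm x y := by
  rw [← tensor_ρ_tm, map_one]
  rfl

theorem braidIso_hom_tm_eq_sw [Quasitriangular k H] (x : X.carrier) (y : Y.carrier) :
    lin (braidIso X Y).hom (tm x y) =
      sw (Quasitriangular.R : H ⊗[k] H) fun p q => tm (Y.ρ q y) (X.ρ p x) := by
  rw [braidIso_hom_tm, act₂_eq_sw, apply_sw (k := k)
    (G := fun t => proj Y X (TensorProduct.comm k X.carrier Y.carrier t))]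
  rfl

-- The associators only rebracket, so the middle interchange is the braiding of the two inner
-- factors.
open MonoidalCategory in
theorem lin_tensorμ_tm [Quasitriangular k H] (W X Y Z : LMod k H) (w : W.carrier) (x : X.carrier)
    (y : Y.carrier) (z : Z.carrier) :
    lin (tensorμ W X Y Z) (tm (X := tensor W X) (Y := tensor Y Z) (tm w x) (tm y z)) =
      sw (Quasitriangular.R : H ⊗[k] H) fun p q =>
        tm (X := tensor W Y) (Y := tensor X Z) (tm w (Y.ρ q y)) (tm (X.ρ p x) z) := by
  change lin (assocIso W Y (tensor X Z)).inv (lin (tensorMap (𝟙 W) (assocIso Y X Z).hom)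
    (lin (tensorMap (𝟙 W) (tensorMap (braidIso X Y).hom (𝟙 Z)))
      (lin (tensorMap (𝟙 W) (assocIso X Y Z).inv) (lin (assocIso W X (tensor Y Z)).hom
        (tm (tm w x) (tm y z)))))) = _
  rw [assocIso_hom_tm, tensorMap_tm, assocIso_inv_tm, tensorMap_tm, tensorMap_tm,
    tensorMap_tm, braidIso_hom_tm_eq_sw]
  simp only [lin_id]
  rw [apply_sw (k := k) (G := fun t => lin (assocIso W Y (tensor X Z)).inv
    (tm w (lin (assocIso Y X Z).hom (tm t z))))]
  refine sw_congr fun p q => ?_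
  rw [assocIso_hom_tm, assocIso_inv_tm]

theorem unit_ρ_unitOne (z : (unit k H).carrier) :
    (unit k H).ρ (unitVal k H z) (unitOne k H) = z := by
  apply unitVal_injective
  rw [unit_ρ, unitVal_unitOne, mul_one, targetMap_unitVal]

/-- The unit module is generated by 1, by `unit_ρ_unitOne`. -/
theorem hom_ext_unit {f g : unit k H ⟶ X}
    (w : lin f (unitOne k H) = lin g (unitOne k H)) : f = g :=
  hom_ext fun z => by rw [← unit_ρ_unitOne z, lin_comm, lin_comm, w]

end LMod

/-! ### The centralizer as a module, and its structure morphisms. -/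

section CentralizerModule

open LMod

variable {k : Type v} {H L : Type u} [Field k] [Ring H] [Algebra k H] [QuantumGroupoid k H]
  [Ring L] [Algebra k L] [QuantumGroupoid k L] (f : H →ₐc[k] L)

/-- The adjoint action of `H` on the centralizer of `L_s`. -/
noncomputable def adjHom : H →ₐ[k] Module.End k (sourceCentralizer k L) :=
  AlgHom.ofLinearMap
    { toFun := fun h => ((adj f h).comp (sourceCentralizer k L).val.toLinearMap).codRestrict
        (Subalgebra.toSubmodule (sourceCentralizer k L)) fun x => adj_mem f h x
      map_add' := fun a b => LinearMap.ext fun x =>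
        Subtype.ext (LinearMap.congr_fun (map_add (adj f) a b) (x : L))
      map_smul' := fun c a => LinearMap.ext fun x =>
        Subtype.ext (LinearMap.congr_fun (map_smul (adj f) c a) (x : L)) }
    (LinearMap.ext fun x => Subtype.ext (adj_one_of_mem x.2))
    (fun a b => LinearMap.ext fun x => Subtype.ext (adj_mul f a b x))

/-- The centralizer of `L_s` as an `H`-module. -/
noncomputable def centralizerMod : LMod k H := LMod.of (adjHom f)

namespace centralizerMod

/-- The inclusion of the centralizer in `L`. -/
noncomputable def val : (centralizerMod f).carrier →ₗ[k] L :=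
  (sourceCentralizer k L).val.toLinearMap

/-- The projection `l ↦ 1 · l` onto the centralizer. -/
noncomputable def pr : L →ₗ[k] (centralizerMod f).carrier :=
  (adj f 1).codRestrict (Subalgebra.toSubmodule (sourceCentralizer k L)) (adj_mem f 1)

variable {f}

theorem val_injective : Function.Injective (val f) := Subtype.val_injective

theorem val_mem (x : (centralizerMod f).carrier) : val f x ∈ sourceCentralizer k L := x.2

theorem val_pr (l : L) : val f (pr f l) = adj f 1 l := rfl

theorem val_pr_of_mem {l : L} (hl : l ∈ sourceCentralizer k L) : val f (pr f l) = l :=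
  adj_one_of_mem hl

theorem val_ρ (h : H) (x : (centralizerMod f).carrier) :
    val f ((centralizerMod f).ρ h x) = adj f h (val f x) := rfl

theorem pr_adj (h : H) (l : L) : pr f (adj f h l) = (centralizerMod f).ρ h (pr f l) :=
  val_injective (by rw [val_pr, val_ρ, val_pr, ← adj_mul, ← adj_mul, one_mul, mul_one])

theorem pr_adj_one (l : L) : pr f (adj f 1 l) = pr f l := by
  rw [pr_adj, map_one]
  rfl

variable (f)

/-- The product of the centralizer, on `C ⊗ C`. -/
noncomputable def mulLin : (tensor (centralizerMod f) (centralizerMod f)).carrier →ₗ[k]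
    (centralizerMod f).carrier :=
  -- The projection only makes the map land in C; on products of elements of C it changes nothing.
  pr f ∘ₗ LinearMap.mul' k L ∘ₗ TensorProduct.map (val f) (val f) ∘ₗ incl _ _

-- The Δ(1) hidden in x ⊗_t y is absorbed, since (1₁ · x)(1₂ · y) = 1 · (xy) = xy.
variable {f} in
theorem val_mulLin_tm (x y : (centralizerMod f).carrier) :
    val f (mulLin f (tm x y)) = val f x * val f y := by
  change val f (pr f (LinearMap.mul' k L (TensorProduct.map (val f) (val f)
    (incl _ _ (tm x y))))) = _
  have : LinearMap.mul' k L (TensorProduct.map (val f) (val f) (incl _ _ (tm x y))) =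
      val f x * val f y := by
    rw [incl_tm, map_sw, map_sw]
    simp only [TensorProduct.map_tmul, LinearMap.mul'_apply, val_ρ]
    rw [← adj_apply_mul (val_mem x), adj_one_of_mem (mul_mem (val_mem x) (val_mem y))]
  rw [this, val_pr_of_mem (mul_mem (val_mem x) (val_mem y))]

/-- The product `a ⊗_t b ↦ a b`. -/
noncomputable def mulHom :
    tensor (centralizerMod f) (centralizerMod f) ⟶ centralizerMod f where
  toLin := mulLin f
  comm h := tm_ext (f := mulLin f ∘ₗ (tensor _ _).ρ h)
    (g := (centralizerMod f).ρ h ∘ₗ mulLin f) fun x y => val_injective (by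
      rw [LinearMap.comp_apply, LinearMap.comp_apply, tensor_ρ_tm, map_sw, map_sw, val_ρ,
        val_mulLin_tm, adj_apply_mul (val_mem x)]
      exact sw_congr fun a b => val_mulLin_tm _ _)

theorem val_mulHom_tm (x y : (centralizerMod f).carrier) :
    val f (lin (mulHom f) (tm x y)) = val f x * val f y := val_mulLin_tm x y

/-- The unit `z ↦ f(z)`. -/
noncomputable def oneHom : unit k H ⟶ centralizerMod f where
  toLin := pr f ∘ₗ (f : H →ₗ[k] L) ∘ₗ unitVal k H
  comm h z := val_injective (by
    change adj f 1 (f (targetMap k (h * unitVal k H z))) =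
      adj f h (adj f 1 (f (unitVal k H z)))
    rw [← adj_mul, mul_one, ← targetMap_unitVal z, adj_map_targetMap, adj_map_targetMap, one_mul,
      targetMap_targetMap])

theorem val_oneHom (z : (unit k H).carrier) : val f (lin (oneHom f) z) = f (unitVal k H z) := by
  change adj f 1 (f (unitVal k H z)) = _
  rw [← targetMap_unitVal, adj_map_targetMap, one_mul, targetMap_targetMap]

theorem lin_oneHom_unitOne : lin (oneHom f) (unitOne k H) = pr f 1 := by
  change pr f (f (unitVal k H (unitOne k H))) = _
  rw [unitVal_unitOne, map_one]

theorem isLinearMap_transCounit : IsLinearMap k (transCounit f) := by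
  have : transCounit f = fun l => sw (Δ k (1 : H)) fun a b => ε k (f a * l) • b :=
    funext fun l => transCounit_eq_sw f l
  rw [this]
  fun_prop

/-- Equalities in the unit object can be tested after f, where the counit is simply ε_t. -/
theorem map_unitVal_injective {z w : (unit k H).carrier}
    (h : f (unitVal k H z) = f (unitVal k H w)) : z = w := by
  apply unitVal_injective
  rw [← targetMap_unitVal, ← targetMap_unitVal w] at h ⊢
  exact map_targetMap_injective f h

/-- The counit of the centralizer as a linear map. -/
noncomputable def counitLin : (centralizerMod f).carrier →ₗ[k] (unit k H).carrier :=
  toUnit k H ∘ₗ (isLinearMap_transCounit f).mk' ∘ₗ val f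

theorem unitVal_counitLin (x : (centralizerMod f).carrier) :
    unitVal k H (counitLin f x) = transCounit f (val f x) := targetMap_transCounit f _

theorem map_unitVal_counitLin (x : (centralizerMod f).carrier) :
    f (unitVal k H (counitLin f x)) = targetMap k (val f x) := by
  rw [unitVal_counitLin, map_transCounit]

/-- The counit `l ↦ ε(f(1₁) l) 1₂`. -/
noncomputable def counitHom : centralizerMod f ⟶ unit k H where
  toLin := counitLin f
  comm h x := map_unitVal_injective f (by
    rw [map_unitVal_counitLin, unit_ρ, map_targetMap, map_mul, map_unitVal_counitLin, val_ρ,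
      targetMap_adj (val_mem x), targetMap_mul_targetMap])

theorem map_unitVal_counitHom (x : (centralizerMod f).carrier) :
    f (unitVal k H (lin (counitHom f) x)) = targetMap k (val f x) := map_unitVal_counitLin f x

variable [Quasitriangular k H]

/-- The transmuted coproduct as a linear map. -/
noncomputable def comulLin : (centralizerMod f).carrier →ₗ[k]
    (tensor (centralizerMod f) (centralizerMod f)).carrier :=
  (proj _ _ ∘ₗ TensorProduct.map (pr f) (pr f)) ∘ₗ (isLinearMap_transComul f).mk' ∘ₗ val f

theorem comulLin_eq_sw (x : (centralizerMod f).carrier) :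
    comulLin f x = sw (transComul f (val f x)) fun a b => tm (pr f a) (pr f b) := by
  change proj _ _ (TensorProduct.map (pr f) (pr f) (transComul f (val f x))) = _
  conv_lhs => rw [← sw_tmul_self (transComul f (val f x))]
  rw [map_sw, map_sw]
  rfl

/-- The coproduct `l ↦ l₁ f(S(R⁽²⁾)) ⊗ R⁽¹⁾ · l₂`. -/
noncomputable def comulHom :
    centralizerMod f ⟶ tensor (centralizerMod f) (centralizerMod f) where
  toLin := comulLin f
  comm h x := by
    rw [comulLin_eq_sw, comulLin_eq_sw, val_ρ, map_sw]
    simp only [tensor_ρ_tm, ← pr_adj]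
    refine Eq.trans ?_ (sw_comm _ _ _)
    exact sw_transComul_adj f h (val f x) (F := fun a b => tm (pr f a) (pr f b))

theorem lin_comulHom (x : (centralizerMod f).carrier) :
    lin (comulHom f) x = sw (transComul f (val f x)) fun a b => tm (pr f a) (pr f b) :=
  comulLin_eq_sw f x

/-- The projections and the Δ(1) used to define the morphism act trivially, because the coproduct of
an element of C is already fixed by Δ(1). -/
theorem map_val_incl_comulHom (x : (centralizerMod f).carrier) :
    TensorProduct.map (val f) (val f) (incl _ _ (lin (comulHom f) x)) =
      transComul f (val f x) := by
  rw [lin_comulHom, map_sw, map_sw]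
  simp only [incl_tm, map_sw, TensorProduct.map_tmul, val_ρ, val_pr, ← adj_mul, mul_one]
  rw [sw_comm]
  refine (Eq.symm (sw_transComul_eq_adj (val_mem x) (F := fun a b => a ⊗ₜ[k] b))).trans
    (sw_tmul_self _)

/-- The transmuted antipode. -/
noncomputable def antipodeHom : centralizerMod f ⟶ centralizerMod f where
  toLin := pr f ∘ₗ (isLinearMap_transAntipode f).mk' ∘ₗ val f
  comm h x := by
    change pr f (transAntipode f (val f ((centralizerMod f).ρ h x))) =
      (centralizerMod f).ρ h (pr f (transAntipode f (val f x)))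
    rw [val_ρ, transAntipode_adj, pr_adj]

theorem val_antipodeHom (x : (centralizerMod f).carrier) :
    val f (lin (antipodeHom f) x) = transAntipode f (val f x) :=
  val_pr_of_mem (transAntipode_mem (val_mem x))

end centralizerMod

end CentralizerModule


/-! ### Braided monoid, comonoid, bimonoid and Hopf axioms. -/

section CentralizerHopf

open LMod MonoidalCategory

variable {k : Type v} {H L : Type u} [Field k] [Ring H] [Algebra k H] [QuantumGroupoid k H]
  [Ring L] [Algebra k L] [QuantumGroupoid k L] (f : H →ₐc[k] L)

namespace centralizerMod

noncomputable instance instMonObj : MonObj (centralizerMod f) where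
  one := oneHom f
  mul := mulHom f
  one_mul := hom_ext (tm_ext fun z x => val_injective (by
    change val f (lin (mulHom f) (lin (tensorMap (oneHom f) (𝟙 _)) (tm z x))) =
      val f (lin (leftUnitIso _).hom (tm z x))
    rw [tensorMap_tm, val_mulHom_tm, leftUnitIso_hom_tm, val_ρ, val_oneHom, lin_id,
      ← targetMap_unitVal z, adj_targetMap, adj_one_of_mem (val_mem x)]))
  mul_one := hom_ext (tm_ext fun x z => val_injective (by
    change val f (lin (mulHom f) (lin (tensorMap (𝟙 _) (oneHom f)) (tm x z))) =
      val f (lin (rightUnitIso _).hom (tm x z))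
    rw [tensorMap_tm, val_mulHom_tm, rightUnitIso_hom_tm, val_ρ, val_oneHom, lin_id,
      ← targetMap_unitVal z, S_symm_targetMap, adj_barTargetMap, map_targetMap,
      adj_one_of_mem (mul_mem (val_mem x) (targetMap_mem _))]))
  mul_assoc := hom_ext (tm_ext_left fun x y z => val_injective (by
    change val f (lin (mulHom f) (lin (tensorMap (mulHom f) (𝟙 _)) (tm (tm x y) z))) =
      val f (lin (mulHom f) (lin (tensorMap (𝟙 _) (mulHom f))
        (lin (assocIso _ _ _).hom (tm (tm x y) z))))
    rw [assocIso_hom_tm, tensorMap_tm, tensorMap_tm, val_mulHom_tm, val_mulHom_tm, val_mulHom_tm,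
      val_mulHom_tm, lin_id, lin_id, mul_assoc]))

variable [Quasitriangular k H]

noncomputable instance instComonObj : ComonObj (centralizerMod f) where
  counit := counitHom f
  comul := comulHom f
  -- The law involves the inverse unitor; composing with the unitor leaves the identity ε_t(l₁) l₂ =
  -- l for the transmuted coproduct.
  counit_comul := (Iso.comp_hom_eq_id (λ_ (centralizerMod f))).1 (hom_ext fun x => by
    refine val_injective (Eq.trans ?_ (sw_transComul_targetMap_mul (f := f) (val_mem x)))
    change val f (lin (leftUnitIso _).hom (lin (tensorMap (counitHom f) (𝟙 _))
      (lin (comulHom f) x))) = _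
    rw [lin_comulHom, map_sw, map_sw, map_sw]
    refine Eq.trans (sw_congr fun a b => ?_)
      (sw_transComul_adj_one (f := f) (val_mem x) (F := fun a b => targetMap k a * b))
    rw [tensorMap_tm, leftUnitIso_hom_tm, lin_id, val_ρ, val_pr, ← targetMap_unitVal,
      adj_targetMap, targetMap_unitVal, map_unitVal_counitHom, val_pr, ← adj_mul, one_mul])
  comul_counit := (Iso.comp_hom_eq_id (ρ_ (centralizerMod f))).1 (hom_ext fun x => by
    refine val_injective (Eq.trans ?_ (sw_transComul_mul_targetMap (f := f) (val_mem x)))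
    change val f (lin (rightUnitIso _).hom (lin (tensorMap (𝟙 _) (counitHom f))
      (lin (comulHom f) x))) = _
    rw [lin_comulHom, map_sw, map_sw, map_sw]
    refine Eq.trans (sw_congr fun a b => ?_)
      (sw_transComul_adj_one (f := f) (val_mem x) (F := fun a b => a * targetMap k b))
    rw [tensorMap_tm, rightUnitIso_hom_tm, lin_id, val_ρ, val_pr, ← targetMap_unitVal,
      S_symm_targetMap, adj_barTargetMap, targetMap_unitVal, map_unitVal_counitHom, val_pr,
      adj_one_of_mem (mul_mem (adj_mem f 1 a) (targetMap_mem _))])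
  comul_assoc := hom_ext fun x => by
    change lin (tensorMap (𝟙 _) (comulHom f)) (lin (comulHom f) x) =
      lin (assocIso _ _ _).hom (lin (tensorMap (comulHom f) (𝟙 _)) (lin (comulHom f) x))
    rw [lin_comulHom, map_sw, map_sw, map_sw]
    have key := sw_transComul_coassoc f (val f x)
      (F := fun a b c => tm (pr f a) (tm (pr f b) (pr f c)))
    refine Eq.trans ?_ (key.symm.trans ?_)
    · refine Eq.trans (sw_congr fun a b => ?_) (sw_transComul_adj_one (f := f) (val_mem x)
        (F := fun a b => sw (transComul f b) fun c d => tm (pr f a) (tm (pr f c) (pr f d))))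
      rw [tensorMap_tm, lin_id, lin_comulHom, val_pr, pr_adj_one,
        apply_sw (k := k) (G := fun t => tm (pr f a) t)]
    · refine Eq.trans (Eq.symm (sw_transComul_adj_one (f := f) (val_mem x)
        (F := fun a b => sw (transComul f a) fun c d => tm (pr f c) (tm (pr f d) (pr f b)))))
        (sw_congr fun a b => ?_)
      rw [tensorMap_tm, lin_id, lin_comulHom, val_pr, pr_adj_one,
        apply_sw (k := k) (G := fun t => lin (assocIso (centralizerMod f) (centralizerMod f)
          (centralizerMod f)).hom (tm t (pr f b)))]
      exact sw_congr fun c d => (assocIso_hom_tm _ _ _ _ _ _).symm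

noncomputable instance instBimonObj : BimonObj (centralizerMod f) where
  mul_comul := hom_ext (tm_ext fun x y => by
    change lin (comulHom f) (lin (mulHom f) (tm x y)) =
      lin (tensorμ _ _ _ _ ≫ tensorMap (mulHom f) (mulHom f))
        (lin (tensorMap (comulHom f) (comulHom f)) (tm x y))
    -- Only linearity of this composite matters until both coproduct sums have been taken outside
    -- it.
    obtain ⟨Ψ, hΨ⟩ : ∃ Ψ : (tensor (tensor (centralizerMod f) (centralizerMod f))
      (tensor (centralizerMod f) (centralizerMod f))).carrier →ₗ[k]
        (tensor (centralizerMod f) (centralizerMod f)).carrier, lin (tensorμ (centralizerMod f) (centralizerMod f) (centralizerMod f)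
      (centralizerMod f) ≫ tensorMap (mulHom f) (mulHom f)) = Ψ := ⟨_, rfl⟩
    rw [hΨ, tensorMap_tm, lin_comulHom, lin_comulHom, lin_comulHom, val_mulHom_tm,
      sw_transComul_mul f (val_mem x) (val_mem y) (by fun_prop) (by fun_prop),
      apply_sw (k := k) (G := fun t =>
        Ψ (tm t (sw (transComul f (val f y)) fun a b => tm (pr f a) (pr f b))))]
    -- The legs of both coproducts are projected into C, matching the elements on which the
    -- composite is evaluated.
    refine Eq.trans (Eq.symm (sw_transComul_adj_one (f := f) (val_mem x)
      (F := fun a₁ a₂ => sw (transComul f (val f y)) fun b₁ b₂ =>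
        sw (Quasitriangular.R : H ⊗[k] H) fun p q =>
          tm (pr f (a₁ * adj f q b₁)) (pr f (adj f p a₂ * b₂))))) (sw_congr fun a₁ a₂ => ?_)
    rw [apply_sw (k := k) (G := fun t => Ψ (tm (tm (pr f a₁) (pr f a₂)) t))]
    refine Eq.trans (Eq.symm (sw_transComul_adj_one (f := f) (val_mem y)
      (F := fun b₁ b₂ => sw (Quasitriangular.R : H ⊗[k] H) fun p q =>
          tm (pr f (adj f 1 a₁ * adj f q b₁)) (pr f (adj f p (adj f 1 a₂) * b₂)))))
      (sw_congr fun b₁ b₂ => ?_)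
    rw [← hΨ, lin_comp]
    refine Eq.trans ?_ (congrArg _ (lin_tensorμ_tm _ _ _ _ _ _ _ _)).symm
    rw [map_sw]
    refine sw_congr fun p q => ?_
    rw [tensorMap_tm]
    congr 1
    all_goals
      refine val_injective ?_
      rw [val_mulHom_tm, val_ρ, val_pr, val_pr, val_pr,
        adj_one_of_mem (mul_mem (adj_mem f _ _) (adj_mem f _ _))])
  one_comul := hom_ext_unit (by
    change lin (comulHom f) (lin (oneHom f) (unitOne k H)) =
      lin (tensorMap (oneHom f) (oneHom f)) (tm (unitOne k H) (unitOne k H))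
    rw [tensorMap_tm, lin_oneHom_unitOne, lin_comulHom, val_pr, adj_one_of_mem (one_mem _),
      sw_transComul_one f (by fun_prop) (by fun_prop)]
    simp only [pr_adj]
    exact sw_e_tm _ _)
  mul_counit := hom_ext (tm_ext fun x y => map_unitVal_injective f (by
    change f (unitVal k H (lin (counitHom f) (lin (mulHom f) (tm x y)))) =
      f (unitVal k H (lin (leftUnitIso _).hom
        (lin (tensorMap (counitHom f) (counitHom f)) (tm x y))))
    rw [tensorMap_tm, leftUnitIso_hom_tm, map_unitVal_counitHom, val_mulHom_tm, unit_ρ,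
      targetMap_mul_of_mem (val_mem x), map_targetMap, map_mul f, map_unitVal_counitHom,
      map_unitVal_counitHom]))
  one_counit := hom_ext fun z => map_unitVal_injective f (by
    change f (unitVal k H (lin (counitHom f) (lin (oneHom f) z))) = f (unitVal k H z)
    rw [map_unitVal_counitHom, val_oneHom, ← map_targetMap, targetMap_unitVal])

noncomputable instance instHopfObj : HopfObj (centralizerMod f) where
  antipode := antipodeHom f
  antipode_left := hom_ext fun x => val_injective (by
    change val f (lin (mulHom f) (lin (tensorMap (antipodeHom f) (𝟙 _)) (lin (comulHom f) x))) =
      val f (lin (oneHom f) (lin (counitHom f) x))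
    rw [val_oneHom, map_unitVal_counitHom, ← sw_transAntipode_mul (f := f) (val_mem x),
      lin_comulHom, map_sw, map_sw, map_sw]
    refine Eq.trans (sw_congr fun a b => ?_)
      (sw_transComul_adj_one (f := f) (val_mem x) (F := fun a b => transAntipode f a * b))
    rw [tensorMap_tm, val_mulHom_tm, val_antipodeHom, lin_id, val_pr, val_pr])
  antipode_right := hom_ext fun x => val_injective (by
    change val f (lin (mulHom f) (lin (tensorMap (𝟙 _) (antipodeHom f)) (lin (comulHom f) x))) =
      val f (lin (oneHom f) (lin (counitHom f) x))
    rw [val_oneHom, map_unitVal_counitHom, ← sw_transComul_mul_transAntipode (f := f) (val_mem x),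
      lin_comulHom, map_sw, map_sw, map_sw]
    refine Eq.trans (sw_congr fun a b => ?_)
      (sw_transComul_adj_one (f := f) (val_mem x) (F := fun a b => a * transAntipode f b))
    rw [tensorMap_tm, val_mulHom_tm, val_antipodeHom, lin_id, val_pr, val_pr])

end centralizerMod

end CentralizerHopf

end QG

theorem theorem2p4 {k : Type v} {H L : Type u} [Field k]
    [Ring H] [Algebra k H] [QG.QuantumGroupoid k H] [QG.Quasitriangular k H]
    [Ring L] [Algebra k L] [QG.QuantumGroupoid k L] (f : H →ₐc[k] L) :
    ∃ (ρ : H →ₐ[k] Module.End k (QG.sourceCentralizer k L)) (A : HopfObj (QG.LMod.of ρ)),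
      (∀ (h : H) (l : QG.sourceCentralizer k L), (ρ h l : L) = QG.adj f h l) ∧
      (∀ a b : QG.sourceCentralizer k L,
        QG.LMod.lin A.mul (QG.LMod.tm (X := QG.LMod.of ρ) (Y := QG.LMod.of ρ) a b) = a * b) ∧
      (∀ z : QG.targetSpace k H,
        (QG.LMod.lin A.one z : QG.sourceCentralizer k L) = f z) ∧
      (∀ l : QG.sourceCentralizer k L,
        TensorProduct.map (QG.sourceCentralizer k L).val.toLinearMap
          (QG.sourceCentralizer k L).val.toLinearMap
          (QG.LMod.incl (QG.LMod.of ρ) (QG.LMod.of ρ) (QG.LMod.lin A.comul l)) =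
            QG.transComul f l) ∧
      (∀ l : QG.sourceCentralizer k L,
        QG.LMod.unitVal k H (QG.LMod.lin A.counit l) = QG.transCounit f l) ∧
      (∀ l : QG.sourceCentralizer k L,
        (QG.LMod.lin A.antipode l : QG.sourceCentralizer k L) = QG.transAntipode f l) := by
  exact ⟨QG.adjHom f, QG.centralizerMod.instHopfObj f, fun _ _ => rfl,
    fun a b => Subtype.ext (QG.centralizerMod.val_mulHom_tm f a b),
    QG.centralizerMod.val_oneHom f, QG.centralizerMod.map_val_incl_comulHom f,
    QG.centralizerMod.unitVal_counitLin f, QG.centralizerMod.val_antipodeHom f⟩
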